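/- **First variation formula.** Let $M$ be a compact smooth Riemannian manifold of dimension $n$ (without boundary), with Levi-Civita connection $\nabla$ and Riemannian volume $dv$, and let $z$ be a square integrable differential form on $M$ (possibly a sum of forms of different degrees), $\|z\|^2=\int_M|z|^2\,dv$. For a local orthonormal frame $\{v_j\}$ with dual coframe $\{\omega^j\}$ let $e(\omega)$ be left exterior multiplication by $\omega$, $i_v$ interior multiplication by $v$, $c(\omega^j)=e(\omega^j)-i_{v_j}$, $\hat c(\omega^j)=e(\omega^j)+i_{v_j}$. For a vector field $X$ put $X^j_{;m}=\omega^j(\nabla_{v_m}X)$, and write $\nabla_{v_i}v_j=\sum_k\gamma^k_{ij}v_k$. 1. Suppose that for the flow $\phi_t$ of every smooth vector field $X$ on $M$ the function $t\mapsto\|\phi_t^*z\|^2$ has derivative $0$ at $t=0$. Then for every smooth vector field $X$ $$0=\Big\langle z,\ \sum_{j,m}(X^j_{;m}+X^m_{;j})\,c(\omega^j)\,\hat c(\omega^m)\,z\Big\rangle_{L^2}.\qquad(*)$$ (The integrand does not depend on the orthonormal frame.) 2. Suppose that $(*)$ holds for every smooth vector field $X$. Let $U\subset M$ be open, let $z$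 be smooth on $U$, and let $\{v_j\}_{j=1}^n$ be a smooth orthonormal frame on $U$ in which the form $Q(v,w)=\langle i_vz,i_wz\rangle$ is diagonal, that is, $\langle i_{v_j}z,i_{v_m}z\rangle=0$ on $U$ for $j\neq m$. Then on $U$, for each $j$ (no sum over $j$), $$v_j\big(|i_{v_j}z|^2-\tfrac12|z|^2\big)=\sum_m\gamma^j_{mm}\big(|i_{v_j}z|^2-|i_{v_m}z|^2\big).\qquad(**)$$ 3. Let $n=4$, and let $U\subset M$ be open with a smooth orthonormal frame $\{e_i\}_{i=1}^4$, with dual coframe $\{w^i\}$, such that $z$ is smooth on $U$ and $z=a\,w^1\wedge w^2+b\,w^3\wedge w^4$ on $U$ with $b^2<a^2$. Let $f=\ln\sqrt{a^2-b^2}$ and, with the $\gamma^k_{ij}$ of this frame, $$H_a=\sum_{k=3,4}(\gamma^k_{11}+\gamma^k_{22})e_k,\qquad H_b=\sum_{k=1,2}(\gamma^k_{33}+\gamma^k_{44})e_k.$$ Then at each point of $U$ the equations $(**)$ for the frame $\{e_i\}$ hold for all $j$ if and only if $\nabla f=H_a+H_b$. In particular, if $(*)$ holds for every smooth vector field $X$,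 then $\nabla f=H_a+H_b$ on $U$. -/

import Mathlib

open Set Filter MeasureTheory Manifold Bundle
open scoped Topology ContDiff

noncomputable section

namespace FirstVar

/-! ### Linear algebra: the exterior algebra of the dual of a Euclidean space -/

section Algebra

/-- Exterior forms of all degrees on `V`: the component in degree `k` of `α` is `α k`. -/
abbrev Forms (V : Type*) [NormedAddCommGroup V] [NormedSpace ℝ V] : Type _ :=
  (k : ℕ) → V [⋀^Fin k]→L[ℝ] ℝ

variable {V : Type*} [NormedAddCommGroup V] [InnerProductSpace ℝ V]

/-- The form `1` of degree zero. -/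
def oneForm : Forms V :=
  Pi.single 0 (ContinuousAlternatingMap.constOfIsEmpty ℝ V (Fin 0) (1 : ℝ))

/-- Exterior multiplication on the left by a covector `w`, in degree `k`:
`(w ∧ α)(u₀, …, u_k) = ∑ i, (-1)^i w(u_i) α(u₀, …, û_i, …, u_k)`. -/
def wedgeLeft {k : ℕ} (w : V →L[ℝ] ℝ) (α : V [⋀^Fin k]→L[ℝ] ℝ) :
    V [⋀^Fin (k + 1)]→L[ℝ] ℝ :=
  ContinuousAlternatingMap.alternatizeUncurryFin (w.smulRight α)

/-- Exterior multiplication `e(w)` on forms of all degrees. -/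
def extMul (w : V →L[ℝ] ℝ) (α : Forms V) : Forms V
  | 0 => 0
  | k + 1 => wedgeLeft w (α k)

/-- Interior multiplication `i_v` on forms of all degrees: `(i_v α)(u₁, …) = α(v, u₁, …)`. -/
def intMul (v : V) (α : Forms V) : Forms V :=
  fun k => (α (k + 1)).curryLeft v

/-- The covector `⟨v, ·⟩` dual to the vector `v`. -/
def flat (v : V) : V →L[ℝ] ℝ := innerSL ℝ v

/-- Clifford multiplication `c(ω) = e(ω) - i_v`, where `ω = ⟨v, ·⟩`. -/
def cliff (v : V) (α : Forms V) : Forms V := extMul (flat v) α - intMul v α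

/-- The operator `ĉ(ω) = e(ω) + i_v`, where `ω = ⟨v, ·⟩`. -/
def cliffHat (v : V) (α : Forms V) : Forms V := extMul (flat v) α + intMul v α

variable [FiniteDimensional ℝ V]

/-- The inner product of two `k`-forms, `(1/k!) ∑ α(b_{i₁}, …, b_{i_k}) β(b_{i₁}, …, b_{i_k})` for
an orthonormal basis `b`; the forms `ω^{i₁} ∧ ⋯ ∧ ω^{i_k}` with `i₁ < ⋯ < i_k` are orthonormal. -/
def innerDeg {k : ℕ} (α β : V [⋀^Fin k]→L[ℝ] ℝ) : ℝ :=
  (k.factorial : ℝ)⁻¹ * ∑ i : Fin k → Fin (Module.finrank ℝ V),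
    α (fun l => stdOrthonormalBasis ℝ V (i l)) * β (fun l => stdOrthonormalBasis ℝ V (i l))

/-- The inner product of forms, different degrees being orthogonal (degrees above `dim V` are
zero). -/
def innerForms (α β : Forms V) : ℝ :=
  ∑ k ∈ Finset.range (Module.finrank ℝ V + 1), innerDeg (α k) (β k)

/-- `|α|²`. -/
def normSq (α : Forms V) : ℝ := innerForms α α

end Algebra

/-! ### Riemannian manifolds -/

section Manifold

variable {n : ℕ} {M : Type*} [TopologicalSpace M] [ChartedSpace (EuclideanSpace ℝ (Fin n)) M]
  [IsManifold (𝓡 n) ∞ M]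

instance (x : M) : FiniteDimensional ℝ (TangentSpace (𝓡 n) x) :=
  inferInstanceAs (FiniteDimensional ℝ (EuclideanSpace ℝ (Fin n)))

/-- `X` is a smooth vector field. -/
def SmoothField (X : (x : M) → TangentSpace (𝓡 n) x) : Prop :=
  ContMDiff (𝓡 n) (𝓡 n).tangent ∞ (fun x => (⟨x, X x⟩ : TangentBundle (𝓡 n) M))

/-- `φ` is the flow of the vector field `X`: `φ 0` is the identity and `t ↦ φ t x` is the integral
curve of `X` through `x`. -/
def IsFlow (X : (x : M) → TangentSpace (𝓡 n) x) (φ : ℝ → M → M) : Prop :=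
  (∀ x, φ 0 x = x) ∧ ∀ x, IsMIntegralCurve (I := 𝓡 n) (fun t => φ t x) X

variable [RiemannianBundle (fun x : M => TangentSpace (𝓡 n) x)]

/-! #### The Levi-Civita connection -/

/-- Half the right-hand side of Koszul's formula for `2 ⟨∇_Y X, Z⟩`, at `x`. -/
def koszul (Y X Z : (x : M) → TangentSpace (𝓡 n) x) (x : M) : ℝ :=
  (1 / 2) *
    (mvfderiv (𝓡 n) (fun p => (inner ℝ (X p) (Z p) : ℝ)) x (Y x)
      + mvfderiv (𝓡 n) (fun p => (inner ℝ (Z p) (Y p) : ℝ)) x (X x)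
      - mvfderiv (𝓡 n) (fun p => (inner ℝ (Y p) (X p) : ℝ)) x (Z x)
      + inner ℝ (VectorField.mlieBracket (𝓡 n) Y X x) (Z x)
      - inner ℝ (VectorField.mlieBracket (𝓡 n) X Z x) (Y x)
      + inner ℝ (VectorField.mlieBracket (𝓡 n) Z Y x) (X x))

/-- The Levi-Civita covariant derivative `∇_v X` at `x`, for `v` in `T_x M`: its inner product with
a vector `w` is given by Koszul's formula, `v` and `w` being extended to vector fields that are
smooth near `x`. -/
def leviCivita (X : (x : M) → TangentSpace (𝓡 n) x) (x : M) (v : TangentSpace (𝓡 n) x) :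
    TangentSpace (𝓡 n) x :=
  ∑ j, koszul (FiberBundle.extend (EuclideanSpace ℝ (Fin n)) v) X
      (FiberBundle.extend (EuclideanSpace ℝ (Fin n))
        (stdOrthonormalBasis ℝ (TangentSpace (𝓡 n) x) j)) x •
    stdOrthonormalBasis ℝ (TangentSpace (𝓡 n) x) j

/-- The gradient of a function. -/
def grad (f : M → ℝ) (x : M) : TangentSpace (𝓡 n) x :=
  ∑ j, mvfderiv (𝓡 n) f x (stdOrthonormalBasis ℝ (TangentSpace (𝓡 n) x) j) •
    stdOrthonormalBasis ℝ (TangentSpace (𝓡 n) x) j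

/-! #### Differential forms -/

/-- The form `z` is smooth on `U`: it takes smooth values on smooth vector fields. -/
def SmoothFormOn (z : (x : M) → Forms (TangentSpace (𝓡 n) x)) (U : Set M) : Prop :=
  ∀ (k : ℕ) (X : Fin k → (x : M) → TangentSpace (𝓡 n) x), (∀ i, SmoothField (X i)) →
    ContMDiffOn (𝓡 n) 𝓘(ℝ, ℝ) ∞ (fun x => z x k fun i => X i x) U

/-- The pullback `φ^* z`. -/
def pullback (φ : M → M) (z : (x : M) → Forms (TangentSpace (𝓡 n) x)) (x : M) :
    Forms (TangentSpace (𝓡 n) x) :=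
  fun k => (z (φ x) k).compContinuousLinearMap (mfderiv (𝓡 n) (𝓡 n) φ x)

/-! #### Frames -/

variable {ι : Type*}

/-- `v` restricts to a smooth orthonormal frame of the tangent bundle on `U`. -/
def IsOrthonormalFrameOn (v : ι → (x : M) → TangentSpace (𝓡 n) x) (U : Set M) : Prop :=
  IsLocalFrameOn (𝓡 n) (EuclideanSpace ℝ (Fin n)) ∞ v U ∧ ∀ x ∈ U, Orthonormal ℝ fun i => v i x

/-- The connection coefficients of a frame: `∇_{v_i} v_j = ∑ k, γ^k_{ij} v_k`, written
`conn v i j k` for `γ^k_{ij}`. -/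
def conn (v : ι → (x : M) → TangentSpace (𝓡 n) x) (i j k : ι) (x : M) : ℝ :=
  inner ℝ (leviCivita (v j) x (v i x)) (v k x)

/-- The bilinear form `Q(v, w) = ⟨i_v z, i_w z⟩` is diagonal in the frame at each point of `U`. -/
def DiagonalizesOn (v : ι → (x : M) → TangentSpace (𝓡 n) x)
    (z : (x : M) → Forms (TangentSpace (𝓡 n) x)) (U : Set M) : Prop :=
  ∀ x ∈ U, ∀ j m, j ≠ m → innerForms (intMul (v j x) (z x)) (intMul (v m x) (z x)) = 0

/-- The pointwise equations at `x`: for each `j`,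
`v_j(|i_{v_j} z|² - |z|²/2) = ∑ m, γ^j_{mm} (|i_{v_j} z|² - |i_{v_m} z|²)`. -/
def PointwiseEq [Fintype ι] (v : ι → (x : M) → TangentSpace (𝓡 n) x)
    (z : (x : M) → Forms (TangentSpace (𝓡 n) x)) (x : M) : Prop :=
  ∀ j, mvfderiv (𝓡 n) (fun p => normSq (intMul (v j p) (z p)) - (1 / 2) * normSq (z p)) x (v j x) =
    ∑ m, conn v m m j x * (normSq (intMul (v j x) (z x)) - normSq (intMul (v m x) (z x)))

/-- The mean curvature vector `H_a = ∑_{k = 3, 4} (γ^k_{11} + γ^k_{22}) e_k` of the distribution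
spanned by `e_1, e_2` (here numbered `e 0, e 1`, and `e 2, e 3` for `e_3, e_4`). -/
def meanCurvA (e : Fin 4 → (x : M) → TangentSpace (𝓡 n) x) (x : M) : TangentSpace (𝓡 n) x :=
  (conn e 0 0 2 x + conn e 1 1 2 x) • e 2 x + (conn e 0 0 3 x + conn e 1 1 3 x) • e 3 x

/-- The mean curvature vector `H_b = ∑_{k = 1, 2} (γ^k_{33} + γ^k_{44}) e_k` of the distribution
spanned by `e_3, e_4`. -/
def meanCurvB (e : Fin 4 → (x : M) → TangentSpace (𝓡 n) x) (x : M) : TangentSpace (𝓡 n) x :=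
  (conn e 2 2 0 x + conn e 3 3 0 x) • e 0 x + (conn e 2 2 1 x + conn e 3 3 1 x) • e 1 x

/-! #### The Riemannian volume -/

/-- The determinant `det (g_ij)` of the metric in the coordinates of the chart at `c`, at the
point of coordinates `y`. -/
def gramDet (c : M) (y : EuclideanSpace ℝ (Fin n)) : ℝ :=
  (Matrix.of fun i j : Fin n =>
    let χ := (chartAt (EuclideanSpace ℝ (Fin n)) c).symm
    (inner ℝ (mfderiv (𝓡 n) (𝓡 n) χ y (EuclideanSpace.single i (1 : ℝ)) : TangentSpace (𝓡 n) (χ y))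
      (mfderiv (𝓡 n) (𝓡 n) χ y (EuclideanSpace.single j (1 : ℝ)) : TangentSpace (𝓡 n) (χ y)) :
        ℝ)).det

variable [MeasurableSpace M]

/-- The measure `√det g dy` in the domain of the chart at `c`, extended by zero. -/
def chartVolume (c : M) : Measure M :=
  ((((volume : Measure (EuclideanSpace ℝ (Fin n))).restrict
      (chartAt (EuclideanSpace ℝ (Fin n)) c).target).withDensity
        fun y => ENNReal.ofReal (Real.sqrt (gramDet c y)))).map
    (chartAt (EuclideanSpace ℝ (Fin n)) c).symm

variable (n M) in
/-- The Riemannian volume: the smallest measure that dominates `√det g dy` in each chart. As these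
measures agree on the overlaps of the charts, it coincides with `√det g dy` in each chart. -/
def riemVol : Measure M := ⨆ c : M, chartVolume (n := n) c

/-! #### The first variation -/

/-- `z` is a square integrable form: its components are measurable and `|z|²` is integrable. -/
def IsL2Form (z : (x : M) → Forms (TangentSpace (𝓡 n) x)) : Prop :=
  (∀ (k : ℕ) (X : Fin k → (x : M) → TangentSpace (𝓡 n) x), (∀ i, SmoothField (X i)) →
    AEStronglyMeasurable (fun x => z x k fun i => X i x) (riemVol n M)) ∧
  Integrable (fun x => normSq (z x)) (riemVol n M)

/-- `‖z‖²` in `L²`. -/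
def energy (z : (x : M) → Forms (TangentSpace (𝓡 n) x)) : ℝ :=
  ∫ x, normSq (z x) ∂(riemVol n M)

/-- `t ↦ ‖φ_t^* z‖²` is critical at `t = 0` for the flow `φ` of each smooth vector field. -/
def IsCritical (z : (x : M) → Forms (TangentSpace (𝓡 n) x)) : Prop :=
  ∀ (X : (x : M) → TangentSpace (𝓡 n) x) (φ : ℝ → M → M), SmoothField X → IsFlow X φ →
    HasDerivAt (fun t => energy (pullback (φ t) z)) 0 0

/-- The pointwise inner product `⟨z, (X^j_{;m} + X^m_{;j}) c(ω^j) ĉ(ω^m) z⟩` at `x`, summed over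
`j` and `m`, in an orthonormal frame `b` with dual coframe `ω`; `X^j_{;m} = ⟨∇_{b_m} X, b_j⟩`. -/
def firstVarDensity (z : (x : M) → Forms (TangentSpace (𝓡 n) x))
    (X : (x : M) → TangentSpace (𝓡 n) x) (x : M) : ℝ :=
  let b := stdOrthonormalBasis ℝ (TangentSpace (𝓡 n) x)
  innerForms (z x) (∑ j, ∑ m,
    ((inner ℝ (leviCivita X x (b m)) (b j) : ℝ) + inner ℝ (leviCivita X x (b j)) (b m)) •
      cliff (b j) (cliffHat (b m) (z x)))

/-- `⟨z, (X^j_{;m} + X^m_{;j}) c(ω^j) ĉ(ω^m) z⟩` in `L²`. -/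
def firstVar (z : (x : M) → Forms (TangentSpace (𝓡 n) x))
    (X : (x : M) → TangentSpace (𝓡 n) x) : ℝ :=
  ∫ x, firstVarDensity z X x ∂(riemVol n M)

end Manifold

end FirstVar

end

/-! Let `X` be supported in one chart, with flow φ_t. The form `z` is only square integrable, so
φ_t^*z cannot be differentiated in t pointwise. The change of variables by φ_{-t} removes this
difficulty: ‖φ_t^*z‖² is the integral of |z|² for the fixed form `z`, with norm and volume taken in
the smooth metric φ_{-t}^*g. Only the metric now depends on t, and its derivative at t = 0 is -S,
where S(v, w) = ⟨∇_v X, w⟩ + ⟨∇_w X, v⟩ is the Lie derivative of g. With Q(v, w) = ⟨i_v z, i_w z⟩,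
the derivative of |z|² dv is (⟨S, Q⟩ - ½ tr S |z|²) dv (`hasDerivAt_componentNormSq_mul_sqrt_det`,
`hasDerivAt_pulledDensity`). Since e and i are adjoint, the symmetric part of ⟨z, c(v) ĉ(w) z⟩ is
2Q(v, w) - ⟨v, w⟩|z|² (`innerForms_sum_cliff`), so this derivative is half the integrand of (*).

Differentiation under the integral sign is justified by a multiple of |z|² as dominating function
(`exists_pulledDensity_lipschitz`), which gives `exists_flow_hasDerivAt_energy`. A general `X` is
split by a partition of unity. Flows do not add, but the integrand of (*) is linear in `X`, and this
suffices (`firstVar_eq_zero_of_isCritical`).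

For the pointwise equations, (*) is tested on X = f v_j with f supported in a small open set. As Q
is diagonal, only v_j(f) and the coefficients γ^j_{ii} enter (`firstVarDensity_smul_frame`). The
derivative of f has to be integrated by parts. The divergence theorem needed for this is the first
variation formula itself, applied to the form 1, whose energy is constant along every flow
(`firstVar_oneForm`). The result is ∫ f T = 0, where T is the difference of the two sides of (**).
Since T is continuous and f arbitrary, T vanishes (`pointwiseEq_of_firstVar_eq_zero`).

In dimension four, |i_{e_j} z|² is a² for j = 1, 2 and b² for j = 3, 4, and |z|² = a² + b². Each
equation of (**) then has the common factor a² - b², and division by it gives the components of ∇f =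
H_a + H_b (`pointwiseEq_iff_grad_eq`). -/

set_option linter.unusedSectionVars false

noncomputable section

namespace FirstVar

/-! ### Gram matrices and change of basis -/

section Gram

variable {V : Type*} [NormedAddCommGroup V] [InnerProductSpace ℝ V]
variable {ι κ : Type*} [Fintype ι] [Fintype κ] [DecidableEq ι] [DecidableEq κ]

/-- The Gram matrix of a family of vectors. -/
def gramMat (u : ι → V) : Matrix ι ι ℝ := Matrix.of fun i j => inner ℝ (u i) (u j)

theorem gramMat_apply (u : ι → V) (i j : ι) : gramMat u i j = inner ℝ (u i) (u j) := rfl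

theorem gramMat_orthonormal {u : ι → V} (hu : Orthonormal ℝ u) : gramMat u = 1 := by
  ext i j
  simp [gramMat_apply, Matrix.one_apply, orthonormal_iff_ite.1 hu]

theorem exists_orthonormal_expansion (u : Module.Basis ι ℝ V) (b : OrthonormalBasis κ ℝ V) :
    ∃ P : Matrix κ ι ℝ, (∀ m, b m = ∑ i, P m i • u i) ∧ P.transpose * P = (gramMat u)⁻¹ ∧
      P * gramMat u * P.transpose = 1 := by
  let P : Matrix κ ι ℝ := Matrix.of fun m i => u.repr (b m) i
  have hP : ∀ m, b m = ∑ i, P m i • u i := fun m => (u.sum_repr (b m)).symm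
  have h1 : P * gramMat u * P.transpose = 1 := by
    ext m l
    have : (inner ℝ (b m) (b l) : ℝ) = (1 : Matrix κ κ ℝ) m l := by
      rw [Matrix.one_apply, orthonormal_iff_ite.1 b.orthonormal]
    rw [← this, hP m, hP l]
    simp only [sum_inner, inner_sum, real_inner_smul_left, real_inner_smul_right,
      Matrix.mul_apply, Matrix.transpose_apply, gramMat_apply, Finset.sum_mul]
    refine Finset.sum_congr rfl fun i _ => Finset.sum_congr rfl fun j _ => ?_
    ring
  have hcard : Fintype.card κ = Fintype.card ι := by
    rw [← Module.finrank_eq_card_basis u, ← Module.finrank_eq_card_basis b.toBasis]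
  refine ⟨P, hP, ?_, h1⟩
  rw [Matrix.mul_assoc] at h1
  -- `P` is formally rectangular; equal cardinalities let a right inverse serve as a left inverse.
  have h2 := (Matrix.mul_eq_one_comm_of_card_eq (R := ℝ) _ _ hcard).1 h1
  rw [Matrix.mul_assoc] at h2
  exact (Matrix.inv_eq_right_inv h2).symm

/-- Passing to an orthonormal basis gives (det P)² det G = 1, which forces det G > 0. -/
theorem gramMat_det_pos (u : Module.Basis ι ℝ V) : 0 < (gramMat u).det := by
  have : FiniteDimensional ℝ V := u.finiteDimensional_of_finite
  have e : Fin (Module.finrank ℝ V) ≃ ι :=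
    Fintype.equivOfCardEq (by simp [Module.finrank_eq_card_basis u])
  obtain ⟨P, -, -, h⟩ := exists_orthonormal_expansion u ((stdOrthonormalBasis ℝ V).reindex e)
  have h' := congrArg Matrix.det h
  rw [Matrix.det_mul, Matrix.det_mul, Matrix.det_transpose, Matrix.det_one] at h'
  by_contra hc
  nlinarith [sq_nonneg P.det, mul_nonneg (sq_nonneg P.det) (not_lt.1 hc |> neg_nonneg.2)]

/-- The trace of a bilinear form in terms of an arbitrary basis. -/
theorem sum_orthonormal_bilin (u : Module.Basis ι ℝ V) (b : OrthonormalBasis κ ℝ V)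
    (B : V →ₗ[ℝ] V →ₗ[ℝ] ℝ) :
    ∑ m, B (b m) (b m) = ((gramMat u)⁻¹ * Matrix.of fun i j => B (u i) (u j)).trace := by
  obtain ⟨P, hP, hPP, -⟩ := exists_orthonormal_expansion u b
  rw [← hPP, Matrix.mul_assoc, Matrix.trace_mul_comm, Matrix.trace]
  refine Finset.sum_congr rfl fun m _ => ?_
  rw [hP m]
  simp only [map_sum, LinearMap.sum_apply, map_smul, LinearMap.smul_apply, smul_eq_mul,
    Matrix.diag_apply, Matrix.mul_apply, Matrix.transpose_apply, Matrix.of_apply, Finset.mul_sum,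
    Finset.sum_mul]
  refine Finset.sum_congr rfl fun i _ => Finset.sum_congr rfl fun j _ => ?_
  ring

theorem sum_mul_eq_trace (A B : Matrix ι κ ℝ) :
    ∑ j, ∑ m, A j m * B j m = (A * B.transpose).trace := by
  simp [Matrix.trace, Matrix.mul_apply]

/-- The pairing of two bilinear forms in terms of an arbitrary basis. -/
theorem sum_orthonormal_bilin_mul (u : Module.Basis ι ℝ V) (b : OrthonormalBasis κ ℝ V)
    (S Q : V →ₗ[ℝ] V →ₗ[ℝ] ℝ) :
    ∑ j, ∑ m, S (b j) (b m) * Q (b j) (b m) =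
      ∑ i, ∑ j, ((gramMat u)⁻¹ * (Matrix.of fun i j => S (u i) (u j)) * (gramMat u)⁻¹) i j *
        Q (u i) (u j) := by
  obtain ⟨P, hP, hPP, -⟩ := exists_orthonormal_expansion u b
  have key : ∀ B : V →ₗ[ℝ] V →ₗ[ℝ] ℝ, ∀ j m, B (b j) (b m) =
      (P * (Matrix.of fun i j => B (u i) (u j)) * P.transpose) j m := by
    intro B j m
    rw [hP j, hP m]
    simp only [map_sum, LinearMap.sum_apply, map_smul, LinearMap.smul_apply, smul_eq_mul,
      Matrix.mul_apply, Matrix.transpose_apply, Matrix.of_apply, Finset.mul_sum,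
      Finset.sum_mul]
    refine Finset.sum_congr rfl fun i _ => Finset.sum_congr rfl fun j _ => ?_
    ring
  have h1 : ∑ j, ∑ m, S (b j) (b m) * Q (b j) (b m) =
      ((P * (Matrix.of fun i j => S (u i) (u j)) * P.transpose) *
       (P * (Matrix.of fun i j => Q (u i) (u j)) * P.transpose).transpose).trace := by
    simp_rw [key]
    exact sum_mul_eq_trace _ _
  have h2 := sum_mul_eq_trace ((gramMat u)⁻¹ * (Matrix.of fun i j => S (u i) (u j)) * (gramMat u)⁻¹)
    (Matrix.of fun i j => Q (u i) (u j))
  simp only [Matrix.of_apply] at h2 ⊢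
  rw [h2, h1, ← hPP]
  simp only [Matrix.transpose_mul, Matrix.transpose_transpose, Matrix.mul_assoc]
  rw [Matrix.trace_mul_comm]
  have := Matrix.trace_mul_comm ((Matrix.of fun i j => S (u i) (u j)) *
    (P.transpose * (P * (Matrix.of fun i j => Q (u i) (u j)).transpose))) (P.transpose * P)
  simpa only [Matrix.mul_assoc] using this

end Gram

/-! ### Inner products of forms -/

section Forms

variable {V : Type*} [NormedAddCommGroup V] [InnerProductSpace ℝ V]
variable {ι : Type*} [Fintype ι] [DecidableEq ι]

/-- The inner product of two `k`-forms with components `a`, `b` in a basis whose dual has Gram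
matrix `H`. -/
def componentInner {k : ℕ} (H : Matrix ι ι ℝ) (a b : (Fin k → ι) → ℝ) : ℝ :=
  (k.factorial : ℝ)⁻¹ * ∑ I, ∑ J, (∏ l, H (I l) (J l)) * (a I * b J)

/-- Multilinear expansion puts one factor `P` per slot on each form. Summing over the orthonormal
indices contracts them to PᵀP = G⁻¹ in each slot. The right side does not involve `c`, so the inner
product does not depend on the orthonormal basis. -/
theorem sum_orthonormal_forms {κ : Type*} [Fintype κ] [DecidableEq κ] {k : ℕ}
    (u : Module.Basis ι ℝ V) (c : OrthonormalBasis κ ℝ V)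
    (α β : V [⋀^Fin k]→L[ℝ] ℝ) :
    (k.factorial : ℝ)⁻¹ * ∑ I : Fin k → κ, α (fun l => c (I l)) * β (fun l => c (I l)) =
      componentInner (gramMat u)⁻¹ (fun I => α fun l => u (I l)) (fun I => β fun l => u (I l)) := by
  obtain ⟨P, hP, hPP, -⟩ := exists_orthonormal_expansion u c
  have expand : ∀ (γ : V [⋀^Fin k]→L[ℝ] ℝ) (i : Fin k → κ), γ (fun l => c (i l)) =
      ∑ I : Fin k → ι, (∏ l, P (i l) (I l)) * γ (fun l => u (I l)) := by
    intro γ i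
    simp_rw [hP]
    rw [γ.map_sum]
    refine Finset.sum_congr rfl fun I _ => ?_
    exact (γ.toMultilinearMap.map_smul_univ (fun l => P (i l) (I l)) fun l => u (I l))
  rw [componentInner]
  congr 1
  simp_rw [expand, ← hPP, Matrix.mul_apply, Matrix.transpose_apply, Finset.prod_univ_sum,
    Fintype.piFinset_univ, Finset.sum_mul, Finset.mul_sum]
  rw [Finset.sum_comm]
  refine Finset.sum_congr rfl fun I _ => ?_
  rw [Finset.sum_comm]
  refine Finset.sum_congr rfl fun J _ => Finset.sum_congr rfl fun i _ => ?_
  rw [Finset.prod_mul_distrib]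
  ring

variable [FiniteDimensional ℝ V]

theorem innerDeg_eq_componentInner {k : ℕ} (u : Module.Basis ι ℝ V) (α β : V [⋀^Fin k]→L[ℝ] ℝ) :
    innerDeg α β =
      componentInner (gramMat u)⁻¹ (fun I => α fun l => u (I l)) (fun I => β fun l => u (I l)) :=
  sum_orthonormal_forms u (stdOrthonormalBasis ℝ V) α β

theorem innerDeg_eq_sum {k : ℕ} (b : OrthonormalBasis ι ℝ V) (α β : V [⋀^Fin k]→L[ℝ] ℝ) :
    innerDeg α β = (k.factorial : ℝ)⁻¹ * ∑ I : Fin k → ι,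
      α (fun l => b (I l)) * β (fun l => b (I l)) := by
  rw [innerDeg_eq_componentInner b.toBasis, sum_orthonormal_forms b.toBasis b]

theorem innerDeg_comm {k : ℕ} (α β : V [⋀^Fin k]→L[ℝ] ℝ) : innerDeg α β = innerDeg β α := by
  simp [innerDeg, mul_comm]

theorem innerDeg_add_left {k : ℕ} (α α' β : V [⋀^Fin k]→L[ℝ] ℝ) :
    innerDeg (α + α') β = innerDeg α β + innerDeg α' β := by
  simp [innerDeg, add_mul, Finset.sum_add_distrib, mul_add]

theorem innerDeg_smul_left {k : ℕ} (r : ℝ) (α β : V [⋀^Fin k]→L[ℝ] ℝ) :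
    innerDeg (r • α) β = r * innerDeg α β := by
  simp only [innerDeg, ContinuousAlternatingMap.smul_apply, smul_eq_mul, Finset.mul_sum]
  refine Finset.sum_congr rfl fun i _ => ?_
  ring

theorem innerForms_comm (α β : Forms V) : innerForms α β = innerForms β α := by
  simp [innerForms, innerDeg_comm]

theorem innerForms_add_left (α α' β : Forms V) :
    innerForms (α + α') β = innerForms α β + innerForms α' β := by
  simp [innerForms, innerDeg_add_left, Finset.sum_add_distrib]

theorem innerForms_smul_left (r : ℝ) (α β : Forms V) :
    innerForms (r • α) β = r * innerForms α β := by
  simp [innerForms, innerDeg_smul_left, Finset.mul_sum]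

/-- The inner product of forms as a bilinear map. -/
def innerFormsₗ : Forms V →ₗ[ℝ] Forms V →ₗ[ℝ] ℝ :=
  LinearMap.mk₂ ℝ innerForms innerForms_add_left innerForms_smul_left
    (fun α β γ => by
      rw [innerForms_comm, innerForms_add_left, innerForms_comm β, innerForms_comm γ])
    (fun r α β => by rw [innerForms_comm, innerForms_smul_left, innerForms_comm β]; rfl)

theorem innerFormsₗ_apply (α β : Forms V) : innerFormsₗ α β = innerForms α β := rfl

theorem innerForms_add_right (α β γ : Forms V) :
    innerForms α (β + γ) = innerForms α β + innerForms α γ := map_add (innerFormsₗ α) β γ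

theorem innerForms_sub_right (α β γ : Forms V) :
    innerForms α (β - γ) = innerForms α β - innerForms α γ := map_sub (innerFormsₗ α) β γ

theorem innerForms_smul_right (r : ℝ) (α β : Forms V) :
    innerForms α (r • β) = r * innerForms α β := map_smul (innerFormsₗ α) r β

theorem innerForms_sum_right {σ : Type*} (s : Finset σ) (α : Forms V) (β : σ → Forms V) :
    innerForms α (∑ i ∈ s, β i) = ∑ i ∈ s, innerForms α (β i) := map_sum (innerFormsₗ α) β s

theorem intMul_add_left (v w : V) (α : Forms V) : intMul (v + w) α = intMul v α + intMul w α := by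
  funext k; simp [intMul]

end Forms

/-! ### Interior and exterior multiplication -/

section Clifford

variable {V : Type*} [NormedAddCommGroup V] [InnerProductSpace ℝ V]
variable {ι : Type*} [Fintype ι] [DecidableEq ι]

theorem intMul_apply (v : V) (α : Forms V) (k : ℕ) (w : Fin k → V) :
    intMul v α k w = α (k + 1) (Matrix.vecCons v w) := rfl

theorem intMul_smul_left (r : ℝ) (v : V) (α : Forms V) : intMul (r • v) α = r • intMul v α := by
  funext k; simp [intMul]

theorem intMul_add_right (v : V) (α β : Forms V) :
    intMul v (α + β) = intMul v α + intMul v β := by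
  funext k; simp [intMul]

theorem intMul_smul_right (r : ℝ) (v : V) (α : Forms V) :
    intMul v (r • α) = r • intMul v α := by
  funext k; simp [intMul]

theorem wedgeLeft_apply {k : ℕ} (w : V →L[ℝ] ℝ) (α : V [⋀^Fin k]→L[ℝ] ℝ) (x : Fin (k + 1) → V) :
    wedgeLeft w α x = ∑ i : Fin (k + 1), (-1) ^ (i : ℕ) * (w (x i) * α (i.removeNth x)) := by
  simp [wedgeLeft, ContinuousAlternatingMap.alternatizeUncurryFin_apply]

/-- Contraction is an antiderivation: in the alternating sum for w ∧ α, the term where w receives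
`v` splits off, and in the others the position is shifted by one, which costs a sign. -/
theorem intMul_extMul (v : V) (w : V →L[ℝ] ℝ) (α : Forms V) :
    intMul v (extMul w α) = w v • α - extMul w (intMul v α) := by
  funext k
  ext x
  rw [intMul_apply]
  change wedgeLeft w (α k) _ = w v * α k x - extMul w (intMul v α) k x
  rw [wedgeLeft_apply, Fin.sum_univ_succ]
  have h0 : (0 : Fin (k + 1)).removeNth (Matrix.vecCons v x) = x := by
    funext i; simp [Fin.removeNth]
  rw [h0]
  cases k with
  | zero => simp [extMul]
  | succ k =>
    change _ = _ - wedgeLeft w (intMul v α k) x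
    rw [wedgeLeft_apply, sub_eq_add_neg, ← Finset.sum_neg_distrib]
    refine congrArg₂ (· + ·) (by simp) (Finset.sum_congr rfl fun i _ => ?_)
    have h1 : (i.succ : Fin (k + 2)).removeNth (Matrix.vecCons v x) =
        Matrix.vecCons v (i.removeNth x) := by
      funext j
      refine Fin.cases ?_ (fun j => ?_) j
      · simp [Fin.removeNth]
      · simp [Fin.removeNth]
    rw [h1, intMul_apply]
    simp [pow_succ]

/-- Summing over the position at which two alternating component functions are contracted. -/
theorem sum_insertNth_mul {k : ℕ} (α β : V [⋀^Fin (k + 1)]→L[ℝ] ℝ) (u : ι → V)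
    (W H : Matrix ι ι ℝ) (l : Fin (k + 1)) :
    ∑ I : Fin (k + 1) → ι, ∑ J : Fin (k + 1) → ι,
      (W (I l) (J l) * ∏ m : Fin k, H (I (l.succAbove m)) (J (l.succAbove m))) *
        (α (fun m => u (I m)) * β (fun m => u (J m))) =
    ∑ i, ∑ j, W i j * ∑ I : Fin k → ι, ∑ J : Fin k → ι, (∏ m, H (I m) (J m)) *
      (α (Matrix.vecCons (u i) fun m => u (I m)) * β (Matrix.vecCons (u j) fun m => u (J m))) := by
  -- Moving the inserted vector from slot `l` to the front costs (-1)^l. The sign occurs once for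
  -- `α` and once for `β`, so it cancels.
  have ins : ∀ (γ : V [⋀^Fin (k + 1)]→L[ℝ] ℝ) (i : ι) (I : Fin k → ι),
      γ (fun m => u (l.insertNth (α := fun _ => ι) i I m)) =
        (-1) ^ (l : ℕ) * γ (Matrix.vecCons (u i) fun m => u (I m)) := by
    intro γ i I
    have : (fun m => u (l.insertNth (α := fun _ => ι) i I m)) =
        l.insertNth (α := fun _ => V) (u i) (fun m => u (I m)) := by
      funext m
      refine Fin.succAboveCases l ?_ (fun m => ?_) m <;> simp
    rw [this, γ.map_insertNth]
    simp
  rw [← (Fin.insertNthEquiv (fun _ => ι) l).sum_comp, Fintype.sum_prod_type]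
  refine Finset.sum_congr rfl fun i _ => ?_
  simp_rw [← (Fin.insertNthEquiv (fun _ => ι) l).sum_comp (fun J => _ * (_ * β fun m => u (J m))),
    Fintype.sum_prod_type, Finset.mul_sum]
  rw [Finset.sum_comm]
  refine Finset.sum_congr rfl fun j _ => Finset.sum_congr rfl fun I _ =>
    Finset.sum_congr rfl fun J _ => ?_
  have hs : ((-1 : ℝ) ^ (l : ℕ)) * (-1) ^ (l : ℕ) = 1 := by
    rw [← mul_pow]; simp
  simp only [Fin.insertNthEquiv_apply, ins, Fin.insertNth_apply_same,
    Fin.insertNth_apply_succAbove]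
  linear_combination (W i j * (∏ m, H (I m) (J m)) * α (Matrix.vecCons (u i) fun m => u (I m)) *
    β (Matrix.vecCons (u j) fun m => u (J m))) * hs

variable [FiniteDimensional ℝ V]

theorem form_eq_zero_of_finrank_lt {k : ℕ} (hk : Module.finrank ℝ V < k)
    (α : V [⋀^Fin k]→L[ℝ] ℝ) : α = 0 := by
  ext x
  refine α.toAlternatingMap.map_linearDependent x fun h => ?_
  have := h.fintype_card_le_finrank
  simp at this
  omega

/-- Each of the k + 1 positions of the covector contributes the same sum, and (k + 1)/(k + 1)! =
1/k!. -/
theorem innerDeg_wedgeLeft {k : ℕ} (v : V) (α : V [⋀^Fin (k + 1)]→L[ℝ] ℝ)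
    (β : V [⋀^Fin k]→L[ℝ] ℝ) :
    innerDeg α (wedgeLeft (flat v) β) = innerDeg (α.curryLeft v) β := by
  set b := stdOrthonormalBasis ℝ V
  have key : ∀ l : Fin (k + 1), ∑ I : Fin (k + 1) → Fin (Module.finrank ℝ V),
      α (fun m => b (I m)) * ((-1) ^ (l : ℕ) * (flat v (b (I l)) *
        β (l.removeNth fun m => b (I m)))) =
      ∑ I : Fin k → Fin (Module.finrank ℝ V), α.curryLeft v (fun m => b (I m)) *
        β (fun m => b (I m)) := by
    intro l
    have ins : ∀ (i : Fin (Module.finrank ℝ V)) (I : Fin k → Fin (Module.finrank ℝ V)),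
        (fun m => b (l.insertNth (α := fun _ => Fin (Module.finrank ℝ V)) i I m)) =
        l.insertNth (α := fun _ => V) (b i) (fun m => b (I m)) := by
      intro i I
      funext m
      refine Fin.succAboveCases l ?_ (fun m => ?_) m <;> simp
    have hs : ((-1 : ℝ) ^ (l : ℕ)) * (-1) ^ (l : ℕ) = 1 := by
      rw [← mul_pow]; simp
    rw [← (Fin.insertNthEquiv (fun _ => Fin (Module.finrank ℝ V)) l).sum_comp,
      Fintype.sum_prod_type, Finset.sum_comm]
    refine Finset.sum_congr rfl fun I _ => ?_
    have hv : v = ∑ i, (inner ℝ v (b i) : ℝ) • b i := by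
      conv_lhs => rw [← b.sum_repr' v]
      simp_rw [real_inner_comm]
    conv_rhs => rw [hv]
    rw [map_sum, ContinuousAlternatingMap.sum_apply, Finset.sum_mul]
    refine Finset.sum_congr rfl fun i _ => ?_
    simp only [Fin.insertNthEquiv_apply, ins, α.map_insertNth, Fin.insertNth_apply_same, map_smul,
      ContinuousAlternatingMap.smul_apply, smul_eq_mul,
      ContinuousAlternatingMap.curryLeft_apply_apply, Fin.removeNth_insertNth]
    have hf : flat v (b i) = inner ℝ v (b i) := rfl
    rw [hf, zsmul_eq_mul]
    push_cast
    linear_combination (α (Matrix.vecCons (b i) fun m => b (I m)) * inner ℝ v (b i) *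
      β (fun m => b (I m))) * hs
  have hk : ((k + 1).factorial : ℝ) = (k + 1) * (k.factorial : ℝ) := by
    rw [Nat.factorial_succ]; push_cast; ring
  simp only [innerDeg, wedgeLeft_apply, Finset.mul_sum (Finset.univ : Finset (Fin (k + 1)))]
  rw [Finset.sum_comm, Finset.sum_congr rfl fun l _ => key l, Finset.sum_const, Finset.card_univ,
    Fintype.card_fin, nsmul_eq_mul, hk]
  have h1 : ((k : ℝ) + 1) ≠ 0 := by positivity
  have h2 : (k.factorial : ℝ) ≠ 0 := by positivity
  push_cast
  field_simp
  rfl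

/-- Exterior multiplication by `⟨v, ·⟩` is adjoint to interior multiplication by `v`. -/
theorem innerForms_extMul (v : V) (α β : Forms V) :
    innerForms α (extMul (flat v) β) = innerForms (intMul v α) β := by
  -- Degree zero drops out on the left and the top degree on the right; the remaining terms match
  -- after a shift of the degree by one.
  have h0 : innerDeg (α 0) (extMul (flat v) β 0) = 0 := by
    simp [innerDeg, extMul]
  have h1 : innerDeg (intMul v α (Module.finrank ℝ V)) (β (Module.finrank ℝ V)) = 0 := by
    have : α (Module.finrank ℝ V + 1) = 0 := form_eq_zero_of_finrank_lt (Nat.lt_succ_self _) _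
    simp [intMul, this, innerDeg]
  rw [innerForms, innerForms, Finset.sum_range_succ', Finset.sum_range_succ, h0, h1]
  simp only [add_zero]
  exact Finset.sum_congr rfl fun k _ => innerDeg_wedgeLeft v _ _

/-- Both factors are expanded and moved across by adjointness and the antiderivation rule. The two
terms with iterated contractions together are antisymmetric in `v` and `w`, so they disappear
against a symmetric tensor. -/
theorem innerForms_cliff_cliffHat (v w : V) (α : Forms V) :
    innerForms α (cliff v (cliffHat w α)) =
      innerForms (intMul w (intMul v α)) α - innerForms (intMul v (intMul w α)) α
        + innerForms (intMul v α) (intMul w α) + innerForms (intMul w α) (intMul v α)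
        - inner ℝ v w * normSq α := by
  have hadd : intMul v (extMul (flat w) α + intMul w α) =
      (inner ℝ v w : ℝ) • α - extMul (flat w) (intMul v α) + intMul v (intMul w α) := by
    rw [intMul_add_right, intMul_extMul]
    have : flat w v = inner ℝ v w := real_inner_comm _ _
    rw [this]
  rw [cliff, cliffHat, innerForms_sub_right, hadd, innerForms_extMul, innerForms_add_right,
    innerForms_add_right, innerForms_sub_right, innerForms_smul_right, innerForms_extMul,
    innerForms_extMul, normSq, innerForms_comm α (intMul v (intMul w α))]
  ring

/-- The bilinear form `Q(v, w) = ⟨i_v α, i_w α⟩`. -/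
def contractionForm (α : Forms V) : V →ₗ[ℝ] V →ₗ[ℝ] ℝ :=
  LinearMap.mk₂ ℝ (fun v w => innerForms (intMul v α) (intMul w α))
    (fun v w x => by simp only [intMul_add_left, innerForms_add_left])
    (fun r v w => by simp only [intMul_smul_left, innerForms_smul_left, smul_eq_mul])
    (fun v w x => by simp only [intMul_add_left, innerForms_add_right])
    (fun r v w => by simp only [intMul_smul_left, innerForms_smul_right, smul_eq_mul])

theorem contractionForm_apply (α : Forms V) (v w : V) :
    contractionForm α v w = innerForms (intMul v α) (intMul w α) := rfl

/-- `⟨α, ∑ S(b_j, b_m) c(b_j) ĉ(b_m) α⟩` for symmetric `S`. -/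
theorem innerForms_sum_cliff (b : OrthonormalBasis ι ℝ V) (S : ι → ι → ℝ)
    (hS : ∀ j m, S j m = S m j) (α : Forms V) :
    innerForms α (∑ j, ∑ m, S j m • cliff (b j) (cliffHat (b m) α)) =
      2 * ∑ j, ∑ m, S j m * contractionForm α (b j) (b m) - (∑ j, S j j) * normSq α := by
  simp_rw [innerForms_sum_right, innerForms_smul_right, innerForms_cliff_cliffHat]
  -- By symmetry of `S` the two iterated contractions are written as transposes of one another, so
  -- they cancel in the double sum.
  have e : ∀ j m, S j m * (innerForms (intMul (b m) (intMul (b j) α)) α -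
      innerForms (intMul (b j) (intMul (b m) α)) α +
      innerForms (intMul (b j) α) (intMul (b m) α) + innerForms (intMul (b m) α) (intMul (b j) α) -
      inner ℝ (b j) (b m) * normSq α) =
      (S m j * innerForms (intMul (b m) (intMul (b j) α)) α -
        S j m * innerForms (intMul (b j) (intMul (b m) α)) α) +
      2 * (S j m * contractionForm α (b j) (b m)) -
      S j m * (if j = m then 1 else 0) * normSq α := by
    intro j m
    rw [orthonormal_iff_ite.1 b.orthonormal, contractionForm_apply,
      innerForms_comm (intMul (b m) α), hS m j]
    ring
  simp_rw [e, Finset.sum_sub_distrib, Finset.sum_add_distrib, Finset.sum_sub_distrib]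
  rw [Finset.sum_comm (f := fun j m => S m j * _), sub_self, zero_add]
  simp [Finset.mul_sum, Finset.sum_mul]

end Clifford

/-! ### Differentiating determinants and inverses -/

section MatrixCalculus

variable {ι : Type*} [Fintype ι] [DecidableEq ι]

/-- Jacobi's formula: the product rule in the Leibniz expansion replaces one column of `A` by the
corresponding column of `A'`, and by Cramer's rule the resulting determinants add up to the trace.
-/
theorem hasDerivAt_det {A : ℝ → Matrix ι ι ℝ} {A' : Matrix ι ι ℝ} {t : ℝ}
    (hA : ∀ i j, HasDerivAt (fun s => A s i j) (A' i j) t) :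
    HasDerivAt (fun s => (A s).det) ((A t).adjugate * A').trace t := by
  have h1 : HasDerivAt (fun s => (A s).det) (∑ σ : Equiv.Perm ι, (Equiv.Perm.sign σ : ℝ) *
      ∑ i, (∏ j ∈ Finset.univ.erase i, A t (σ j) j) * A' (σ i) i) t := by
    simp_rw [Matrix.det_apply']
    refine HasDerivAt.fun_sum fun σ _ => ?_
    refine HasDerivAt.const_mul _ ?_
    have := HasDerivAt.fun_finsetProd (u := Finset.univ) (f := fun i s => A s (σ i) i)
      (fun i _ => hA (σ i) i)
    simpa using this
  convert h1 using 1
  have h2 : ((A t).adjugate * A').trace =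
      ∑ i, ((A t).updateCol i fun k => A' k i).det := by
    refine Finset.sum_congr rfl fun i _ => ?_
    rw [← Matrix.cramer_apply, Matrix.cramer_eq_adjugate_mulVec]
    rfl
  rw [h2]
  simp_rw [Matrix.det_apply', Finset.mul_sum]
  rw [Finset.sum_comm]
  refine Finset.sum_congr rfl fun σ _ => Finset.sum_congr rfl fun i _ => ?_
  rw [← Finset.mul_prod_erase _ _ (Finset.mem_univ i)]
  have : ∏ j ∈ Finset.univ.erase i, (A t).updateCol i (fun k => A' k i) (σ j) j =
      ∏ j ∈ Finset.univ.erase i, A t (σ j) j :=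
    Finset.prod_congr rfl fun j hj => by
      rw [Matrix.updateCol_ne (Finset.ne_of_mem_erase hj)]
  rw [this, Matrix.updateCol_self]
  ring

/-- Cramer's rule: regularity of the inverse is thereby reduced to regularity of determinants. -/
theorem inv_apply_eq (A : Matrix ι ι ℝ) (i j : ι) :
    A⁻¹ i j = A.det⁻¹ * (A.updateRow j (Pi.single i 1)).det := by
  rw [Matrix.inv_def, Matrix.smul_apply, Matrix.adjugate_apply, Ring.inverse_eq_inv, smul_eq_mul]

/-- Differentiability comes from Cramer's rule. The value then follows by differentiating A⁻¹A = 1,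
which holds near `t` because the determinant stays nonzero. -/
theorem hasDerivAt_matrix_inv {A : ℝ → Matrix ι ι ℝ} {A' : Matrix ι ι ℝ} {t : ℝ}
    (hA : ∀ i j, HasDerivAt (fun s => A s i j) (A' i j) t) (hdet : (A t).det ≠ 0) (i j : ι) :
    HasDerivAt (fun s => (A s)⁻¹ i j) (-((A t)⁻¹ * A' * (A t)⁻¹) i j) t := by
  have hd := hasDerivAt_det hA
  have hdiff : ∀ i j, DifferentiableAt ℝ (fun s => (A s)⁻¹ i j) t := by
    intro i j
    simp_rw [inv_apply_eq]
    refine (hd.differentiableAt.inv hdet).mul ?_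
    have : ∀ k l, HasDerivAt (fun s => ((A s).updateRow j (Pi.single i 1)) k l)
        ((A'.updateRow j 0) k l) t := by
      intro k l
      by_cases hk : k = j
      · subst hk; simpa using hasDerivAt_const t _
      · simpa [Matrix.updateRow_ne hk] using hA k l
    exact (hasDerivAt_det this).differentiableAt
  set H' : Matrix ι ι ℝ := Matrix.of fun i j => deriv (fun s => (A s)⁻¹ i j) t
  have hH : ∀ i j, HasDerivAt (fun s => (A s)⁻¹ i j) (H' i j) t := fun i j =>
    (hdiff i j).hasDerivAt
  have hmul : H' * A t + (A t)⁻¹ * A' = 0 := by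
    ext i j
    have h1 : HasDerivAt (fun s => ((A s)⁻¹ * A s) i j) ((H' * A t + (A t)⁻¹ * A') i j) t := by
      simp only [Matrix.mul_apply, Matrix.add_apply, ← Finset.sum_add_distrib]
      exact HasDerivAt.fun_sum fun k _ => (hH i k).mul (hA k j)
    have h2 : (fun s => ((A s)⁻¹ * A s) i j) =ᶠ[𝓝 t] fun _ => (1 : Matrix ι ι ℝ) i j := by
      filter_upwards [hd.continuousAt.eventually_ne hdet] with s hs
      rw [Matrix.nonsing_inv_mul _ (isUnit_iff_ne_zero.2 hs)]
    exact h1.unique ((hasDerivAt_const t _).congr_of_eventuallyEq h2)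
  have h3 : H' = -((A t)⁻¹ * A' * (A t)⁻¹) := by
    have := congrArg (· * (A t)⁻¹) (eq_neg_of_add_eq_zero_left hmul)
    simpa [Matrix.mul_assoc, Matrix.mul_nonsing_inv _ (isUnit_iff_ne_zero.2 hdet)] using this
  have := hH i j
  rwa [h3] at this

theorem contDiffAt_det {W : Type*} [NormedAddCommGroup W] [NormedSpace ℝ W] {k : WithTop ℕ∞}
    {A : W → Matrix ι ι ℝ} {w : W} (hA : ∀ i j, ContDiffAt ℝ k (fun s => A s i j) w) :
    ContDiffAt ℝ k (fun s => (A s).det) w := by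
  simp_rw [Matrix.det_apply']
  exact ContDiffAt.sum fun σ _ => contDiffAt_const.mul (contDiffAt_prod fun i _ => hA _ _)

theorem contDiffAt_matrix_inv {W : Type*} [NormedAddCommGroup W] [NormedSpace ℝ W]
    {k : WithTop ℕ∞} {A : W → Matrix ι ι ℝ} {w : W}
    (hA : ∀ i j, ContDiffAt ℝ k (fun s => A s i j) w) (hdet : (A w).det ≠ 0) (i j : ι) :
    ContDiffAt ℝ k (fun s => (A s)⁻¹ i j) w := by
  simp_rw [inv_apply_eq]
  refine ((contDiffAt_det hA).inv hdet).mul (contDiffAt_det fun a b => ?_)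
  by_cases ha : a = j
  · subst ha; simpa using contDiffAt_const
  · simpa [Matrix.updateRow_ne ha] using hA a b

end MatrixCalculus

/-! ### The norm of a form for a varying metric -/

section VaryingMetric

variable {V : Type*} [NormedAddCommGroup V] [InnerProductSpace ℝ V]
variable {ι : Type*} [Fintype ι] [DecidableEq ι]

/-- The square norm of the form `α` for the metric with Gram matrix `H⁻¹` in the basis `u`. -/
def componentNormSq (H : Matrix ι ι ℝ) (u : ι → V) (α : Forms V) : ℝ :=
  ∑ k ∈ Finset.range (Fintype.card ι + 1),
    componentInner H (fun I => α k fun l => u (I l)) (fun I => α k fun l => u (I l))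

/-- The product rule differentiates one of the k + 1 factors `H`. As `α` is alternating, every slot
gives the same contribution, and the factor k + 1 turns 1/(k + 1)! into 1/k!. -/
theorem hasDerivAt_componentInner {k : ℕ} (u : ι → V) (α : V [⋀^Fin (k + 1)]→L[ℝ] ℝ)
    {H : ℝ → Matrix ι ι ℝ} {H' : Matrix ι ι ℝ} {t : ℝ}
    (hH : ∀ i j, HasDerivAt (fun s => H s i j) (H' i j) t) :
    HasDerivAt (fun s => componentInner (H s) (fun I => α fun l => u (I l))
      (fun I => α fun l => u (I l)))
      (∑ i, ∑ j, H' i j * componentInner (H t) (fun I => α.curryLeft (u i) fun l => u (I l))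
        (fun I => α.curryLeft (u j) fun l => u (I l))) t := by
  have h1 : HasDerivAt (fun s => componentInner (H s) (fun I => α fun l => u (I l))
      (fun I => α fun l => u (I l)))
      (((k + 1).factorial : ℝ)⁻¹ * ∑ I : Fin (k + 1) → ι, ∑ J : Fin (k + 1) → ι,
        (∑ l, H' (I l) (J l) * ∏ m : Fin k, H t (I (l.succAbove m)) (J (l.succAbove m))) *
        (α (fun m => u (I m)) * α (fun m => u (J m)))) t := by
    refine HasDerivAt.const_mul _ (HasDerivAt.fun_sum fun I _ => HasDerivAt.fun_sum fun J _ => ?_)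
    refine HasDerivAt.mul_const ?_ _
    have := HasDerivAt.fun_finsetProd (u := Finset.univ) (f := fun l s => H s (I l) (J l))
      (fun l _ => hH (I l) (J l))
    convert this using 1
    refine Finset.sum_congr rfl fun l _ => ?_
    rw [smul_eq_mul, mul_comm, ← Finset.compl_singleton, ← Fin.image_succAbove_univ,
      Finset.prod_image fun _ _ _ _ h => Fin.succAbove_right_injective h]
  convert h1 using 1
  simp_rw [Finset.sum_mul]
  have hswap : ∀ f : (Fin (k + 1) → ι) → (Fin (k + 1) → ι) → Fin (k + 1) → ℝ,
      ∑ I, ∑ J, ∑ l, f I J l = ∑ l, ∑ I, ∑ J, f I J l := by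
    intro f
    rw [Finset.sum_comm' (s := Finset.univ) (t := fun _ => Finset.univ) (t' := Finset.univ)
      (s' := fun _ => Finset.univ) (by simp)]
    simp_rw [Finset.sum_comm (s := (Finset.univ : Finset (Fin (k + 1))))]
    rw [Finset.sum_comm]
  rw [hswap, Finset.sum_congr rfl fun l _ => sum_insertNth_mul α α u H' (H t) l, Finset.sum_const,
    Finset.card_univ, Fintype.card_fin, nsmul_eq_mul]
  have hk : ((k + 1).factorial : ℝ) = (k + 1) * (k.factorial : ℝ) := by
    rw [Nat.factorial_succ]; push_cast; ring
  have h1 : ((k : ℝ) + 1) ≠ 0 := by positivity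
  have h2 : (k.factorial : ℝ) ≠ 0 := by positivity
  simp only [componentInner, Finset.mul_sum, hk,
    ContinuousAlternatingMap.curryLeft_apply_apply]
  refine Finset.sum_congr rfl fun i _ => Finset.sum_congr rfl fun j _ =>
    Finset.sum_congr rfl fun I _ => Finset.sum_congr rfl fun J _ => ?_
  push_cast
  field_simp

variable [FiniteDimensional ℝ V]

theorem normSq_eq_componentNormSq (u : Module.Basis ι ℝ V) (α : Forms V) :
    normSq α = componentNormSq (gramMat u)⁻¹ u α := by
  rw [normSq, innerForms, componentNormSq, Module.finrank_eq_card_basis u]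
  exact Finset.sum_congr rfl fun k _ => innerDeg_eq_componentInner u _ _

/-- The derivative of |α|² with respect to the dual metric is the contraction form Q: degree k + 1
of `α` yields degree k of its contractions. Degree zero is independent of the metric, and the
contractions vanish in top degree. -/
theorem hasDerivAt_componentNormSq (u : Module.Basis ι ℝ V) (α : Forms V)
    {H : ℝ → Matrix ι ι ℝ} {H' : Matrix ι ι ℝ} {t : ℝ} (h0 : H t = (gramMat u)⁻¹)
    (hH : ∀ i j, HasDerivAt (fun s => H s i j) (H' i j) t) :
    HasDerivAt (fun s => componentNormSq (H s) u α)
      (∑ i, ∑ j, H' i j * contractionForm α (u i) (u j)) t := by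
  have hcard := Module.finrank_eq_card_basis u
  have htop : ∀ v : V, intMul v α (Fintype.card ι) = 0 := by
    intro v
    have : α (Fintype.card ι + 1) = 0 := form_eq_zero_of_finrank_lt (by omega) _
    simp [intMul, this]
  have hQ : ∀ i j, contractionForm α (u i) (u j) = ∑ k ∈ Finset.range (Fintype.card ι),
      componentInner (H t) (fun I => (α (k + 1)).curryLeft (u i) fun l => u (I l))
        (fun I => (α (k + 1)).curryLeft (u j) fun l => u (I l)) := by
    intro i j
    rw [contractionForm_apply, innerForms, hcard, Finset.sum_range_succ, htop, h0]
    have : innerDeg (0 : V [⋀^Fin (Fintype.card ι)]→L[ℝ] ℝ)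
        (intMul (u j) α (Fintype.card ι)) = 0 := by simp [innerDeg]
    rw [this, add_zero]
    exact Finset.sum_congr rfl fun k _ => innerDeg_eq_componentInner u _ _
  simp_rw [hQ, Finset.mul_sum]
  simp_rw [componentNormSq, Finset.sum_range_succ']
  rw [← add_zero (∑ i, ∑ j, _)]
  refine HasDerivAt.add ?_ ?_
  · have hsw : ∑ i, ∑ j, ∑ k ∈ Finset.range (Fintype.card ι), H' i j *
        componentInner (H t) (fun I => (α (k + 1)).curryLeft (u i) fun l => u (I l))
          (fun I => (α (k + 1)).curryLeft (u j) fun l => u (I l)) =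
        ∑ k ∈ Finset.range (Fintype.card ι), ∑ i, ∑ j, H' i j *
        componentInner (H t) (fun I => (α (k + 1)).curryLeft (u i) fun l => u (I l))
          (fun I => (α (k + 1)).curryLeft (u j) fun l => u (I l)) := by
      rw [Finset.sum_comm (s := Finset.range _)]
      exact Finset.sum_congr rfl fun i _ => Finset.sum_comm
    rw [hsw]
    exact HasDerivAt.fun_sum fun k _ => hasDerivAt_componentInner u (α (k + 1)) hH
  · simp only [componentInner, Finset.univ_eq_empty, Finset.prod_empty]
    exact hasDerivAt_const _ _

/-- The derivative of `|α|² dv` when the metric varies with derivative `-S`. -/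
theorem hasDerivAt_componentNormSq_mul_sqrt_det (u : Module.Basis ι ℝ V) (α : Forms V)
    {G : ℝ → Matrix ι ι ℝ} {S : Matrix ι ι ℝ} {t : ℝ} (h0 : G t = gramMat u)
    (hG : ∀ i j, HasDerivAt (fun s => G s i j) (-S i j) t) :
    HasDerivAt (fun s => componentNormSq (G s)⁻¹ u α * Real.sqrt ((G s).det / (gramMat u).det))
      (∑ i, ∑ j, ((gramMat u)⁻¹ * S * (gramMat u)⁻¹) i j * contractionForm α (u i) (u j) -
        1 / 2 * ((gramMat u)⁻¹ * S).trace * normSq α) t := by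
  have hpos := gramMat_det_pos u
  have hG' : ∀ i j, HasDerivAt (fun s => G s i j) ((-S) i j) t := hG
  have hdet : (G t).det ≠ 0 := by rw [h0]; exact hpos.ne'
  -- The inverse metric has derivative -G⁻¹(-S)G⁻¹, so the norm contributes with a plus sign and the
  -- volume with -½ tr(G⁻¹S).
  have h1 := hasDerivAt_componentNormSq u α (H := fun s => (G s)⁻¹) (by rw [h0])
    (hasDerivAt_matrix_inv hG' hdet)
  have h2 := ((hasDerivAt_det hG').div_const (gramMat u).det).sqrt
    (by rw [h0, div_self hpos.ne']; exact one_ne_zero)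
  have h3 := h1.mul h2
  refine h3.congr_deriv ?_
  rw [h0, div_self hpos.ne', Real.sqrt_one, ← normSq_eq_componentNormSq]
  have e1 : ((gramMat u).adjugate * -S).trace / (gramMat u).det = -((gramMat u)⁻¹ * S).trace := by
    rw [Matrix.inv_def, Ring.inverse_eq_inv, Matrix.smul_mul, Matrix.trace_smul, Matrix.mul_neg,
      Matrix.trace_neg, smul_eq_mul]
    field_simp
  rw [e1]
  simp only [Matrix.mul_neg, Matrix.neg_mul, Matrix.neg_apply, neg_neg]
  ring

theorem innerDeg_self_nonneg {k : ℕ} (α : V [⋀^Fin k]→L[ℝ] ℝ) : 0 ≤ innerDeg α α :=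
  mul_nonneg (by positivity) (Finset.sum_nonneg fun _ _ => mul_self_nonneg _)

theorem normSq_nonneg (α : Forms V) : 0 ≤ normSq α := by
  rw [normSq, innerForms]
  exact Finset.sum_nonneg fun _ _ => innerDeg_self_nonneg _

/-- Cauchy–Schwarz for the expansion in an orthonormal basis. The factor k! undoes the normalization
of `innerDeg`. -/
theorem sq_apply_le {k : ℕ} (α : V [⋀^Fin k]→L[ℝ] ℝ) (v : Fin k → V) :
    α v ^ 2 ≤ (k.factorial : ℝ) * innerDeg α α * ∏ l, ‖v l‖ ^ 2 := by
  set b := stdOrthonormalBasis ℝ V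
  have hv : v = fun l => ∑ i, b.repr (v l) i • b i := by
    funext l; exact (b.sum_repr (v l)).symm
  have h1 : α v = ∑ I : Fin k → Fin (Module.finrank ℝ V),
      (∏ l, b.repr (v l) (I l)) * α (fun l => b (I l)) := by
    conv_lhs => rw [hv]
    rw [α.map_sum]
    refine Finset.sum_congr rfl fun I _ => ?_
    exact (α.toMultilinearMap.map_smul_univ (fun l => b.repr (v l) (I l)) fun l => b (I l))
  have h2 : ∏ l, ‖v l‖ ^ 2 = ∑ I : Fin k → Fin (Module.finrank ℝ V),
      (∏ l, b.repr (v l) (I l)) ^ 2 := by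
    have : ∀ l, ‖v l‖ ^ 2 = ∑ i, b.repr (v l) i ^ 2 := by
      intro l
      rw [← b.repr.norm_map, EuclideanSpace.norm_sq_eq]
      simp
    simp_rw [this, Finset.prod_univ_sum, Fintype.piFinset_univ, Finset.prod_pow]
  have h3 : (k.factorial : ℝ) * innerDeg α α =
      ∑ I : Fin k → Fin (Module.finrank ℝ V), α (fun l => b (I l)) ^ 2 := by
    have : (k.factorial : ℝ) ≠ 0 := by positivity
    simp only [innerDeg, sq]
    rw [← mul_assoc, mul_inv_cancel₀ this, one_mul]
  rw [h1, h2, h3, mul_comm]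
  exact Finset.sum_mul_sq_le_sq_mul_sq _ _ _

/-- Products of components are controlled by |α|² alone, via 2|st| ≤ s² + t². This is what makes a
multiple of |z|² a dominating function for the energy integrals. -/
theorem abs_apply_mul_apply_le {k : ℕ} (hk : k ∈ Finset.range (Module.finrank ℝ V + 1))
    (α : Forms V) (v w : Fin k → V) {B : ℝ} (hv : ∀ l, ‖v l‖ ≤ B)
    (hw : ∀ l, ‖w l‖ ≤ B) :
    |α k v * α k w| ≤ (k.factorial : ℝ) * B ^ (2 * k) * normSq α := by
  have hle : innerDeg (α k) (α k) ≤ normSq α :=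
    Finset.single_le_sum (f := fun k => innerDeg (α k) (α k))
      (fun _ _ => innerDeg_self_nonneg _) hk
  have key : ∀ v : Fin k → V, (∀ l, ‖v l‖ ≤ B) →
      α k v ^ 2 ≤ (k.factorial : ℝ) * B ^ (2 * k) * normSq α := by
    intro v hv
    have hp : ∏ l, ‖v l‖ ^ 2 ≤ B ^ (2 * k) := by
      calc ∏ l, ‖v l‖ ^ 2 ≤ ∏ _l : Fin k, B ^ 2 :=
            Finset.prod_le_prod (fun _ _ => by positivity)
              fun l _ => pow_le_pow_left₀ (norm_nonneg _) (hv l) 2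
        _ = B ^ (2 * k) := by simp [pow_mul]
    refine (sq_apply_le _ v).trans ?_
    have h0 : 0 ≤ normSq α := normSq_nonneg α
    calc (k.factorial : ℝ) * innerDeg (α k) (α k) * ∏ l, ‖v l‖ ^ 2
        ≤ (k.factorial : ℝ) * normSq α * B ^ (2 * k) := by gcongr
      _ = _ := by ring
  have h1 := key v hv
  have h2 := key w hw
  rw [abs_mul]
  nlinarith [sq_nonneg (|α k v| - |α k w|), sq_abs (α k v), sq_abs (α k w)]

end VaryingMetric

/-! ### The flow of a compactly supported vector field on a vector space -/

section Flow

open Metric NNReal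

/-- Grönwall's inequality from time zero in both directions. As times are at most one, the bound
takes a form linear in |t| with a constant independent of the time. -/
theorem norm_le_of_norm_deriv_le {F : Type*} [NormedAddCommGroup F] [NormedSpace ℝ F]
    {f f' : ℝ → F} {B η ε : ℝ} (hB : 0 < B) (hε : ε ≤ 1) (hη : 0 ≤ η) (h0 : f 0 = 0)
    (hf : ∀ t, |t| < ε → HasDerivAt f (f' t) t)
    (hb : ∀ t, |t| < ε → ‖f' t‖ ≤ B * ‖f t‖ + η) {t : ℝ} (ht : |t| < ε) :
    ‖f t‖ ≤ η * Real.exp B * |t| := by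
  have main : ∀ σ : ℝ, |σ| = 1 → ∀ b : ℝ, 0 ≤ b → b < ε → ‖f (σ * b)‖ ≤ η * Real.exp B * b := by
    intro σ hσ b hb0 hbε
    have habs : ∀ s ∈ Icc 0 b, |σ * s| < ε := by
      intro s hs
      rw [abs_mul, hσ, one_mul, abs_of_nonneg hs.1]
      exact hs.2.trans_lt hbε
    have hd : ∀ s ∈ Icc 0 b, HasDerivAt (fun s => f (σ * s)) (σ • f' (σ * s)) s := by
      intro s hs
      have h1 : HasDerivAt (fun s : ℝ => σ * s) σ s := by
        simpa using (hasDerivAt_id s).const_mul σ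
      exact (hf _ (habs s hs)).scomp s h1
    have := norm_le_gronwallBound_of_norm_deriv_right_le (f := fun s => f (σ * s))
      (f' := fun s => σ • f' (σ * s)) (δ := 0) (K := B) (ε := η) (a := 0) (b := b)
      (fun s hs => (hd s hs).continuousAt.continuousWithinAt)
      (fun s hs => (hd s ⟨hs.1, hs.2.le⟩).hasDerivWithinAt) (by simp [h0])
      (fun s hs => by
        rw [norm_smul, Real.norm_eq_abs, hσ, one_mul]
        exact hb _ (habs s ⟨hs.1, hs.2.le⟩)) b ⟨hb0, le_rfl⟩
    refine this.trans ?_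
    simp only [gronwallBound_of_K_ne_0 hB.ne', sub_zero, zero_mul, zero_add]
    -- This is 1 - s ≤ exp(-s) multiplied by exp(s), with s = B b.
    have h1 : Real.exp (B * b) - 1 ≤ B * b * Real.exp (B * b) := by
      have h2 := Real.add_one_le_exp (-(B * b))
      have h3 : Real.exp (-(B * b)) * Real.exp (B * b) = 1 := by
        rw [← Real.exp_add]; simp
      nlinarith [Real.exp_pos (B * b)]
    have h2 : Real.exp (B * b) ≤ Real.exp B := Real.exp_le_exp.2 (by nlinarith)
    calc η / B * (Real.exp (B * b) - 1) ≤ η / B * (B * b * Real.exp B) := by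
          gcongr
          exact h1.trans (by gcongr)
      _ = η * Real.exp B * b := by field_simp
  rcases le_total 0 t with h | h
  · have := main 1 (by simp) t h (by rwa [abs_of_nonneg h] at ht)
    rw [abs_of_nonneg h]
    rwa [one_mul] at this
  · have := main (-1) (by simp) (-t) (by linarith) (by rwa [abs_of_nonpos h] at ht)
    rw [abs_of_nonpos h]
    rwa [neg_one_mul, neg_neg] at this

variable {E : Type*} [NormedAddCommGroup E] [NormedSpace ℝ E] [FiniteDimensional ℝ E]

/-- `ψ` is the flow of the vector field `Y` on the vector space `E`. -/
structure IsVectorFlow (Y : E → E) (ψ : ℝ → E → E) : Prop where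
  zero : ∀ x, ψ 0 x = x
  hasDerivAt : ∀ x t, HasDerivAt (fun s => ψ s x) (Y (ψ t x)) t

/-- A bounded field moves a point by at most B T in time T, so Picard–Lindelöf on the ball of that
radius gives solutions on (-T, T) for every T. Uniqueness makes them agree on overlaps. -/
theorem exists_isVectorFlow {Y : E → E} {K : ℝ≥0} {B : ℝ} (hL : LipschitzWith K Y)
    (hB : ∀ x, ‖Y x‖ ≤ B) : ∃ ψ, IsVectorFlow Y ψ := by
  have hB0 : 0 ≤ B := (norm_nonneg _).trans (hB 0)
  have loc : ∀ (x : E) (T : ℝ), 0 ≤ T → ∃ α : ℝ → E, α 0 = x ∧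
      ∀ t ∈ Ioo (-T) T, HasDerivAt α (Y (α t)) t := by
    intro x T hT
    have hP : IsPicardLindelof (fun _ => Y) (tmin := -T) (tmax := T) ⟨0, by simpa using hT⟩ x
        ⟨B * T, by positivity⟩ 0 ⟨B, hB0⟩ K :=
      IsPicardLindelof.of_time_independent (fun y _ => hB y) hL.lipschitzOnWith (by
          simp only [sub_zero, sub_neg_eq_add, zero_add, max_self, NNReal.coe_zero]
          exact le_rfl)
    obtain ⟨α, h0, hα⟩ := hP.exists_eq_forall_mem_Icc_hasDerivWithinAt₀
    exact ⟨α, h0, fun t ht => (hα t ⟨ht.1.le, ht.2.le⟩).hasDerivAt (Icc_mem_nhds ht.1 ht.2)⟩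
  choose α h0 hα using fun (x : E) (T : ℝ) => loc x |T| (abs_nonneg T)
  have agree : ∀ x T T', |T| ≤ |T'| → 0 < |T| → EqOn (α x T) (α x T') (Ioo (-|T|) |T|) := by
    intro x T T' h hT
    refine ODE_solution_unique_of_mem_Ioo (v := fun _ => Y) (s := fun _ => univ) (K := K) (t₀ := 0)
      (fun t _ => hL.lipschitzOnWith) (by simpa using hT) (fun t ht => ⟨hα x T t ht, trivial⟩)
      (fun t ht => ⟨hα x T' t ⟨by linarith [ht.1], by linarith [ht.2]⟩, trivial⟩) ?_
    rw [h0, h0]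
  -- The solution used at time `t` is the one on the window of size |t| + 1. For times s near `t`
  -- these windows lie inside the window of size |t| + 2, so a single solution serves for the
  -- derivative.
  refine ⟨fun t x => α x (|t| + 1) t, ⟨fun x => h0 x _, fun x t => ?_⟩⟩
  have ht1 : |(|t| + 1)| = |t| + 1 := abs_of_pos (by positivity)
  have ht2 : |(|t| + 2)| = |t| + 2 := abs_of_pos (by positivity)
  have hev : (fun s => α x (|s| + 1) s) =ᶠ[𝓝 t] α x (|t| + 2) := by
    have : ∀ᶠ s in 𝓝 t, |s| < |t| + 1 :=
      continuous_abs.continuousAt.eventually_lt continuousAt_const (by simp)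
    filter_upwards [this] with s hs
    have hs1 : |(|s| + 1)| = |s| + 1 := abs_of_pos (by positivity)
    refine agree x (|s| + 1) (|t| + 2) (by rw [hs1, ht2]; linarith) (by rw [hs1]; positivity) ?_
    rw [hs1]
    constructor <;> linarith [neg_abs_le s, le_abs_self s]
  have hmem : t ∈ Ioo (-|(|t| + 2)|) |(|t| + 2)| := by
    rw [ht2]
    constructor <;> linarith [neg_abs_le t, le_abs_self t]
  have := (hα x (|t| + 2) t hmem).congr_of_eventuallyEq hev
  rwa [← hev.eq_of_nhds] at this

namespace IsVectorFlow

variable {Y : E → E} {ψ : ℝ → E → E}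

theorem add (h : IsVectorFlow Y ψ) {K : ℝ≥0} (hL : LipschitzWith K Y) (s t : ℝ) (x : E) :
    ψ s (ψ t x) = ψ (s + t) x := by
  have := ODE_solution_unique_univ (v := fun _ => Y) (s := fun _ => univ) (K := K) (t₀ := 0)
    (f := fun s => ψ s (ψ t x)) (g := fun s => ψ (s + t) x) (fun t => hL.lipschitzOnWith)
    (fun s => ⟨h.hasDerivAt _ s, trivial⟩)
    (fun s => ⟨(h.hasDerivAt x (s + t)).comp_add_const s t, trivial⟩)
    (by simp [h.zero])
  exact congrFun this s

theorem neg_apply (h : IsVectorFlow Y ψ) {K : ℝ≥0} (hL : LipschitzWith K Y) (t : ℝ) (x : E) :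
    ψ (-t) (ψ t x) = x := by
  rw [h.add hL, neg_add_cancel, h.zero]

theorem apply_neg (h : IsVectorFlow Y ψ) {K : ℝ≥0} (hL : LipschitzWith K Y) (t : ℝ) (x : E) :
    ψ t (ψ (-t) x) = x := by
  rw [h.add hL, add_neg_cancel, h.zero]

theorem eq_of_eq_zero (h : IsVectorFlow Y ψ) {K : ℝ≥0} (hL : LipschitzWith K Y) {x : E}
    (hx : Y x = 0) (t : ℝ) : ψ t x = x := by
  have := ODE_solution_unique_univ (v := fun _ => Y) (s := fun _ => univ) (K := K) (t₀ := 0)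
    (f := fun s => ψ s x) (g := fun _ => x) (fun t => hL.lipschitzOnWith)
    (fun s => ⟨h.hasDerivAt _ s, trivial⟩)
    (fun s => ⟨by simpa [hx] using hasDerivAt_const s x, trivial⟩)
    (h.zero x)
  exact congrFun this t

/-- A closed set containing the support of the field is invariant. -/
theorem mem_iff (h : IsVectorFlow Y ψ) {K : ℝ≥0} (hL : LipschitzWith K Y) {s : Set E}
    (hs : Function.support Y ⊆ s) (t : ℝ) (x : E) : ψ t x ∈ s ↔ x ∈ s := by
  have key : ∀ t x, x ∉ s → ψ t x = x := fun t x hx =>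
    h.eq_of_eq_zero hL (by by_contra hne; exact hx (hs hne)) t
  constructor
  · intro hm
    by_contra hx
    exact hx (key t x hx ▸ hm)
  · intro hm
    by_contra hx
    have := key (-t) _ hx
    rw [h.neg_apply hL] at this
    exact hx (this ▸ hm)

/-- The flow of a compactly supported `C²` field is differentiable in space for small times, with
derivative differentiable in time. -/
theorem exists_hasFDerivAt (h : IsVectorFlow Y ψ) (hY : ContDiff ℝ 2 Y)
    (hc : HasCompactSupport Y) :
    ∃ ε > 0, ∃ C : ℝ, ∃ J : ℝ → E → E →L[ℝ] E, ∀ x,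
      HasDerivAt (fun t => J t x) (fderiv ℝ Y x) 0 ∧ J 0 x = ContinuousLinearMap.id ℝ E ∧
      ∀ t, |t| < ε → HasFDerivAt (ψ t) (J t x) x ∧
        ‖J t x - ContinuousLinearMap.id ℝ E‖ ≤ C * |t| ∧ ‖ψ t x - x‖ ≤ C * |t| := by
  have hdY : ContDiff ℝ 1 (fderiv ℝ Y) := hY.fderiv_right (by norm_num)
  obtain ⟨B₁, hB₁⟩ := hY.continuous.bounded_above_of_compact_support hc
  obtain ⟨B₂, hB₂⟩ := hdY.continuous.bounded_above_of_compact_support (hc.fderiv ℝ)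
  obtain ⟨B₃, hB₃⟩ := (hdY.continuous_fderiv one_ne_zero).bounded_above_of_compact_support
    ((hc.fderiv ℝ).fderiv ℝ)
  obtain ⟨B, hB1, hBY, hBD, hBDD⟩ : ∃ B : ℝ, 1 ≤ B ∧ (∀ x, ‖Y x‖ ≤ B) ∧
      (∀ x, ‖fderiv ℝ Y x‖ ≤ B) ∧ ∀ x, ‖fderiv ℝ (fderiv ℝ Y) x‖ ≤ B :=
    ⟨max 1 (max B₁ (max B₂ B₃)), le_max_left _ _,
      fun x => (hB₁ x).trans ((le_max_left _ _).trans (le_max_right _ _)),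
      fun x => (hB₂ x).trans ((le_max_left _ _).trans ((le_max_right _ _).trans (le_max_right _ _))),
      fun x => (hB₃ x).trans ((le_max_right _ _).trans ((le_max_right _ _).trans
        (le_max_right _ _)))⟩
  have hB0 : 0 < B := by linarith
  have hYd : ∀ x, HasFDerivAt Y (fderiv ℝ Y x) x := fun x =>
    (hY.differentiable (by norm_num) x).hasFDerivAt
  have hlipY : ∀ a b, ‖Y b - Y a‖ ≤ B * ‖b - a‖ := fun a b =>
    convex_univ.norm_image_sub_le_of_norm_hasFDerivWithin_le
      (fun x _ => (hYd x).hasFDerivWithinAt) (fun x _ => hBD x) trivial trivial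
  have hlipD : ∀ a b, ‖fderiv ℝ Y b - fderiv ℝ Y a‖ ≤ B * ‖b - a‖ := fun a b =>
    convex_univ.norm_image_sub_le_of_norm_fderiv_le
      (fun x _ => hdY.differentiable one_ne_zero x) (fun x _ => hBDD x) trivial trivial
  -- The mean value inequality on the segment, where the derivative of `Y` differs from its value at
  -- `a` by at most B‖b - a‖.
  have htaylor : ∀ a b, ‖Y b - Y a - fderiv ℝ Y a (b - a)‖ ≤ B * ‖b - a‖ * ‖b - a‖ := by
    intro a b
    refine (convex_segment a b).norm_image_sub_le_of_norm_hasFDerivWithin_le'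
      (fun x _ => (hYd x).hasFDerivWithinAt) (fun x hx => ?_)
      (left_mem_segment ℝ a b) (right_mem_segment ℝ a b)
    refine (hlipD a x).trans ?_
    gcongr
    obtain ⟨θ, hθ, rfl⟩ := (segment_eq_image' ℝ a b) ▸ hx
    rw [add_sub_cancel_left, norm_smul, Real.norm_eq_abs, abs_of_nonneg hθ.1]
    exact mul_le_of_le_one_left (norm_nonneg _) hθ.2
  set I := ContinuousLinearMap.id ℝ E
  -- `L` bounds the right side of the variational equation on the unit ball around the identity.
  -- During a time ε with L ε ≤ 1 the solution stays in this ball, and ε does not depend on the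
  -- point.
  set L : ℝ := B * (‖I‖ + 1)
  have hL0 : 0 ≤ L := by positivity
  set ε : ℝ := 1 / (L + 1)
  have hε0 : 0 < ε := by positivity
  have hε1 : ε ≤ 1 := by
    rw [div_le_one (by positivity)]; linarith
  -- The candidate for the spatial derivative of the flow solves the linearized equation J' = DY(ψ_t
  -- x) J with J(0) = id.
  have hJ : ∀ x, ∃ J : ℝ → E →L[ℝ] E, J 0 = I ∧ ∀ t, |t| < ε →
      HasDerivAt J ((fderiv ℝ Y (ψ t x)).comp (J t)) t := by
    intro x
    have hP : IsPicardLindelof (fun t (A : E →L[ℝ] E) => (fderiv ℝ Y (ψ t x)).comp A)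
        (tmin := -ε) (tmax := ε) ⟨0, by simpa using hε0.le⟩ I 1 0 ⟨L, hL0⟩ ⟨B, hB0.le⟩ := by
      refine ⟨fun t _ => ?_, fun A _ => ?_, fun t _ A hA => ?_, ?_⟩
      · refine (LipschitzWith.of_dist_le_mul fun A A' => ?_).lipschitzOnWith
        rw [dist_eq_norm, dist_eq_norm, ← ContinuousLinearMap.comp_sub]
        exact (ContinuousLinearMap.opNorm_comp_le _ _).trans (by gcongr; exact hBD _)
      · have hψ : Continuous fun t => ψ t x :=
          continuous_iff_continuousAt.2 fun t => (h.hasDerivAt x t).continuousAt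
        exact ((hdY.continuous.comp hψ).clm_comp continuous_const).continuousOn
      · refine (ContinuousLinearMap.opNorm_comp_le _ _).trans ?_
        have hA' : ‖A‖ ≤ ‖I‖ + 1 := by
          have h1 : ‖A - I‖ ≤ 1 := by simpa [dist_eq_norm] using hA
          calc ‖A‖ = ‖I + (A - I)‖ := by congr 1; abel
            _ ≤ ‖I‖ + ‖A - I‖ := norm_add_le _ _
            _ ≤ _ := by linarith
        exact mul_le_mul (hBD _) hA' (norm_nonneg _) hB0.le
      · have : L * ε ≤ 1 := by
          rw [mul_one_div, div_le_one (by positivity)]; linarith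
        rw [sub_zero, sub_neg_eq_add, zero_add, max_self, NNReal.coe_zero, sub_zero, NNReal.coe_one]
        exact this
    obtain ⟨J, h0, hd⟩ := hP.exists_eq_forall_mem_Icc_hasDerivWithinAt₀
    refine ⟨J, h0, fun t ht => (hd t ?_).hasDerivAt (Icc_mem_nhds ?_ ?_)⟩ <;>
    simp only [abs_lt] at ht
    exacts [⟨ht.1.le, ht.2.le⟩, ht.1, ht.2]
  choose J hJ0 hJd using hJ
  -- A Lipschitz constant of the flow maps for times below ε: Grönwall is applied to ψ_t(x + w) -
  -- ψ_t(x) - w, which vanishes at time zero.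
  set D : ℝ := 1 + B * Real.exp B
  have hD0 : 0 ≤ D := by positivity
  have hdiff : ∀ x w t, |t| < ε → ‖ψ t (x + w) - ψ t x‖ ≤ D * ‖w‖ := by
    intro x w t ht
    have := norm_le_of_norm_deriv_le (f := fun t => ψ t (x + w) - ψ t x - w)
      (f' := fun t => Y (ψ t (x + w)) - Y (ψ t x)) (B := B) (η := B * ‖w‖) hB0 hε1 (by positivity)
      (by simp [h.zero]) (fun t _ => ((h.hasDerivAt _ t).sub (h.hasDerivAt _ t)).sub_const w)
      (fun t _ => by
        refine (hlipY _ _).trans ?_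
        rw [← mul_add]
        gcongr
        calc ‖ψ t (x + w) - ψ t x‖ = ‖(ψ t (x + w) - ψ t x - w) + w‖ := by congr 1; abel
          _ ≤ _ := norm_add_le _ _) ht
    have h2 : B * ‖w‖ * Real.exp B * |t| ≤ B * ‖w‖ * Real.exp B :=
      mul_le_of_le_one_right (by positivity) (ht.le.trans hε1)
    calc ‖ψ t (x + w) - ψ t x‖ = ‖(ψ t (x + w) - ψ t x - w) + w‖ := by congr 1; abel
      _ ≤ ‖ψ t (x + w) - ψ t x - w‖ + ‖w‖ := norm_add_le _ _
      _ ≤ B * ‖w‖ * Real.exp B + ‖w‖ := by linarith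
      _ = D * ‖w‖ := by ring
  refine ⟨ε, hε0, B * Real.exp B, fun t x => J x t, fun x => ⟨?_, hJ0 x, fun t ht => ⟨?_, ?_, ?_⟩⟩⟩
  · have := hJd x 0 (by simpa using hε0)
    rw [h.zero, hJ0] at this
    exact this
  · refine HasFDerivAt.of_isLittleO ?_
    -- The remainder of the linear approximation satisfies a linear differential inequality whose
    -- inhomogeneous term is the Taylor error of `Y`, which is quadratic in `w`.
    have hquad : ∀ w, ‖ψ t (x + w) - ψ t x - J x t w‖ ≤ B * D ^ 2 * Real.exp B * ‖w‖ ^ 2 := by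
      intro w
      have := norm_le_of_norm_deriv_le (f := fun t => ψ t (x + w) - ψ t x - J x t w)
        (f' := fun t => Y (ψ t (x + w)) - Y (ψ t x) - fderiv ℝ Y (ψ t x) (J x t w))
        (B := B) (η := B * D ^ 2 * ‖w‖ ^ 2) hB0 hε1 (by positivity)
        (by simp [h.zero, hJ0, I])
        (fun t ht => ((h.hasDerivAt _ t).sub (h.hasDerivAt _ t)).sub
          ((hJd x t ht).clm_apply (hasDerivAt_const t w) |>.congr_deriv (by simp)))
        (fun t ht => by
          have h1 := htaylor (ψ t x) (ψ t (x + w))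
          have h2 := hdiff x w t ht
          have e : Y (ψ t (x + w)) - Y (ψ t x) - fderiv ℝ Y (ψ t x) (J x t w) =
              (Y (ψ t (x + w)) - Y (ψ t x) - fderiv ℝ Y (ψ t x) (ψ t (x + w) - ψ t x)) +
              fderiv ℝ Y (ψ t x) (ψ t (x + w) - ψ t x - J x t w) := by
            simp only [map_sub]; abel
          rw [e]
          refine (norm_add_le _ _).trans ?_
          have h3 : ‖fderiv ℝ Y (ψ t x) (ψ t (x + w) - ψ t x - J x t w)‖ ≤
              B * ‖ψ t (x + w) - ψ t x - J x t w‖ :=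
            (ContinuousLinearMap.le_opNorm _ _).trans (by gcongr; exact hBD _)
          have h4 : B * ‖ψ t (x + w) - ψ t x‖ * ‖ψ t (x + w) - ψ t x‖ ≤
              B * (D * ‖w‖) * (D * ‖w‖) := by gcongr
          have h5 : B * (D * ‖w‖) * (D * ‖w‖) = B * D ^ 2 * ‖w‖ ^ 2 := by ring
          linarith) ht
      refine this.trans ?_
      have h1 : |t| ≤ 1 := ht.le.trans hε1
      calc B * D ^ 2 * ‖w‖ ^ 2 * Real.exp B * |t| ≤ B * D ^ 2 * ‖w‖ ^ 2 * Real.exp B :=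
            mul_le_of_le_one_right (by positivity) h1
        _ = _ := by ring
    have hO : (fun w => ψ t (x + w) - ψ t x - J x t w) =O[𝓝 0] fun w => ‖w‖ ^ 2 :=
      Asymptotics.IsBigO.of_bound (B * D ^ 2 * Real.exp B) (Eventually.of_forall fun w => by
        rw [Real.norm_of_nonneg (by positivity : 0 ≤ ‖w‖ ^ 2)]; exact hquad w)
    have ho : (fun w => ψ t (x + w) - ψ t x - J x t w) =o[𝓝 0] fun w => w :=
      hO.trans_isLittleO (Asymptotics.isLittleO_norm_pow_id one_lt_two)
    have := ho.comp_tendsto (k := fun x' => x' - x) (l' := 𝓝 x)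
      (by simpa using (continuous_sub_right x).tendsto x)
    simpa [Function.comp_def] using this
  · exact norm_le_of_norm_deriv_le (f := fun t => J x t - I)
      (f' := fun t => (fderiv ℝ Y (ψ t x)).comp (J x t)) (B := B) (η := B) hB0 hε1 hB0.le
      (by simp [hJ0]) (fun t ht => (hJd x t ht).sub_const I)
      (fun t ht => by
        have e : (fderiv ℝ Y (ψ t x)).comp (J x t) =
            (fderiv ℝ Y (ψ t x)).comp (J x t - I) + fderiv ℝ Y (ψ t x) := by
          rw [ContinuousLinearMap.comp_sub]; simp [I]
        rw [e]
        refine (norm_add_le _ _).trans (add_le_add ?_ (hBD _))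
        exact (ContinuousLinearMap.opNorm_comp_le _ _).trans (by gcongr; exact hBD _)) ht
  · exact norm_le_of_norm_deriv_le (f := fun t => ψ t x - x)
      (f' := fun t => Y (ψ t x)) (B := B) (η := B) hB0 hε1 hB0.le
      (by simp [h.zero]) (fun t ht => (h.hasDerivAt x t).sub_const x)
      (fun t ht => by
        have := hBY (ψ t x)
        have h2 : 0 ≤ B * ‖ψ t x - x‖ := by positivity
        linarith) ht

end IsVectorFlow

end Flow

/-! ### Vector fields and the metric in the coordinates of a chart -/

section MatrixBilin

variable {ι : Type*} [Fintype ι] {F : Type*} [NormedAddCommGroup F] [NormedSpace ℝ F]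

/-- The bilinear form with a given matrix, in linear coordinates `p`. -/
def matrixBilin (p : ι → F →L[ℝ] ℝ) (A : Matrix ι ι ℝ) : F →L[ℝ] F →L[ℝ] ℝ :=
  ∑ i, ∑ j, A i j • (p i).smulRight (p j)

theorem matrixBilin_apply (p : ι → F →L[ℝ] ℝ) (A : Matrix ι ι ℝ) (u w : F) :
    matrixBilin p A u w = ∑ i, ∑ j, A i j * (p i u * p j w) := by
  simp only [matrixBilin, sum_apply, smul_apply, ContinuousLinearMap.smulRight_apply, smul_eq_mul]

theorem contDiffAt_fun_smul_vec {W G : Type*} [NormedAddCommGroup W] [NormedSpace ℝ W]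
    [NormedAddCommGroup G] [NormedSpace ℝ G] {k : WithTop ℕ∞} (v : G) {f : W → ℝ} {w : W}
    (hf : ContDiffAt ℝ k f w) : ContDiffAt ℝ k (fun s => f s • v) w :=
  hf.fun_smul contDiffAt_const

theorem contDiffAt_matrixBilin {W : Type*} [NormedAddCommGroup W] [NormedSpace ℝ W]
    {k : WithTop ℕ∞} (p : ι → F →L[ℝ] ℝ) {A : W → Matrix ι ι ℝ} {w : W}
    (hA : ∀ i j, ContDiffAt ℝ k (fun s => A s i j) w) :
    ContDiffAt ℝ k (fun s => matrixBilin p (A s)) w :=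
  ContDiffAt.sum fun i _ => ContDiffAt.sum fun j _ => contDiffAt_fun_smul_vec _ (hA i j)

end MatrixBilin

section Coordinates

variable {n : ℕ} {M : Type*} [TopologicalSpace M] [ChartedSpace (EuclideanSpace ℝ (Fin n)) M]
  [IsManifold (𝓡 n) ∞ M]

/-- The derivative of the inverse of the chart at `c`. -/
def chartD (c : M) (y : EuclideanSpace ℝ (Fin n)) : EuclideanSpace ℝ (Fin n) →L[ℝ]
    TangentSpace (𝓡 n) ((chartAt (EuclideanSpace ℝ (Fin n)) c).symm y) :=
  mfderiv (𝓡 n) (𝓡 n) (chartAt (EuclideanSpace ℝ (Fin n)) c).symm y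

variable {c : M} {y : EuclideanSpace ℝ (Fin n)}

theorem contMDiffAt_chart_symm (hy : y ∈ (chartAt (EuclideanSpace ℝ (Fin n)) c).target) :
    ContMDiffAt (𝓡 n) (𝓡 n) ∞ (chartAt (EuclideanSpace ℝ (Fin n)) c).symm y :=
  (contMDiffOn_chart_symm (I := 𝓡 n) (n := ∞) (x := c)).contMDiffAt
    ((chartAt (EuclideanSpace ℝ (Fin n)) c).open_target.mem_nhds hy)

theorem contMDiffAt_chart {x : M} (hx : x ∈ (chartAt (EuclideanSpace ℝ (Fin n)) c).source) :
    ContMDiffAt (𝓡 n) (𝓡 n) ∞ (chartAt (EuclideanSpace ℝ (Fin n)) c) x :=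
  (contMDiffOn_chart (I := 𝓡 n) (n := ∞) (x := c)).contMDiffAt
    ((chartAt (EuclideanSpace ℝ (Fin n)) c).open_source.mem_nhds hx)

theorem chartD_bijective (hy : y ∈ (chartAt (EuclideanSpace ℝ (Fin n)) c).target) :
    Function.Bijective (chartD c y) :=
  (mdifferentiable_chart (I := 𝓡 n) c).symm.mfderiv_bijective hy

theorem isInvertible_mfderiv_chart_symm
    (hy : y ∈ (chartAt (EuclideanSpace ℝ (Fin n)) c).target) :
    (mfderiv (𝓡 n) (𝓡 n) (chartAt (EuclideanSpace ℝ (Fin n)) c).symm y).IsInvertible :=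
  ⟨(mdifferentiable_chart (I := 𝓡 n) c).symm.mfderiv hy, rfl⟩

theorem isInvertible_mfderiv_chart {x : M}
    (hx : x ∈ (chartAt (EuclideanSpace ℝ (Fin n)) c).source) :
    (mfderiv (𝓡 n) (𝓡 n) (chartAt (EuclideanSpace ℝ (Fin n)) c) x).IsInvertible :=
  ⟨(mdifferentiable_chart (I := 𝓡 n) c).mfderiv hx, rfl⟩

/-- The coordinate frame of the chart at `c`, at the point of coordinates `y`. -/
def coordBasis (c : M) (y : EuclideanSpace ℝ (Fin n))
    (hy : y ∈ (chartAt (EuclideanSpace ℝ (Fin n)) c).target) : Module.Basis (Fin n) ℝ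
      (TangentSpace (𝓡 n) ((chartAt (EuclideanSpace ℝ (Fin n)) c).symm y)) :=
  (EuclideanSpace.basisFun (Fin n) ℝ).toBasis.map
    (LinearEquiv.ofBijective (chartD c y).toLinearMap (chartD_bijective hy))

theorem coordBasis_apply (hy : y ∈ (chartAt (EuclideanSpace ℝ (Fin n)) c).target) (i : Fin n) :
    coordBasis c y hy i = chartD c y (EuclideanSpace.single i (1 : ℝ)) := by
  simp [coordBasis]

/-- The representative of the vector field `X` in the coordinates of the chart at `c`. -/
def coordRep (c : M) (X : (x : M) → TangentSpace (𝓡 n) x) :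
    EuclideanSpace ℝ (Fin n) → EuclideanSpace ℝ (Fin n) :=
  VectorField.mpullback (𝓡 n) (𝓡 n) (chartAt (EuclideanSpace ℝ (Fin n)) c).symm X

theorem coordRep_eq (hy : y ∈ (chartAt (EuclideanSpace ℝ (Fin n)) c).target)
    {X : (x : M) → TangentSpace (𝓡 n) x} {u : EuclideanSpace ℝ (Fin n)}
    (h : X ((chartAt (EuclideanSpace ℝ (Fin n)) c).symm y) = chartD c y u) :
    coordRep c X y = u := by
  rw [coordRep, VectorField.mpullback_apply, h]
  exact (isInvertible_mfderiv_chart_symm hy).inverse_apply_self u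

theorem chartD_coordRep (hy : y ∈ (chartAt (EuclideanSpace ℝ (Fin n)) c).target)
    (X : (x : M) → TangentSpace (𝓡 n) x) :
    chartD c y (coordRep c X y) = X ((chartAt (EuclideanSpace ℝ (Fin n)) c).symm y) := by
  obtain ⟨u, hu⟩ := (chartD_bijective hy).2 (X ((chartAt (EuclideanSpace ℝ (Fin n)) c).symm y))
  rw [coordRep_eq hy hu.symm, hu]

theorem differentiableAt_coordRep (hy : y ∈ (chartAt (EuclideanSpace ℝ (Fin n)) c).target)
    {X : (x : M) → TangentSpace (𝓡 n) x}
    (hX : MDifferentiableAt (𝓡 n) (𝓡 n).tangent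
      (fun x => (⟨x, X x⟩ : TangentBundle (𝓡 n) M))
      ((chartAt (EuclideanSpace ℝ (Fin n)) c).symm y)) :
    DifferentiableAt ℝ (coordRep c X) y := by
  have := hX.mpullback_vectorField (contMDiffAt_chart_symm hy)
    (isInvertible_mfderiv_chart_symm hy) (by norm_cast)
  exact ((contMDiff_snd_tangentBundle_modelSpace (EuclideanSpace ℝ (Fin n))
    (𝓡 n)).contMDiffAt.mdifferentiableAt one_ne_zero |>.comp y this).differentiableAt

theorem contDiffAt_coordRep (hy : y ∈ (chartAt (EuclideanSpace ℝ (Fin n)) c).target)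
    {X : (x : M) → TangentSpace (𝓡 n) x}
    (hX : ContMDiffAt (𝓡 n) (𝓡 n).tangent ∞
      (fun x => (⟨x, X x⟩ : TangentBundle (𝓡 n) M))
      ((chartAt (EuclideanSpace ℝ (Fin n)) c).symm y)) :
    ContDiffAt ℝ ∞ (coordRep c X) y := by
  have := hX.mpullback_vectorField_preimage (contMDiffAt_chart_symm hy)
    (isInvertible_mfderiv_chart_symm hy) (by simp)
  exact contMDiffAt_vectorSpace_iff_contDiffAt.1 this

/-- The vector field with constant coordinates `u` in the chart at `c`. -/
def coordField (c : M) (u : EuclideanSpace ℝ (Fin n)) (x : M) : TangentSpace (𝓡 n) x :=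
  (mfderiv (𝓡 n) (𝓡 n) (chartAt (EuclideanSpace ℝ (Fin n)) c) x).inverse u

theorem coordField_eq (hy : y ∈ (chartAt (EuclideanSpace ℝ (Fin n)) c).target)
    (u : EuclideanSpace ℝ (Fin n)) :
    coordField c u ((chartAt (EuclideanSpace ℝ (Fin n)) c).symm y) = chartD c y u := by
  set e := chartAt (EuclideanSpace ℝ (Fin n)) c
  have hx := e.map_target hy
  rw [coordField]
  have h1 := (mdifferentiable_chart (I := 𝓡 n) c).comp_symm_deriv hy
  have h2 : mfderiv (𝓡 n) (𝓡 n) e (e.symm y) (chartD c y u) = u := DFunLike.congr_fun h1 u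
  conv_lhs => rw [← h2]
  exact (isInvertible_mfderiv_chart hx).inverse_apply_self _

theorem contMDiffOn_coordField (c : M) (u : EuclideanSpace ℝ (Fin n)) :
    ContMDiffOn (𝓡 n) (𝓡 n).tangent ∞
      (fun x => (⟨x, coordField c u x⟩ : TangentBundle (𝓡 n) M))
      (chartAt (EuclideanSpace ℝ (Fin n)) c).source := by
  intro x hx
  refine ContMDiffAt.contMDiffWithinAt ?_
  let V : (y : EuclideanSpace ℝ (Fin n)) → TangentSpace (𝓡 n) y := fun _ => u
  have hV : ContMDiffAt (𝓡 n) (𝓡 n).tangent ∞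
      (fun y => (⟨y, V y⟩ : TangentBundle (𝓡 n) (EuclideanSpace ℝ (Fin n))))
      (chartAt (EuclideanSpace ℝ (Fin n)) c x) :=
    contMDiffAt_vectorSpace_iff_contDiffAt.2 contDiffAt_const
  exact hV.mpullback_vectorField_preimage (contMDiffAt_chart hx)
    (isInvertible_mfderiv_chart hx) (by simp)

theorem mvfderiv_chartD (hy : y ∈ (chartAt (EuclideanSpace ℝ (Fin n)) c).target) {f : M → ℝ}
    (hf : MDifferentiableAt (𝓡 n) 𝓘(ℝ, ℝ) f ((chartAt (EuclideanSpace ℝ (Fin n)) c).symm y))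
    (u : EuclideanSpace ℝ (Fin n)) :
    mvfderiv (𝓡 n) f ((chartAt (EuclideanSpace ℝ (Fin n)) c).symm y) (chartD c y u) =
      fderiv ℝ (f ∘ (chartAt (EuclideanSpace ℝ (Fin n)) c).symm) y u := by
  have := mvfderiv_comp_apply y hf ((contMDiffAt_chart_symm hy).mdifferentiableAt (by simp)) u
  rw [← mfderiv_eq_fderiv]
  exact this.symm

variable [RiemannianBundle (fun x : M => TangentSpace (𝓡 n) x)]

/-- The matrix `(g_ij)` of the metric in the chart at `c`. -/
def chartGram (c : M) (y : EuclideanSpace ℝ (Fin n)) : Matrix (Fin n) (Fin n) ℝ :=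
  gramMat fun i => chartD c y (EuclideanSpace.single i (1 : ℝ))

theorem gramDet_eq (c : M) (y : EuclideanSpace ℝ (Fin n)) : gramDet c y = (chartGram c y).det :=
  rfl

theorem gramDet_pos (hy : y ∈ (chartAt (EuclideanSpace ℝ (Fin n)) c).target) :
    0 < gramDet c y := by
  have := gramMat_det_pos (coordBasis c y hy)
  simp_rw [gramMat, coordBasis_apply] at this
  exact this

/-- The metric in the chart at `c`, as a field of bilinear forms. -/
def chartMetric (c : M) (y : EuclideanSpace ℝ (Fin n)) :
    EuclideanSpace ℝ (Fin n) →L[ℝ] EuclideanSpace ℝ (Fin n) →L[ℝ] ℝ :=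
  matrixBilin (fun i => (EuclideanSpace.proj i : EuclideanSpace ℝ (Fin n) →L[ℝ] ℝ))
    (chartGram c y)

theorem chartMetric_apply (c : M) (y u w : EuclideanSpace ℝ (Fin n)) :
    chartMetric c y u w = inner ℝ (chartD c y u) (chartD c y w) := by
  have h : ∀ u : EuclideanSpace ℝ (Fin n), chartD c y u =
      ∑ i, u i • chartD c y (EuclideanSpace.single i (1 : ℝ)) := by
    intro u
    conv_lhs => rw [← (EuclideanSpace.basisFun (Fin n) ℝ).sum_repr u]
    simp
  rw [h u, h w]
  rw [chartMetric, matrixBilin_apply]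
  simp only [PiLp.proj_apply, sum_inner, inner_sum, real_inner_smul_left, real_inner_smul_right]
  rw [Finset.sum_comm]
  refine Finset.sum_congr rfl fun i _ => Finset.sum_congr rfl fun j _ => ?_
  rw [chartGram, gramMat_apply]
  ring

theorem chartMetric_symm (c : M) (y u w : EuclideanSpace ℝ (Fin n)) :
    chartMetric c y u w = chartMetric c y w u := by
  rw [chartMetric_apply, chartMetric_apply, real_inner_comm]

variable [IsContMDiffRiemannianBundle (𝓡 n) ∞ (EuclideanSpace ℝ (Fin n))
      (fun x : M => TangentSpace (𝓡 n) x)]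

/-- On the domain of the chart the entries are inner products of coordinate fields, which are smooth
sections there. -/
theorem contDiffAt_chartGram (hy : y ∈ (chartAt (EuclideanSpace ℝ (Fin n)) c).target)
    (i j : Fin n) : ContDiffAt ℝ ∞ (fun y => chartGram c y i j) y := by
  set e := chartAt (EuclideanSpace ℝ (Fin n)) c
  have h := (contMDiffOn_coordField c (EuclideanSpace.single i (1 : ℝ))).inner_bundle
    (contMDiffOn_coordField c (EuclideanSpace.single j (1 : ℝ)))
  have h1 := (h.contMDiffAt (e.open_source.mem_nhds (e.map_target hy))).comp y
    (contMDiffAt_chart_symm hy)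
  refine (contMDiffAt_iff_contDiffAt.1 h1).congr_of_eventuallyEq ?_
  filter_upwards [e.open_target.mem_nhds hy] with y' hy'
  simp only [Function.comp, chartGram, gramMat_apply]
  rw [coordField_eq hy', coordField_eq hy']

theorem contDiffAt_chartMetric (hy : y ∈ (chartAt (EuclideanSpace ℝ (Fin n)) c).target) :
    ContDiffAt ℝ ∞ (chartMetric c) y :=
  contDiffAt_matrixBilin _ fun i j => contDiffAt_chartGram hy i j

theorem contDiffAt_gramDet (hy : y ∈ (chartAt (EuclideanSpace ℝ (Fin n)) c).target) :
    ContDiffAt ℝ ∞ (gramDet c) y :=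
  contDiffAt_det fun i j => contDiffAt_chartGram hy i j

end Coordinates

/-! ### The Levi-Civita connection in coordinates -/

section LocalConnection

variable {F : Type*} [NormedAddCommGroup F] [NormedSpace ℝ F]

/-- `⟨∇_u X, w⟩` at `y` for the Levi-Civita connection of a metric `g` on a vector space. -/
def localConn (g : F → F →L[ℝ] F →L[ℝ] ℝ) (X : F → F) (y u w : F) : ℝ :=
  g y (fderiv ℝ X y u) w +
    1 / 2 * (fderiv ℝ g y u (X y) w + fderiv ℝ g y (X y) w u - fderiv ℝ g y w u (X y))

variable {g : F → F →L[ℝ] F →L[ℝ] ℝ} {X Y Z : F → F} {y : F}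

theorem fderiv_bilin (hg : DifferentiableAt ℝ g y) (hX : DifferentiableAt ℝ X y)
    (hZ : DifferentiableAt ℝ Z y) (u : F) :
    fderiv ℝ (fun y => g y (X y) (Z y)) y u =
      fderiv ℝ g y u (X y) (Z y) + g y (fderiv ℝ X y u) (Z y) + g y (X y) (fderiv ℝ Z y u) := by
  have := (hg.hasFDerivAt.clm_apply hX.hasFDerivAt).clm_apply hZ.hasFDerivAt
  rw [this.fderiv]
  simp
  ring

theorem fderiv_bilin_symm (hs : ∀ y u w, g y u w = g y w u) (hg : DifferentiableAt ℝ g y)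
    (v u w : F) : fderiv ℝ g y v u w = fderiv ℝ g y v w u := by
  have h1 := fderiv_bilin hg (differentiableAt_const u) (differentiableAt_const w) v
  have h2 := fderiv_bilin hg (differentiableAt_const w) (differentiableAt_const u) v
  simp only [hs _ u w] at h1
  rw [h1] at h2
  simpa using h2

/-- All derivatives of `Y` and `Z` cancel in Koszul's expression, so only the values of these two
fields at `y` matter. -/
theorem localConn_eq_koszul (hs : ∀ y u w, g y u w = g y w u) (hg : DifferentiableAt ℝ g y)
    (hX : DifferentiableAt ℝ X y) (hY : DifferentiableAt ℝ Y y) (hZ : DifferentiableAt ℝ Z y) :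
    1 / 2 * (fderiv ℝ (fun y => g y (X y) (Z y)) y (Y y) +
      fderiv ℝ (fun y => g y (Z y) (Y y)) y (X y) - fderiv ℝ (fun y => g y (Y y) (X y)) y (Z y) +
      g y (VectorField.lieBracket ℝ Y X y) (Z y) - g y (VectorField.lieBracket ℝ X Z y) (Y y) +
      g y (VectorField.lieBracket ℝ Z Y y) (X y)) = localConn g X y (Y y) (Z y) := by
  simp only [fderiv_bilin hg hX hZ, fderiv_bilin hg hZ hY, fderiv_bilin hg hY hX,
    VectorField.lieBracket_eq, localConn, map_sub, sub_apply]
  rw [hs y (fderiv ℝ Z y (X y)) (Y y), hs y (X y) (fderiv ℝ Z y (Y y)),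
    hs y (fderiv ℝ Y y (X y)) (Z y), hs y (fderiv ℝ X y (Z y)) (Y y),
    hs y (fderiv ℝ Y y (Z y)) (X y), hs y (fderiv ℝ Z y (Y y)) (X y)]
  ring

set_option synthInstance.maxHeartbeats 200000 in
theorem localConn_add_field {X' : F → F} (hX : DifferentiableAt ℝ X y)
    (hX' : DifferentiableAt ℝ X' y) (u w : F) :
    localConn g (fun y => X y + X' y) y u w = localConn g X y u w + localConn g X' y u w := by
  simp only [localConn, fderiv_fun_add hX hX', add_apply, map_add]
  ring

set_option synthInstance.maxHeartbeats 200000 in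
theorem localConn_smul_field
    {f : F → ℝ} (hf : DifferentiableAt ℝ f y)
    (hX : DifferentiableAt ℝ X y) (u w : F) :
    localConn g (fun y => f y • X y) y u w =
      fderiv ℝ f y u * g y (X y) w + f y * localConn g X y u w := by
  simp only [localConn, fderiv_fun_smul hf hX, add_apply, map_add, map_smul, smul_apply,
    smul_eq_mul, ContinuousLinearMap.smulRight_apply]
  ring

set_option synthInstance.maxHeartbeats 200000 in
theorem localConn_add_left (u u' w : F) :
    localConn g X y (u + u') w = localConn g X y u w + localConn g X y u' w := by
  simp only [localConn, add_apply, map_add]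
  ring

set_option synthInstance.maxHeartbeats 200000 in
theorem localConn_smul_left (r : ℝ) (u w : F) :
    localConn g X y (r • u) w = r * localConn g X y u w := by
  simp only [localConn, smul_apply, map_smul, smul_eq_mul]
  ring

set_option synthInstance.maxHeartbeats 200000 in
theorem localConn_add_right (u w w' : F) :
    localConn g X y u (w + w') = localConn g X y u w + localConn g X y u w' := by
  simp only [localConn, add_apply, map_add]
  ring

set_option synthInstance.maxHeartbeats 200000 in
theorem localConn_smul_right (r : ℝ) (u w : F) :
    localConn g X y u (r • w) = r * localConn g X y u w := by
  simp only [localConn, smul_apply, map_smul, smul_eq_mul]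
  ring

theorem localConn_sum_right {σ : Type*} (s : Finset σ) (u : F) (w : σ → F) :
    localConn g X y u (∑ i ∈ s, w i) = ∑ i ∈ s, localConn g X y u (w i) :=
  map_sum (AddMonoidHom.mk' (localConn g X y u) (localConn_add_right u)) w s

/-- Compatibility with the metric: by symmetry of `g`, the Christoffel terms of the two summands add
up to the derivative of `g`, the remaining terms cancelling. -/
theorem fderiv_eq_localConn (hs : ∀ y u w, g y u w = g y w u) (hg : DifferentiableAt ℝ g y)
    (hX : DifferentiableAt ℝ X y) (hZ : DifferentiableAt ℝ Z y) (u : F) :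
    fderiv ℝ (fun y => g y (X y) (Z y)) y u =
      localConn g X y u (Z y) + localConn g Z y u (X y) := by
  simp only [fderiv_bilin hg hX hZ, localConn]
  rw [hs y (X y) (fderiv ℝ Z y u), fderiv_bilin_symm hs hg u (Z y) (X y),
    fderiv_bilin_symm hs hg (X y) (Z y) u, fderiv_bilin_symm hs hg (Z y) (X y) u]
  ring

/-- The Lie derivative of the metric in coordinates. -/
theorem localConn_add_swap (hs : ∀ y u w, g y u w = g y w u) (hg : DifferentiableAt ℝ g y)
    (u w : F) : localConn g X y u w + localConn g X y w u =
      fderiv ℝ g y (X y) u w + g y (fderiv ℝ X y u) w + g y u (fderiv ℝ X y w) := by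
  simp only [localConn]
  rw [hs y u (fderiv ℝ X y w), fderiv_bilin_symm hs hg u (X y) w,
    fderiv_bilin_symm hs hg w u (X y), fderiv_bilin_symm hs hg (X y) w u]
  ring

end LocalConnection

section Connection

variable {n : ℕ} {M : Type*} [TopologicalSpace M] [ChartedSpace (EuclideanSpace ℝ (Fin n)) M]
  [IsManifold (𝓡 n) ∞ M]

/-- The vector field `X` is differentiable at `x`. -/
abbrev DiffFieldAt (X : (x : M) → TangentSpace (𝓡 n) x) (x : M) : Prop :=
  MDifferentiableAt (𝓡 n) (𝓡 n).tangent (fun x => (⟨x, X x⟩ : TangentBundle (𝓡 n) M)) x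

/-- Writing a point as the image of `y` under the inverse chart keeps the base points syntactically
equal in the coordinate formulas. -/
theorem exists_chart_point (x : M) : ∃ (c : M) (y : EuclideanSpace ℝ (Fin n)),
    y ∈ (chartAt (EuclideanSpace ℝ (Fin n)) c).target ∧
      (chartAt (EuclideanSpace ℝ (Fin n)) c).symm y = x :=
  ⟨x, chartAt (EuclideanSpace ℝ (Fin n)) x x, mem_chart_target _ x,
    (chartAt (EuclideanSpace ℝ (Fin n)) x).left_inv (mem_chart_source _ x)⟩

variable {c : M} {y : EuclideanSpace ℝ (Fin n)} {X Y Z : (x : M) → TangentSpace (𝓡 n) x}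

theorem mlieBracket_chartD (hy : y ∈ (chartAt (EuclideanSpace ℝ (Fin n)) c).target)
    (hX : DiffFieldAt X ((chartAt (EuclideanSpace ℝ (Fin n)) c).symm y))
    (hY : DiffFieldAt Y ((chartAt (EuclideanSpace ℝ (Fin n)) c).symm y)) :
    VectorField.mlieBracket (𝓡 n) X Y ((chartAt (EuclideanSpace ℝ (Fin n)) c).symm y) =
      chartD c y (VectorField.lieBracket ℝ (coordRep c X) (coordRep c Y) y) := by
  have : IsManifold (𝓡 n) (minSmoothness ℝ 2) M := by
    rw [minSmoothness_of_isRCLikeNormedField]; infer_instance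
  have h := VectorField.mpullback_mlieBracket hX hY (contMDiffAt_chart_symm hy)
    (by rw [minSmoothness_of_isRCLikeNormedField]; norm_cast)
  have h2 : coordRep c (VectorField.mlieBracket (𝓡 n) X Y) y =
      VectorField.lieBracket ℝ (coordRep c X) (coordRep c Y) y := by
    rw [coordRep, h, ← VectorField.mlieBracketWithin_univ,
      VectorField.mlieBracketWithin_eq_lieBracketWithin]
    exact congrFun (VectorField.lieBracketWithin_univ (𝕜 := ℝ) (V := coordRep c X)
      (W := coordRep c Y)) y
  rw [← h2, chartD_coordRep hy]

variable [RiemannianBundle (fun x : M => TangentSpace (𝓡 n) x)]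
  [IsContMDiffRiemannianBundle (𝓡 n) ∞ (EuclideanSpace ℝ (Fin n))
      (fun x : M => TangentSpace (𝓡 n) x)]

theorem differentiableAt_chartMetric (hy : y ∈ (chartAt (EuclideanSpace ℝ (Fin n)) c).target) :
    DifferentiableAt ℝ (chartMetric c) y :=
  (contDiffAt_chartMetric hy).differentiableAt (by simp)

theorem inner_field_comp_chart (hy : y ∈ (chartAt (EuclideanSpace ℝ (Fin n)) c).target)
    (X Y : (x : M) → TangentSpace (𝓡 n) x) :
    (fun x => (inner ℝ (X x) (Y x) : ℝ)) ∘ (chartAt (EuclideanSpace ℝ (Fin n)) c).symm =ᶠ[𝓝 y]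
      fun y => chartMetric c y (coordRep c X y) (coordRep c Y y) := by
  filter_upwards [(chartAt (EuclideanSpace ℝ (Fin n)) c).open_target.mem_nhds hy] with y' hy'
  rw [chartMetric_apply, chartD_coordRep hy', chartD_coordRep hy']
  rfl

theorem mvfderiv_inner_chartD (hy : y ∈ (chartAt (EuclideanSpace ℝ (Fin n)) c).target)
    (hX : DiffFieldAt X ((chartAt (EuclideanSpace ℝ (Fin n)) c).symm y))
    (hY : DiffFieldAt Y ((chartAt (EuclideanSpace ℝ (Fin n)) c).symm y))
    (u : EuclideanSpace ℝ (Fin n)) :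
    mvfderiv (𝓡 n) (fun x => (inner ℝ (X x) (Y x) : ℝ))
      ((chartAt (EuclideanSpace ℝ (Fin n)) c).symm y) (chartD c y u) =
      fderiv ℝ (fun y => chartMetric c y (coordRep c X y) (coordRep c Y y)) y u := by
  have : IsContMDiffRiemannianBundle (𝓡 n) 1 (EuclideanSpace ℝ (Fin n))
      (fun x : M => TangentSpace (𝓡 n) x) :=
    IsContMDiffRiemannianBundle.of_le (n := ∞) (by norm_cast)
  rw [mvfderiv_chartD hy (hX.inner_bundle hY), (inner_field_comp_chart hy X Y).fderiv_eq]

/-- Brackets and directional derivatives are natural under the inverse chart, so Koszul's expression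
may be evaluated for the coordinate metric. -/
theorem koszul_eq_localConn (hy : y ∈ (chartAt (EuclideanSpace ℝ (Fin n)) c).target)
    (hX : DiffFieldAt X ((chartAt (EuclideanSpace ℝ (Fin n)) c).symm y))
    (hY : DiffFieldAt Y ((chartAt (EuclideanSpace ℝ (Fin n)) c).symm y))
    (hZ : DiffFieldAt Z ((chartAt (EuclideanSpace ℝ (Fin n)) c).symm y)) :
    koszul Y X Z ((chartAt (EuclideanSpace ℝ (Fin n)) c).symm y) =
      localConn (chartMetric c) (coordRep c X) y (coordRep c Y y) (coordRep c Z y) := by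
  rw [← localConn_eq_koszul (chartMetric_symm c) (differentiableAt_chartMetric hy)
    (differentiableAt_coordRep hy hX) (differentiableAt_coordRep hy hY)
    (differentiableAt_coordRep hy hZ), koszul, mlieBracket_chartD hy hY hX,
    mlieBracket_chartD hy hX hZ, mlieBracket_chartD hy hZ hY]
  rw [← mvfderiv_inner_chartD hy hX hZ, ← mvfderiv_inner_chartD hy hZ hY,
    ← mvfderiv_inner_chartD hy hY hX]
  simp only [chartMetric_apply, chartD_coordRep hy]

/-- The coordinate expression depends only on `u` and `w`, so the extensions and the basis chosen in
`leviCivita` play no role. The properties of ∇ used below are read off from this formula. -/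
theorem inner_leviCivita_chartD (hy : y ∈ (chartAt (EuclideanSpace ℝ (Fin n)) c).target)
    (hX : DiffFieldAt X ((chartAt (EuclideanSpace ℝ (Fin n)) c).symm y))
    (u w : EuclideanSpace ℝ (Fin n)) :
    inner ℝ (leviCivita X ((chartAt (EuclideanSpace ℝ (Fin n)) c).symm y) (chartD c y u))
      (chartD c y w) = localConn (chartMetric c) (coordRep c X) y u w := by
  set x := (chartAt (EuclideanSpace ℝ (Fin n)) c).symm y
  set b := stdOrthonormalBasis ℝ (TangentSpace (𝓡 n) x)
  choose β hβ using fun j => (chartD_bijective hy).2 (b j)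
  have hk : ∀ j, koszul (FiberBundle.extend (EuclideanSpace ℝ (Fin n)) (chartD c y u)) X
      (FiberBundle.extend (EuclideanSpace ℝ (Fin n)) (b j)) x =
      localConn (chartMetric c) (coordRep c X) y u (β j) := by
    intro j
    rw [koszul_eq_localConn hy hX (FiberBundle.mdifferentiableAt_extend _ _ _)
      (FiberBundle.mdifferentiableAt_extend _ _ _),
      coordRep_eq hy (FiberBundle.extend_apply_self (EuclideanSpace ℝ (Fin n)) _),
      coordRep_eq hy ((FiberBundle.extend_apply_self (EuclideanSpace ℝ (Fin n)) _).trans (hβ j).symm)]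
  have hw : w = ∑ j, (inner ℝ (b j) (chartD c y w) : ℝ) • β j := by
    apply (chartD_bijective hy).1
    rw [map_sum]
    conv_lhs => rw [← b.sum_repr' (chartD c y w)]
    refine Finset.sum_congr rfl fun j _ => ?_
    rw [map_smul, hβ]
  rw [leviCivita, sum_inner]
  conv_rhs => rw [hw, localConn_sum_right]
  refine Finset.sum_congr rfl fun j _ => ?_
  rw [localConn_smul_right, real_inner_smul_left, mul_comm, ← hk]

end Connection

section ConnectionProperties

variable {n : ℕ} {M : Type*} [TopologicalSpace M] [ChartedSpace (EuclideanSpace ℝ (Fin n)) M]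
  [IsManifold (𝓡 n) ∞ M] [RiemannianBundle (fun x : M => TangentSpace (𝓡 n) x)]
  [IsContMDiffRiemannianBundle (𝓡 n) ∞ (EuclideanSpace ℝ (Fin n))
      (fun x : M => TangentSpace (𝓡 n) x)]
  {X X' Z : (x : M) → TangentSpace (𝓡 n) x} {x : M}

theorem inner_leviCivita_add_field (hX : DiffFieldAt X x) (hX' : DiffFieldAt X' x)
    (v w : TangentSpace (𝓡 n) x) :
    inner ℝ (leviCivita (fun p => X p + X' p) x v) w =
      (inner ℝ (leviCivita X x v) w + inner ℝ (leviCivita X' x v) w : ℝ) := by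
  obtain ⟨c, y, hy, rfl⟩ := exists_chart_point (n := n) x
  obtain ⟨v, rfl⟩ := (chartD_bijective hy).2 v
  obtain ⟨w, rfl⟩ := (chartD_bijective hy).2 w
  have hs : DiffFieldAt (fun p => X p + X' p) ((chartAt (EuclideanSpace ℝ (Fin n)) c).symm y) :=
    mdifferentiableAt_add_section hX hX'
  rw [inner_leviCivita_chartD hy hs, inner_leviCivita_chartD hy hX,
    inner_leviCivita_chartD hy hX', ← localConn_add_field (differentiableAt_coordRep hy hX)
    (differentiableAt_coordRep hy hX')]
  congr 1
  exact VectorField.mpullback_add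

theorem inner_leviCivita_smul_field {f : M → ℝ} (hf : MDifferentiableAt (𝓡 n) 𝓘(ℝ, ℝ) f x)
    (hX : DiffFieldAt X x) (v w : TangentSpace (𝓡 n) x) :
    inner ℝ (leviCivita (fun p => f p • X p) x v) w =
      (mvfderiv (𝓡 n) f x v * inner ℝ (X x) w + f x * inner ℝ (leviCivita X x v) w : ℝ) := by
  obtain ⟨c, y, hy, rfl⟩ := exists_chart_point (n := n) x
  obtain ⟨v, rfl⟩ := (chartD_bijective hy).2 v
  obtain ⟨w, rfl⟩ := (chartD_bijective hy).2 w
  have hf' : DifferentiableAt ℝ (f ∘ (chartAt (EuclideanSpace ℝ (Fin n)) c).symm) y :=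
    (hf.comp y ((contMDiffAt_chart_symm hy).mdifferentiableAt (by simp))).differentiableAt
  have hs : DiffFieldAt (fun p => f p • X p) ((chartAt (EuclideanSpace ℝ (Fin n)) c).symm y) :=
    hf.smul_section hX
  rw [inner_leviCivita_chartD hy hs, inner_leviCivita_chartD hy hX,
    mvfderiv_chartD hy hf, ← chartD_coordRep hy X, ← chartMetric_apply]
  have := localConn_smul_field (g := chartMetric c) hf'
    (differentiableAt_coordRep hy hX) v w
  refine Eq.trans ?_ this
  congr 1
  exact VectorField.mpullback_smul

theorem inner_leviCivita_add_left (hX : DiffFieldAt X x) (v v' w : TangentSpace (𝓡 n) x) :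
    inner ℝ (leviCivita X x (v + v')) w =
      (inner ℝ (leviCivita X x v) w + inner ℝ (leviCivita X x v') w : ℝ) := by
  obtain ⟨c, y, hy, rfl⟩ := exists_chart_point (n := n) x
  obtain ⟨v, rfl⟩ := (chartD_bijective hy).2 v
  obtain ⟨v', rfl⟩ := (chartD_bijective hy).2 v'
  obtain ⟨w, rfl⟩ := (chartD_bijective hy).2 w
  rw [← map_add, inner_leviCivita_chartD hy hX, inner_leviCivita_chartD hy hX,
    inner_leviCivita_chartD hy hX, localConn_add_left]

theorem inner_leviCivita_smul_left (hX : DiffFieldAt X x) (r : ℝ) (v w : TangentSpace (𝓡 n) x) :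
    inner ℝ (leviCivita X x (r • v)) w = (r * inner ℝ (leviCivita X x v) w : ℝ) := by
  obtain ⟨c, y, hy, rfl⟩ := exists_chart_point (n := n) x
  obtain ⟨v, rfl⟩ := (chartD_bijective hy).2 v
  obtain ⟨w, rfl⟩ := (chartD_bijective hy).2 w
  rw [← map_smul, inner_leviCivita_chartD hy hX, inner_leviCivita_chartD hy hX,
    localConn_smul_left]

theorem mvfderiv_inner (hX : DiffFieldAt X x) (hZ : DiffFieldAt Z x)
    (v : TangentSpace (𝓡 n) x) :
    mvfderiv (𝓡 n) (fun p => (inner ℝ (X p) (Z p) : ℝ)) x v =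
      inner ℝ (leviCivita X x v) (Z x) + inner ℝ (leviCivita Z x v) (X x) := by
  obtain ⟨c, y, hy, rfl⟩ := exists_chart_point (n := n) x
  obtain ⟨v, rfl⟩ := (chartD_bijective hy).2 v
  rw [mvfderiv_inner_chartD hy hX hZ, ← chartD_coordRep hy X, ← chartD_coordRep hy Z,
    inner_leviCivita_chartD hy hX, inner_leviCivita_chartD hy hZ]
  exact fderiv_eq_localConn (chartMetric_symm c) (differentiableAt_chartMetric hy)
    (differentiableAt_coordRep hy hX) (differentiableAt_coordRep hy hZ) v

/-- The symmetrized covariant derivative of `X` at `x`. -/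
def covSym (hX : DiffFieldAt X x) :
    TangentSpace (𝓡 n) x →ₗ[ℝ] TangentSpace (𝓡 n) x →ₗ[ℝ] ℝ :=
  LinearMap.mk₂ ℝ (fun v w => inner ℝ (leviCivita X x v) w + inner ℝ (leviCivita X x w) v)
    (fun v v' w => by rw [inner_leviCivita_add_left hX, inner_add_right]; ring)
    (fun r v w => by
      rw [inner_leviCivita_smul_left hX, real_inner_smul_right, smul_eq_mul]; ring)
    (fun v w w' => by rw [inner_leviCivita_add_left hX, inner_add_right]; ring)
    (fun r v w => by
      rw [inner_leviCivita_smul_left hX, real_inner_smul_right, smul_eq_mul]; ring)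

theorem covSym_apply (hX : DiffFieldAt X x) (v w : TangentSpace (𝓡 n) x) :
    covSym hX v w = inner ℝ (leviCivita X x v) w + inner ℝ (leviCivita X x w) v := rfl

/-- The density of the first variation in terms of an arbitrary basis. -/
theorem firstVarDensity_eq {ι : Type*} [Fintype ι] [DecidableEq ι]
    (u : Module.Basis ι ℝ (TangentSpace (𝓡 n) x))
    (z : (x : M) → Forms (TangentSpace (𝓡 n) x)) (hX : DiffFieldAt X x) :
    firstVarDensity z X x =
      2 * ∑ i, ∑ j, ((gramMat u)⁻¹ * (Matrix.of fun i j => covSym hX (u i) (u j)) *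
        (gramMat u)⁻¹) i j * contractionForm (z x) (u i) (u j) -
      ((gramMat u)⁻¹ * Matrix.of fun i j => covSym hX (u i) (u j)).trace * normSq (z x) := by
  rw [← sum_orthonormal_bilin_mul u (stdOrthonormalBasis ℝ (TangentSpace (𝓡 n) x)),
    ← sum_orthonormal_bilin u (stdOrthonormalBasis ℝ (TangentSpace (𝓡 n) x))]
  rw [← innerForms_sum_cliff (stdOrthonormalBasis ℝ (TangentSpace (𝓡 n) x))
    (fun j m => covSym hX (stdOrthonormalBasis ℝ (TangentSpace (𝓡 n) x) j)
      (stdOrthonormalBasis ℝ (TangentSpace (𝓡 n) x) m))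
    (fun j m => by rw [covSym_apply, covSym_apply, add_comm])]
  rw [firstVarDensity]
  refine congrArg _ (Finset.sum_congr rfl fun j _ => Finset.sum_congr rfl fun m _ => ?_)
  rw [covSym_apply, add_comm]

end ConnectionProperties

/-! ### The Riemannian volume in charts -/

section Gram

variable {V : Type*} [NormedAddCommGroup V] [InnerProductSpace ℝ V] {n : ℕ}

theorem apply_eq_sum_single (L : EuclideanSpace ℝ (Fin n) →ₗ[ℝ] V)
    (u : EuclideanSpace ℝ (Fin n)) : L u = ∑ i, u i • L (EuclideanSpace.single i (1 : ℝ)) := by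
  conv_lhs => rw [← (EuclideanSpace.basisFun (Fin n) ℝ).sum_repr u]
  simp

theorem gramMat_comp (L : EuclideanSpace ℝ (Fin n) →ₗ[ℝ] V)
    (A : EuclideanSpace ℝ (Fin n) →ₗ[ℝ] EuclideanSpace ℝ (Fin n)) :
    gramMat (fun i => L (A (EuclideanSpace.single i (1 : ℝ)))) =
      (LinearMap.toMatrix (EuclideanSpace.basisFun (Fin n) ℝ).toBasis
        (EuclideanSpace.basisFun (Fin n) ℝ).toBasis A).transpose *
        gramMat (fun i => L (EuclideanSpace.single i (1 : ℝ))) *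
      LinearMap.toMatrix (EuclideanSpace.basisFun (Fin n) ℝ).toBasis
        (EuclideanSpace.basisFun (Fin n) ℝ).toBasis A := by
  ext i j
  rw [gramMat_apply, apply_eq_sum_single L, apply_eq_sum_single L (A (EuclideanSpace.single j 1))]
  simp only [Matrix.mul_apply, gramMat_apply, sum_inner, inner_sum, real_inner_smul_left,
    real_inner_smul_right, Matrix.transpose_apply, LinearMap.toMatrix_apply, Finset.sum_mul]
  refine Finset.sum_congr rfl fun k _ => Finset.sum_congr rfl fun l _ => ?_
  simp
  ring

theorem det_gramMat_comp (L : EuclideanSpace ℝ (Fin n) →ₗ[ℝ] V)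
    (A : EuclideanSpace ℝ (Fin n) →L[ℝ] EuclideanSpace ℝ (Fin n)) :
    (gramMat (fun i => L (A (EuclideanSpace.single i (1 : ℝ))))).det =
      (gramMat (fun i => L (EuclideanSpace.single i (1 : ℝ)))).det * A.det ^ 2 := by
  have h := gramMat_comp L A.toLinearMap
  simp only [ContinuousLinearMap.coe_coe] at h
  rw [h, Matrix.det_mul, Matrix.det_mul, Matrix.det_transpose, LinearMap.det_toMatrix]
  change A.det * _ * A.det = _
  ring

end Gram

section Volume

variable {n : ℕ} {M : Type*} [TopologicalSpace M] [ChartedSpace (EuclideanSpace ℝ (Fin n)) M]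
  [IsManifold (𝓡 n) ∞ M] [RiemannianBundle (fun x : M => TangentSpace (𝓡 n) x)]
  [IsContMDiffRiemannianBundle (𝓡 n) ∞ (EuclideanSpace ℝ (Fin n))
      (fun x : M => TangentSpace (𝓡 n) x)]

theorem continuousOn_gramDet (c : M) :
    ContinuousOn (gramDet c) (chartAt (EuclideanSpace ℝ (Fin n)) c).target :=
  fun _ hy => (contDiffAt_gramDet hy).continuousAt.continuousWithinAt

/-- The measure `√det g dy` in the coordinates of the chart at `c`. -/
def coordMeasure (c : M) : Measure (EuclideanSpace ℝ (Fin n)) :=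
  (volume.restrict (chartAt (EuclideanSpace ℝ (Fin n)) c).target).withDensity
    fun y => ENNReal.ofReal (Real.sqrt (gramDet c y))

theorem aemeasurable_density (c : M) :
    AEMeasurable (fun y => ENNReal.ofReal (Real.sqrt (gramDet c y)))
      (volume.restrict (chartAt (EuclideanSpace ℝ (Fin n)) c).target) :=
  ((continuousOn_gramDet c).sqrt.aemeasurable
    (chartAt (EuclideanSpace ℝ (Fin n)) c).open_target.measurableSet).ennreal_ofReal

theorem coordMeasure_apply (c : M) {A : Set (EuclideanSpace ℝ (Fin n))} (hA : MeasurableSet A)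
    (h : A ⊆ (chartAt (EuclideanSpace ℝ (Fin n)) c).target) :
    coordMeasure c A = ∫⁻ y in A, ENNReal.ofReal (Real.sqrt (gramDet c y)) := by
  rw [coordMeasure, withDensity_apply _ hA, Measure.restrict_restrict hA,
    inter_eq_left.2 h]

theorem coordMeasure_absolutelyContinuous (c : M) : (coordMeasure (n := n) c) ≪
    volume.restrict (chartAt (EuclideanSpace ℝ (Fin n)) c).target :=
  withDensity_absolutelyContinuous _ _

theorem ae_coordMeasure_mem_target (c : M) :
    ∀ᵐ y ∂coordMeasure (n := n) c, y ∈ (chartAt (EuclideanSpace ℝ (Fin n)) c).target :=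
  (coordMeasure_absolutelyContinuous c).ae_le
    (ae_restrict_mem (chartAt (EuclideanSpace ℝ (Fin n)) c).open_target.measurableSet)

theorem aemeasurable_of_continuousOn_target (c : M) {β : Type*} [TopologicalSpace β]
    [MeasurableSpace β] [BorelSpace β] {f : EuclideanSpace ℝ (Fin n) → β}
    (hf : ContinuousOn f (chartAt (EuclideanSpace ℝ (Fin n)) c).target) :
    AEMeasurable f (coordMeasure c) :=
  (hf.aemeasurable (chartAt (EuclideanSpace ℝ (Fin n)) c).open_target.measurableSet).mono_ac
    (coordMeasure_absolutelyContinuous c)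

variable [MeasurableSpace M]

theorem chartVolume_eq (c : M) : chartVolume (n := n) c =
    (coordMeasure c).map (chartAt (EuclideanSpace ℝ (Fin n)) c).symm := rfl

variable [BorelSpace M]

theorem aemeasurable_chart_symm (c : M) :
    AEMeasurable (chartAt (EuclideanSpace ℝ (Fin n)) c).symm (coordMeasure c) :=
  aemeasurable_of_continuousOn_target c
    (chartAt (EuclideanSpace ℝ (Fin n)) c).continuousOn_symm

theorem measurableSet_target_inter_preimage (c : M) {A : Set M} (hA : MeasurableSet A) :
    MeasurableSet ((chartAt (EuclideanSpace ℝ (Fin n)) c).target ∩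
      (chartAt (EuclideanSpace ℝ (Fin n)) c).symm ⁻¹' A) := by
  have ht := (chartAt (EuclideanSpace ℝ (Fin n)) c).open_target.measurableSet
  have h := (continuousOn_iff_continuous_domRestrict.1
    (chartAt (EuclideanSpace ℝ (Fin n)) c).continuousOn_symm).measurable hA
  have := ht.subtype_image h
  convert this using 1
  ext y
  simp
  tauto

theorem chartVolume_apply (c : M) {A : Set M} (hA : MeasurableSet A) :
    chartVolume (n := n) c A = ∫⁻ y in (chartAt (EuclideanSpace ℝ (Fin n)) c).target ∩
      (chartAt (EuclideanSpace ℝ (Fin n)) c).symm ⁻¹' A,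
        ENNReal.ofReal (Real.sqrt (gramDet c y)) := by
  rw [chartVolume_eq, Measure.map_apply_of_aemeasurable (aemeasurable_chart_symm c) hA,
    ← coordMeasure_apply c (measurableSet_target_inter_preimage c hA) inter_subset_left]
  refine measure_congr ?_
  filter_upwards [ae_coordMeasure_mem_target c] with y hy
  exact propext ⟨fun h => ⟨hy, h⟩, fun h => h.2⟩

theorem chartVolume_compl_source (c : M) :
    chartVolume (n := n) c (chartAt (EuclideanSpace ℝ (Fin n)) c).sourceᶜ = 0 := by
  rw [chartVolume_apply c (chartAt (EuclideanSpace ℝ (Fin n)) c).open_source.measurableSet.compl]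
  have : (chartAt (EuclideanSpace ℝ (Fin n)) c).target ∩
      (chartAt (EuclideanSpace ℝ (Fin n)) c).symm ⁻¹'
        (chartAt (EuclideanSpace ℝ (Fin n)) c).sourceᶜ = ∅ := by
    ext y
    simp only [mem_inter_iff, mem_preimage, mem_compl_iff, mem_empty_iff_false, iff_false, not_and,
      not_not]
    exact fun hy => (chartAt (EuclideanSpace ℝ (Fin n)) c).map_target hy
  rw [this, Measure.restrict_empty, lintegral_zero_measure]

/-- Tangent spaces at equal points are different types, but all unfold to the model space; this
transports inner products between them. -/
theorem inner_congr_point {x x' : M} (h : x = x') (v w : EuclideanSpace ℝ (Fin n)) :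
    (inner ℝ (show TangentSpace (𝓡 n) x from v) (show TangentSpace (𝓡 n) x from w) : ℝ) =
      inner ℝ (show TangentSpace (𝓡 n) x' from v) (show TangentSpace (𝓡 n) x' from w) := by
  subst h
  rfl

/-- Near `y` the inverse of the first chart is the inverse of the second composed with the
transition map. The Gram matrices are therefore congruent by the Jacobian of that map. -/
theorem gramDet_transition {c c' : M} {y : EuclideanSpace ℝ (Fin n)}
    (hy : y ∈ (chartAt (EuclideanSpace ℝ (Fin n)) c).target)
    (hy' : (chartAt (EuclideanSpace ℝ (Fin n)) c).symm y ∈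
      (chartAt (EuclideanSpace ℝ (Fin n)) c').source) :
    ∃ τ : EuclideanSpace ℝ (Fin n) →L[ℝ] EuclideanSpace ℝ (Fin n),
      HasFDerivAt (chartAt (EuclideanSpace ℝ (Fin n)) c' ∘
        (chartAt (EuclideanSpace ℝ (Fin n)) c).symm) τ y ∧
      gramDet c y = gramDet c' ((chartAt (EuclideanSpace ℝ (Fin n)) c' ∘
        (chartAt (EuclideanSpace ℝ (Fin n)) c).symm) y) * τ.det ^ 2 := by
  set e := chartAt (EuclideanSpace ℝ (Fin n)) c with he
  set e' := chartAt (EuclideanSpace ℝ (Fin n)) c' with he'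
  have h1 : MDifferentiableAt (𝓡 n) (𝓡 n) e.symm y :=
    (contMDiffAt_chart_symm hy).mdifferentiableAt (by simp)
  have h2 : MDifferentiableAt (𝓡 n) (𝓡 n) e' (e.symm y) :=
    (contMDiffAt_chart hy').mdifferentiableAt (by simp)
  have h3 : MDifferentiableAt (𝓡 n) (𝓡 n) e'.symm (e' (e.symm y)) :=
    (contMDiffAt_chart_symm (e'.map_source hy')).mdifferentiableAt (by simp)
  have h21 : MDifferentiableAt (𝓡 n) (𝓡 n) (e' ∘ e.symm) y := h2.comp y h1
  refine ⟨fderiv ℝ (e' ∘ e.symm) y, h21.differentiableAt.hasFDerivAt, ?_⟩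
  have hev : e.symm =ᶠ[𝓝 y] e'.symm ∘ (e' ∘ e.symm) := by
    have : e.symm ⁻¹' e'.source ∈ 𝓝 y :=
      (e.symm.continuousAt hy).preimage_mem_nhds (e'.open_source.mem_nhds hy')
    filter_upwards [this] with p hp
    exact (e'.left_inv hp).symm
  have hD : ∀ u, chartD c y u = chartD c' (e' (e.symm y)) (fderiv ℝ (e' ∘ e.symm) y u) := by
    intro u
    have := (hev.mfderiv_eq (I := 𝓡 n) (I' := 𝓡 n))
    rw [mfderiv_comp y h3 h21] at this
    rw [← mfderiv_eq_fderiv]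
    exact DFunLike.congr_fun this u
  have hg := det_gramMat_comp (chartD c' (e' (e.symm y))).toLinearMap
    (fderiv ℝ (e' ∘ e.symm) y)
  rw [gramDet_eq, gramDet_eq, chartGram, chartGram]
  refine Eq.trans ?_ hg
  congr 1
  ext i j
  rw [gramMat_apply, gramMat_apply, hD, hD]
  exact inner_congr_point (e'.left_inv hy').symm _ _

end Volume

section RiemVol

variable {n : ℕ} {M : Type*} [TopologicalSpace M] [ChartedSpace (EuclideanSpace ℝ (Fin n)) M]
  [IsManifold (𝓡 n) ∞ M] [RiemannianBundle (fun x : M => TangentSpace (𝓡 n) x)]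
  [IsContMDiffRiemannianBundle (𝓡 n) ∞ (EuclideanSpace ℝ (Fin n))
      (fun x : M => TangentSpace (𝓡 n) x)] [MeasurableSpace M] [BorelSpace M]

/-- The factor |det τ| in the change of variables is exactly the ratio of the two densities √det g.
-/
theorem chartVolume_eq_of_subset {c c' : M} {A : Set M} (hA : MeasurableSet A)
    (h : A ⊆ (chartAt (EuclideanSpace ℝ (Fin n)) c).source)
    (h' : A ⊆ (chartAt (EuclideanSpace ℝ (Fin n)) c').source) :
    chartVolume (n := n) c A = chartVolume (n := n) c' A := by
  rw [chartVolume_apply c hA, chartVolume_apply c' hA]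
  have hm := measurableSet_target_inter_preimage (n := n) c hA
  set e := chartAt (EuclideanSpace ℝ (Fin n)) c with he
  set e' := chartAt (EuclideanSpace ℝ (Fin n)) c' with he'
  choose! τ hτ hd using fun y (hy : y ∈ e.target ∩ e.symm ⁻¹' A) =>
    gramDet_transition (c' := c') hy.1 (h' hy.2)
  have himg : e'.target ∩ e'.symm ⁻¹' A = (e' ∘ e.symm) '' (e.target ∩ e.symm ⁻¹' A) := by
    ext y
    constructor
    · rintro ⟨hy, hyA⟩
      refine ⟨e (e'.symm y), ⟨e.map_source (h hyA), ?_⟩, ?_⟩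
      · rw [mem_preimage, e.left_inv (h hyA)]
        exact hyA
      · rw [Function.comp, e.left_inv (h hyA), e'.right_inv hy]
    · rintro ⟨p, ⟨hp, hpA⟩, rfl⟩
      refine ⟨e'.map_source (h' hpA), ?_⟩
      rw [mem_preimage, Function.comp, e'.left_inv (h' hpA)]
      exact hpA
  have hinj : InjOn (e' ∘ e.symm) (e.target ∩ e.symm ⁻¹' A) := by
    intro p hp q hq hpq
    exact e.symm.injOn hp.1 hq.1 (e'.injOn (h' hp.2) (h' hq.2) hpq)
  rw [himg, lintegral_image_eq_lintegral_abs_det_fderiv_mul _ hm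
    (fun y hy => (hτ y hy).hasFDerivWithinAt) hinj]
  refine setLIntegral_congr_fun hm fun y hy => ?_
  rw [hd y hy, ← ENNReal.ofReal_mul (abs_nonneg _), Real.sqrt_mul' _ (sq_nonneg _),
    Real.sqrt_sq_eq_abs, mul_comm]

theorem chartVolume_inter_source (c : M) (A : Set M) :
    chartVolume (n := n) c (A ∩ (chartAt (EuclideanSpace ℝ (Fin n)) c).source) =
      chartVolume (n := n) c A :=
  measure_inter_conull (chartVolume_compl_source c)

theorem chartVolume_le_riemVol (c : M) : chartVolume (n := n) c ≤ riemVol n M :=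
  le_iSup (fun c : M => chartVolume (n := n) c) c

/-- The supremum is bounded by the measure of the chart at `c` plus infinity times counting measure
off its domain. Inside the domain all chart measures agree, outside it the infinite term dominates,
and on a subset of the domain this term vanishes. -/
theorem riemVol_apply_of_subset {c : M} {A : Set M} (hA : MeasurableSet A)
    (h : A ⊆ (chartAt (EuclideanSpace ℝ (Fin n)) c).source) :
    riemVol n M A = chartVolume (n := n) c A := by
  refine le_antisymm ?_ (chartVolume_le_riemVol c A)
  have hs := (chartAt (EuclideanSpace ℝ (Fin n)) c).open_source.measurableSet
  have key : riemVol n M ≤ chartVolume (n := n) c +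
      (⊤ : ENNReal) • Measure.count.restrict (chartAt (EuclideanSpace ℝ (Fin n)) c).sourceᶜ := by
    refine iSup_le fun c' => Measure.le_iff.2 fun B hB => ?_
    rw [← measure_inter_add_sdiff B hs]
    refine add_le_add ?_ ?_
    · have hm := hB.inter hs
      rw [← chartVolume_inter_source c',
        chartVolume_eq_of_subset (hm.inter (chartAt (EuclideanSpace ℝ
          (Fin n)) c').open_source.measurableSet) inter_subset_right
          (inter_subset_left.trans inter_subset_right)]
      exact measure_mono (inter_subset_left.trans inter_subset_left)
    · rcases (B \ (chartAt (EuclideanSpace ℝ (Fin n)) c).source).eq_empty_or_nonempty with h0 | h0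
      · rw [h0, measure_empty]
        exact zero_le
      · change _ ≤ ((⊤ : ENNReal) • Measure.count.restrict
          (chartAt (EuclideanSpace ℝ (Fin n)) c).sourceᶜ) B
        rw [Measure.smul_apply, Measure.restrict_apply hB, smul_eq_mul, ENNReal.top_mul]
        · exact le_top
        · rw [Ne, Measure.count_eq_zero_iff]
          exact h0.ne_empty
  refine (key A).trans ?_
  rw [Measure.add_apply, Measure.smul_apply, Measure.restrict_apply hA,
    (disjoint_compl_right_iff_subset.2 h).inter_eq, measure_empty]
  simp

theorem riemVol_restrict_source (c : M) :
    (riemVol n M).restrict (chartAt (EuclideanSpace ℝ (Fin n)) c).source =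
      chartVolume (n := n) c := by
  ext A hA
  rw [Measure.restrict_apply hA, riemVol_apply_of_subset (hA.inter
    (chartAt (EuclideanSpace ℝ (Fin n)) c).open_source.measurableSet) inter_subset_right,
    chartVolume_inter_source]

instance isLocallyFiniteMeasure_riemVol : IsLocallyFiniteMeasure (riemVol n M) := by
  refine ⟨fun c => ?_⟩
  set e := chartAt (EuclideanSpace ℝ (Fin n)) c with he
  obtain ⟨r, hr, hsub⟩ := Metric.nhds_basis_closedBall.mem_iff.1
    (e.open_target.mem_nhds (mem_chart_target (EuclideanSpace ℝ (Fin n)) c))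
  have hb : Metric.ball (e c) r ⊆ e.target := Metric.ball_subset_closedBall.trans hsub
  have ho : IsOpen (e.source ∩ e ⁻¹' Metric.ball (e c) r) :=
    e.isOpen_inter_preimage Metric.isOpen_ball
  refine ⟨e.source ∩ e ⁻¹' Metric.ball (e c) r, ho.mem_nhds
    ⟨mem_chart_source _ c, Metric.mem_ball_self hr⟩, ?_⟩
  rw [riemVol_apply_of_subset ho.measurableSet inter_subset_left,
    chartVolume_apply c ho.measurableSet]
  obtain ⟨B, hB⟩ := ((isCompact_closedBall (e c) r).image_of_continuousOn
    ((continuousOn_gramDet c).sqrt.mono hsub)).bddAbove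
  have hle : e.target ∩ e.symm ⁻¹' (e.source ∩ e ⁻¹' Metric.ball (e c) r) ⊆
      Metric.closedBall (e c) r := by
    rintro y ⟨hy, -, h2⟩
    rw [mem_preimage, e.right_inv hy] at h2
    exact Metric.ball_subset_closedBall h2
  calc _ ≤ ∫⁻ y in Metric.closedBall (e c) r, ENNReal.ofReal (Real.sqrt (gramDet c y)) :=
        lintegral_mono_set hle
    _ ≤ ∫⁻ _ in Metric.closedBall (e c) r, ENNReal.ofReal B :=
        setLIntegral_mono' Metric.isClosed_closedBall.measurableSet fun y hy =>
          ENNReal.ofReal_le_ofReal (hB ⟨y, hy, rfl⟩)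
    _ < ⊤ := by
        rw [setLIntegral_const]
        exact ENNReal.mul_lt_top ENNReal.ofReal_lt_top measure_closedBall_lt_top

instance isFiniteMeasure_riemVol [CompactSpace M] : IsFiniteMeasure (riemVol n M) :=
  CompactSpace.isFiniteMeasure

instance isOpenPosMeasure_riemVol : (riemVol n M).IsOpenPosMeasure := by
  refine ⟨fun U hU hne => ?_⟩
  obtain ⟨c, hc⟩ := hne
  set e := chartAt (EuclideanSpace ℝ (Fin n)) c with he
  have hsub : chartVolume (n := n) c U ≤ riemVol n M U := chartVolume_le_riemVol c U
  refine fun h0 => ?_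
  rw [h0, nonpos_iff_eq_zero, chartVolume_eq, Measure.map_apply_of_aemeasurable
    (aemeasurable_chart_symm c) hU.measurableSet] at hsub
  have h1 : coordMeasure c (e.target ∩ e.symm ⁻¹' U) = 0 :=
    measure_mono_null inter_subset_right hsub
  have ho : IsOpen (e.target ∩ e.symm ⁻¹' U) := e.symm.isOpen_inter_preimage hU
  rw [coordMeasure, withDensity_apply_eq_zero' (aemeasurable_density c),
    Measure.restrict_apply' e.open_target.measurableSet] at h1
  refine ho.measure_ne_zero volume ⟨e c, mem_chart_target _ c, ?_⟩ (measure_mono_null ?_ h1)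
  · rw [mem_preimage, e.left_inv (mem_chart_source _ c)]
    exact hc
  · rintro y ⟨hy, hyU⟩
    refine ⟨⟨?_, hy, hyU⟩, hy⟩
    rw [mem_ofPred_eq, Ne, ENNReal.ofReal_eq_zero, not_le]
    exact Real.sqrt_pos.2 (gramDet_pos hy)

/-- The inverse direction of the definition of `chartVolume`, needed to carry measurability from
coordinates back to the manifold. -/
theorem map_chart_chartVolume (c : M) :
    AEMeasurable (chartAt (EuclideanSpace ℝ (Fin n)) c) (chartVolume (n := n) c) ∧
      (chartVolume (n := n) c).map (chartAt (EuclideanSpace ℝ (Fin n)) c) = coordMeasure c := by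
  set e := chartAt (EuclideanSpace ℝ (Fin n)) c with he
  have h1 : AEMeasurable e (chartVolume (n := n) c) := by
    rw [← riemVol_restrict_source]
    exact e.continuousOn.aemeasurable e.open_source.measurableSet
  refine ⟨h1, ?_⟩
  rw [chartVolume_eq] at h1 ⊢
  rw [AEMeasurable.map_map_of_aemeasurable h1 (aemeasurable_chart_symm c)]
  conv_rhs => rw [← Measure.map_id (μ := coordMeasure c)]
  refine Measure.map_congr ?_
  filter_upwards [ae_coordMeasure_mem_target c] with y hy
  exact e.right_inv hy

theorem aestronglyMeasurable_source_iff (c : M) {f : M → ℝ} :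
    AEStronglyMeasurable f ((riemVol n M).restrict
      (chartAt (EuclideanSpace ℝ (Fin n)) c).source) ↔
    AEStronglyMeasurable (f ∘ (chartAt (EuclideanSpace ℝ (Fin n)) c).symm) (coordMeasure c) := by
  rw [riemVol_restrict_source]
  refine ⟨fun h => h.comp_aemeasurable (aemeasurable_chart_symm c), fun h => ?_⟩
  obtain ⟨h1, h2⟩ := map_chart_chartVolume (n := n) c
  rw [← h2] at h
  refine (h.comp_aemeasurable h1).congr ?_
  rw [← riemVol_restrict_source]
  filter_upwards [ae_restrict_mem
    (chartAt (EuclideanSpace ℝ (Fin n)) c).open_source.measurableSet] with x hx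
  simp only [Function.comp]
  rw [(chartAt (EuclideanSpace ℝ (Fin n)) c).left_inv hx]

theorem integrableOn_source_iff (c : M) {f : M → ℝ} :
    IntegrableOn f (chartAt (EuclideanSpace ℝ (Fin n)) c).source (riemVol n M) ↔
    Integrable (f ∘ (chartAt (EuclideanSpace ℝ (Fin n)) c).symm) (coordMeasure c) := by
  have hi := aestronglyMeasurable_source_iff (n := n) c (f := f)
  by_cases h : AEStronglyMeasurable f ((riemVol n M).restrict
      (chartAt (EuclideanSpace ℝ (Fin n)) c).source)
  · rw [IntegrableOn]
    rw [riemVol_restrict_source] at h ⊢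
    exact integrable_map_measure h (aemeasurable_chart_symm c)
  · exact ⟨fun h1 => absurd h1.1 h, fun h1 => absurd (hi.2 h1.1) h⟩

theorem setIntegral_source (c : M) (f : M → ℝ) :
    ∫ x in (chartAt (EuclideanSpace ℝ (Fin n)) c).source, f x ∂riemVol n M =
      ∫ y, f ((chartAt (EuclideanSpace ℝ (Fin n)) c).symm y) ∂coordMeasure c := by
  have hi := aestronglyMeasurable_source_iff (n := n) c (f := f)
  by_cases h : AEStronglyMeasurable f ((riemVol n M).restrict
      (chartAt (EuclideanSpace ℝ (Fin n)) c).source)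
  · rw [riemVol_restrict_source] at h ⊢
    exact integral_map (aemeasurable_chart_symm c) h
  -- Without measurability both integrals are zero by convention, so no hypothesis on `f` is needed.
  · rw [integral_non_aestronglyMeasurable h]
    exact (integral_non_aestronglyMeasurable (fun h1 => h (hi.2 h1))).symm

theorem integrable_coordMeasure_iff (c : M) {f : EuclideanSpace ℝ (Fin n) → ℝ} :
    Integrable f (coordMeasure c) ↔ IntegrableOn (fun y => Real.sqrt (gramDet c y) * f y)
      (chartAt (EuclideanSpace ℝ (Fin n)) c).target := by
  rw [coordMeasure, integrable_withDensity_iff_integrable_smul₀' (aemeasurable_density c)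
    (Eventually.of_forall fun _ => ENNReal.ofReal_lt_top)]
  simp only [ENNReal.toReal_ofReal (Real.sqrt_nonneg _), smul_eq_mul, IntegrableOn]

theorem integral_coordMeasure (c : M) (f : EuclideanSpace ℝ (Fin n) → ℝ) :
    ∫ y, f y ∂coordMeasure c = ∫ y in (chartAt (EuclideanSpace ℝ (Fin n)) c).target,
      Real.sqrt (gramDet c y) * f y := by
  rw [coordMeasure, integral_withDensity_eq_integral_toReal_smul₀ (aemeasurable_density c)
    (Eventually.of_forall fun _ => ENNReal.ofReal_lt_top)]
  simp only [ENNReal.toReal_ofReal (Real.sqrt_nonneg _), smul_eq_mul]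

/-- Change of variables by a diffeomorphism of the domain of a chart. -/
theorem coordMeasure_change (c : M) {ψ : EuclideanSpace ℝ (Fin n) → EuclideanSpace ℝ (Fin n)}
    {J : EuclideanSpace ℝ (Fin n) → EuclideanSpace ℝ (Fin n) →L[ℝ] EuclideanSpace ℝ (Fin n)}
    (hJ : ∀ y, HasFDerivAt ψ (J y) y) (hinj : Function.Injective ψ)
    (himg : ψ '' (chartAt (EuclideanSpace ℝ (Fin n)) c).target =
      (chartAt (EuclideanSpace ℝ (Fin n)) c).target)
    (f : EuclideanSpace ℝ (Fin n) → ℝ) :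
    (Integrable f (coordMeasure c) ↔ Integrable (fun y => f (ψ y) *
      Real.sqrt (gramDet c (ψ y) * (J y).det ^ 2 / gramDet c y)) (coordMeasure c)) ∧
    ∫ y, f y ∂coordMeasure c = ∫ y, f (ψ y) *
      Real.sqrt (gramDet c (ψ y) * (J y).det ^ 2 / gramDet c y) ∂coordMeasure c := by
  have hm := (chartAt (EuclideanSpace ℝ (Fin n)) c).open_target.measurableSet
  -- The Jacobian is divided by the density at `y`, so that the new integral is again taken against
  -- `coordMeasure c`.
  have heq : EqOn (fun y => |(J y).det| • (Real.sqrt (gramDet c (ψ y)) * f (ψ y)))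
      (fun y => Real.sqrt (gramDet c y) * (f (ψ y) *
        Real.sqrt (gramDet c (ψ y) * (J y).det ^ 2 / gramDet c y)))
      (chartAt (EuclideanSpace ℝ (Fin n)) c).target := by
    intro y hy
    have h1 := gramDet_pos hy
    simp only [smul_eq_mul]
    rw [Real.sqrt_div' _ h1.le, Real.sqrt_mul' _ (sq_nonneg _), Real.sqrt_sq_eq_abs]
    have := (Real.sqrt_pos.2 h1).ne'
    field_simp
  rw [integrable_coordMeasure_iff, integrable_coordMeasure_iff, integral_coordMeasure,
    integral_coordMeasure]
  constructor
  · conv_lhs => rw [← himg]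
    rw [integrableOn_image_iff_integrableOn_abs_det_fderiv_smul _ hm
      (fun y _ => (hJ y).hasFDerivWithinAt) hinj.injOn]
    exact integrableOn_congr_fun heq hm
  · conv_lhs => rw [← himg]
    rw [integral_image_eq_integral_abs_det_fderiv_smul _ hm
      (fun y _ => (hJ y).hasFDerivWithinAt) hinj.injOn]
    exact setIntegral_congr_fun hm heq

end RiemVol

/-- A C¹ function is Lipschitz near each point; compactness yields a common radius and constant.
Only `p` has to lie in the compact set, while `q` may leave it. -/
theorem exists_lipschitz_near_isCompact {W : Type*} [NormedAddCommGroup W] [NormedSpace ℝ W]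
    {f : W → ℝ} {κ : Set W} (hκ : IsCompact κ) (hf : ∀ p ∈ κ, ContDiffAt ℝ 1 f p) :
    ∃ δ > 0, ∃ L : ℝ, 0 ≤ L ∧ ∀ p ∈ κ, ∀ q, ‖q - p‖ < δ → |f q - f p| ≤ L * ‖q - p‖ := by
  refine hκ.induction_on (p := fun s => ∃ δ > 0, ∃ L : ℝ, 0 ≤ L ∧
    ∀ p ∈ s, ∀ q, ‖q - p‖ < δ → |f q - f p| ≤ L * ‖q - p‖) ?_ ?_ ?_ ?_
  · exact ⟨1, one_pos, 0, le_rfl, fun p hp => absurd hp (notMem_empty p)⟩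
  · rintro s t hst ⟨δ, hδ, L, hL, h⟩
    exact ⟨δ, hδ, L, hL, fun p hp => h p (hst hp)⟩
  · rintro s t ⟨δ, hδ, L, hL, h⟩ ⟨δ', hδ', L', hL', h'⟩
    refine ⟨min δ δ', lt_min hδ hδ', max L L', le_max_of_le_left hL, ?_⟩
    rintro p (hp | hp) q hq
    · exact (h p hp q (hq.trans_le (min_le_left _ _))).trans
        (mul_le_mul_of_nonneg_right (le_max_left _ _) (norm_nonneg _))
    · exact (h' p hp q (hq.trans_le (min_le_right _ _))).trans
        (mul_le_mul_of_nonneg_right (le_max_right _ _) (norm_nonneg _))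
  · intro p hp
    obtain ⟨K, t, ht, hK⟩ := (hf p hp).exists_lipschitzOnWith
    obtain ⟨r, hr, hrt⟩ := Metric.mem_nhds_iff.1 ht
    refine ⟨Metric.ball p (r / 2), mem_nhdsWithin_of_mem_nhds (Metric.ball_mem_nhds p (half_pos hr)),
      r / 2, half_pos hr, K, K.2, fun a ha q hq => ?_⟩
    have h1 : a ∈ t := hrt (Metric.ball_subset_ball (half_le_self hr.le) ha)
    have h2 : q ∈ t := by
      refine hrt (Metric.mem_ball.2 ?_)
      have := dist_triangle q a p
      rw [dist_eq_norm q a] at this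
      have h3 := Metric.mem_ball.1 ha
      linarith
    have := hK.dist_le_mul q h2 a h1
    rwa [Real.dist_eq, dist_eq_norm] at this

/-! ### Cutoff functions and globalization of local vector fields -/

section Cutoff

variable {n : ℕ} {M : Type*} [TopologicalSpace M] [T2Space M] [CompactSpace M]
  [ChartedSpace (EuclideanSpace ℝ (Fin n)) M] [IsManifold (𝓡 n) ∞ M]

theorem exists_cutoff {K U : Set M} (hK : IsClosed K) (hU : IsOpen U) (hKU : K ⊆ U) :
    ∃ ρ : M → ℝ, ContMDiff (𝓡 n) 𝓘(ℝ, ℝ) ∞ ρ ∧ (∀ x ∈ K, ∀ᶠ p in 𝓝 x, ρ p = 1) ∧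
      tsupport ρ ⊆ U ∧ ∀ x, 0 ≤ ρ x := by
  obtain ⟨V, hV, hKV, hVU⟩ := normal_exists_closure_subset hK hU hKU
  obtain ⟨f, h1, h0, h01⟩ := exists_contMDiffMap_one_nhds_of_subset_interior (n := ⊤) (𝓡 n) hK
    (t := V) (by rwa [hV.interior_eq])
  refine ⟨f, f.contMDiff, fun x hx => ?_, ?_, fun x => (h01 x).1⟩
  · exact (eventually_nhdsSet_iff_forall.1 h1) x hx
  · refine (closure_mono ?_).trans hVU
    intro x hx
    by_contra h
    exact hx (h0 x h)

/-- A vector field that is smooth on an open set agrees with a smooth field near a given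
closed subset. -/
theorem exists_smoothField_eq {K U : Set M} (hK : IsClosed K) (hU : IsOpen U) (hKU : K ⊆ U)
    {ι : Type*} (v : ι → (x : M) → TangentSpace (𝓡 n) x)
    (hv : ∀ i, ContMDiffOn (𝓡 n) (𝓡 n).tangent ∞
      (fun x => (⟨x, v i x⟩ : TangentBundle (𝓡 n) M)) U) :
    ∃ w : ι → (x : M) → TangentSpace (𝓡 n) x, (∀ i, SmoothField (w i)) ∧
      ∀ x ∈ K, ∀ᶠ p in 𝓝 x, ∀ i, w i p = v i p := by
  obtain ⟨ρ, hρ, h1, hs, -⟩ := exists_cutoff (n := n) hK hU hKU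
  refine ⟨fun i => ρ • v i, fun i => ?_, fun x hx => ?_⟩
  · exact ContMDiffOn.smul_section_of_tsupport hρ.contMDiffOn hU hs (hv i)
  · filter_upwards [h1 x hx] with p hp i
    simp [hp]

end Cutoff

/-! ### Flows of vector fields supported in a chart -/

section ChartFlow

variable {n : ℕ} {M : Type*} [TopologicalSpace M] [T2Space M]
  [ChartedSpace (EuclideanSpace ℝ (Fin n)) M] [IsManifold (𝓡 n) ∞ M]

open scoped Classical in
/-- The coordinate representative of a vector field, extended by zero. -/
def chartField (c : M) (X : (x : M) → TangentSpace (𝓡 n) x) (y : EuclideanSpace ℝ (Fin n)) :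
    EuclideanSpace ℝ (Fin n) :=
  if y ∈ (chartAt (EuclideanSpace ℝ (Fin n)) c).target then coordRep c X y else 0

open scoped Classical in
/-- A flow in the domain of a chart, extended by the identity. -/
def chartFlow (c : M) (ψ : ℝ → EuclideanSpace ℝ (Fin n) → EuclideanSpace ℝ (Fin n)) (t : ℝ)
    (x : M) : M :=
  if x ∈ (chartAt (EuclideanSpace ℝ (Fin n)) c).source then
    (chartAt (EuclideanSpace ℝ (Fin n)) c).symm (ψ t (chartAt (EuclideanSpace ℝ (Fin n)) c x))
  else x

variable {c : M} {X : (x : M) → TangentSpace (𝓡 n) x} {K : Set M}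
  {ψ : ℝ → EuclideanSpace ℝ (Fin n) → EuclideanSpace ℝ (Fin n)} {y : EuclideanSpace ℝ (Fin n)}

theorem chartField_eventuallyEq (hy : y ∈ (chartAt (EuclideanSpace ℝ (Fin n)) c).target) :
    chartField c X =ᶠ[𝓝 y] coordRep c X := by
  filter_upwards [(chartAt (EuclideanSpace ℝ (Fin n)) c).open_target.mem_nhds hy] with p hp
  exact if_pos hp

theorem chartD_chartField (hy : y ∈ (chartAt (EuclideanSpace ℝ (Fin n)) c).target) :
    chartD c y (chartField c X y) = X ((chartAt (EuclideanSpace ℝ (Fin n)) c).symm y) := by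
  rw [(chartField_eventuallyEq hy).eq_of_nhds, chartD_coordRep hy]

theorem isCompact_image_chart (hK : IsCompact K)
    (hKs : K ⊆ (chartAt (EuclideanSpace ℝ (Fin n)) c).source) :
    IsCompact (chartAt (EuclideanSpace ℝ (Fin n)) c '' K) :=
  hK.image_of_continuousOn ((chartAt (EuclideanSpace ℝ (Fin n)) c).continuousOn.mono hKs)

theorem image_chart_subset (hKs : K ⊆ (chartAt (EuclideanSpace ℝ (Fin n)) c).source) :
    chartAt (EuclideanSpace ℝ (Fin n)) c '' K ⊆
      (chartAt (EuclideanSpace ℝ (Fin n)) c).target := by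
  rintro _ ⟨x, hx, rfl⟩
  exact (chartAt (EuclideanSpace ℝ (Fin n)) c).map_source (hKs hx)

theorem chartField_eq_zero (hX0 : ∀ x ∉ K, X x = 0)
    (hy : y ∉ chartAt (EuclideanSpace ℝ (Fin n)) c '' K) : chartField c X y = 0 := by
  by_cases h : y ∈ (chartAt (EuclideanSpace ℝ (Fin n)) c).target
  · rw [(chartField_eventuallyEq h).eq_of_nhds]
    refine coordRep_eq h ?_
    rw [hX0 _ fun hm => hy ⟨_, hm, (chartAt (EuclideanSpace ℝ (Fin n)) c).right_inv h⟩, map_zero]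
  · exact if_neg h

/-- The chart target and the complement of the compact image of `K` cover the space; the field is
smooth on the first and zero on the second. -/
theorem contDiff_chartField (hX : SmoothField X) (hK : IsCompact K)
    (hKs : K ⊆ (chartAt (EuclideanSpace ℝ (Fin n)) c).source) (hX0 : ∀ x ∉ K, X x = 0) :
    ContDiff ℝ ∞ (chartField c X) := by
  rw [contDiff_iff_contDiffAt]
  intro y
  by_cases h : y ∈ (chartAt (EuclideanSpace ℝ (Fin n)) c).target
  · exact (contDiffAt_coordRep h hX.contMDiffAt).congr_of_eventuallyEq (chartField_eventuallyEq h)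
  · have hc := (isCompact_image_chart hK hKs).isClosed
    refine (contDiffAt_const (c := 0)).congr_of_eventuallyEq ?_
    filter_upwards [hc.isOpen_compl.mem_nhds fun hm => h (image_chart_subset hKs hm)] with p hp
    exact chartField_eq_zero hX0 hp

theorem hasCompactSupport_chartField (hK : IsCompact K)
    (hKs : K ⊆ (chartAt (EuclideanSpace ℝ (Fin n)) c).source) (hX0 : ∀ x ∉ K, X x = 0) :
    HasCompactSupport (chartField c X) :=
  HasCompactSupport.intro (isCompact_image_chart hK hKs) fun _ hy => chartField_eq_zero hX0 hy

theorem support_chartField_subset :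
    Function.support (chartField c X) ⊆ (chartAt (EuclideanSpace ℝ (Fin n)) c).target := by
  intro y hy
  by_contra h
  exact hy (if_neg h)

theorem chartFlow_symm (hy : y ∈ (chartAt (EuclideanSpace ℝ (Fin n)) c).target) (t : ℝ) :
    chartFlow c ψ t ((chartAt (EuclideanSpace ℝ (Fin n)) c).symm y) =
      (chartAt (EuclideanSpace ℝ (Fin n)) c).symm (ψ t y) := by
  rw [chartFlow, if_pos ((chartAt (EuclideanSpace ℝ (Fin n)) c).map_target hy),
    (chartAt (EuclideanSpace ℝ (Fin n)) c).right_inv hy]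

theorem chartFlow_eq_self (hψ : IsVectorFlow (chartField c X) ψ) {L : NNReal}
    (hL : LipschitzWith L (chartField c X)) (hX0 : ∀ x ∉ K, X x = 0)
    (hKs : K ⊆ (chartAt (EuclideanSpace ℝ (Fin n)) c).source) {x : M} (hx : x ∉ K) (t : ℝ) :
    chartFlow c ψ t x = x := by
  by_cases h : x ∈ (chartAt (EuclideanSpace ℝ (Fin n)) c).source
  · rw [chartFlow, if_pos h, hψ.eq_of_eq_zero hL, (chartAt (EuclideanSpace ℝ (Fin n)) c).left_inv h]
    refine chartField_eq_zero hX0 ?_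
    rintro ⟨p, hp, hpx⟩
    rw [(chartAt (EuclideanSpace ℝ (Fin n)) c).injOn (hKs hp) h hpx] at hp
    exact hx hp
  · exact if_neg h

/-- The chart target contains the support of the field, so it is invariant and the coordinate curves
can be carried to `M`. Points off the chart domain are rest points, since `X` vanishes there. -/
theorem isFlow_chartFlow (hψ : IsVectorFlow (chartField c X) ψ) {L : NNReal}
    (hL : LipschitzWith L (chartField c X)) (hX0 : ∀ x ∉ K, X x = 0)
    (hKs : K ⊆ (chartAt (EuclideanSpace ℝ (Fin n)) c).source) : IsFlow X (chartFlow c ψ) := by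
  set e := chartAt (EuclideanSpace ℝ (Fin n)) c with he
  constructor
  · intro x
    by_cases h : x ∈ e.source
    · rw [chartFlow, if_pos h, hψ.zero, e.left_inv h]
    · exact if_neg h
  · intro x t
    by_cases h : x ∈ e.source
    · have hfun : (fun t => chartFlow c ψ t x) = e.symm ∘ fun t => ψ t (e x) := by
        ext s
        exact if_pos h
      have hm : ψ t (e x) ∈ e.target :=
        (hψ.mem_iff hL support_chartField_subset t _).2 (e.map_source h)
      have h1 : HasMFDerivAt 𝓘(ℝ, ℝ) (𝓡 n) (fun t => ψ t (e x)) t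
          (ContinuousLinearMap.toSpanSingleton ℝ (chartField c X (ψ t (e x)))) :=
        (hψ.hasDerivAt (e x) t).hasFDerivAt.hasMFDerivAt
      have h2 : HasMFDerivAt (𝓡 n) (𝓡 n) e.symm (ψ t (e x)) (chartD c (ψ t (e x))) :=
        ((contMDiffAt_chart_symm hm).mdifferentiableAt (by simp)).hasMFDerivAt
      have h3 := h2.comp t h1
      have hpt : chartFlow c ψ t x = e.symm (ψ t (e x)) := if_pos h
      have h4 : X (chartFlow c ψ t x) = (chartD c (ψ t (e x)) (chartField c X (ψ t (e x))) : _) := by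
        rw [chartD_chartField hm, hpt]
      rw [h4, hfun]
      refine h3.congr_mfderiv ?_
      ext1
      change chartD c _ ((1 : ℝ) • chartField c X _) = (1 : ℝ) • chartD c _ (chartField c X _)
      rw [map_smul]
    · have hfun : (fun t => chartFlow c ψ t x) = fun _ => x := by
        ext s
        exact if_neg h
      have hx0 : X (chartFlow c ψ t x) = 0 := by
        have : chartFlow c ψ t x = x := if_neg h
        rw [this]
        exact hX0 x fun hm => h (hKs hm)
      rw [hx0, hfun]
      refine (hasMFDerivAt_const x t).congr_mfderiv ?_
      ext1
      change (0 : EuclideanSpace ℝ (Fin n)) = (1 : ℝ) • 0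
      rw [smul_zero]

end ChartFlow

/-! ### The energy density of a pulled back form -/

section PulledDensity

variable {n : ℕ} {M : Type*} [TopologicalSpace M] [ChartedSpace (EuclideanSpace ℝ (Fin n)) M]
  [IsManifold (𝓡 n) ∞ M] [RiemannianBundle (fun x : M => TangentSpace (𝓡 n) x)]

/-- The Gram matrix, at the point of coordinates `p.1`, of the images under `p.2` of the
coordinate vectors. -/
def pulledGram (c : M) (p : EuclideanSpace ℝ (Fin n) ×
    (EuclideanSpace ℝ (Fin n) →L[ℝ] EuclideanSpace ℝ (Fin n))) : Matrix (Fin n) (Fin n) ℝ :=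
  Matrix.of fun i j => chartMetric c p.1 (p.2 (EuclideanSpace.single i (1 : ℝ)))
    (p.2 (EuclideanSpace.single j (1 : ℝ)))

/-- The coefficients of the density `pulledDensity`, as a quadratic form in the components of the
form. -/
def densityCoeff (c : M) {k : ℕ} (I J : Fin k → Fin n) (w : EuclideanSpace ℝ (Fin n) ×
    EuclideanSpace ℝ (Fin n) × (EuclideanSpace ℝ (Fin n) →L[ℝ] EuclideanSpace ℝ (Fin n))) : ℝ :=
  (k.factorial : ℝ)⁻¹ * (∏ l, (pulledGram c w.2)⁻¹ (I l) (J l)) *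
    Real.sqrt ((pulledGram c w.2).det / gramDet c w.1)

/-- The energy density at the point of coordinates `w.1`, relative to the Riemannian volume there,
of the pullback of `z` by the inverse of a map that takes this point to the one of coordinates
`w.2.1` and has derivative `w.2.2`. -/
def pulledDensity (c : M) (z : (x : M) → Forms (TangentSpace (𝓡 n) x))
    (w : EuclideanSpace ℝ (Fin n) × EuclideanSpace ℝ (Fin n) ×
      (EuclideanSpace ℝ (Fin n) →L[ℝ] EuclideanSpace ℝ (Fin n))) : ℝ :=
  componentNormSq (pulledGram c w.2)⁻¹ (fun i => chartD c w.1 (EuclideanSpace.single i (1 : ℝ)))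
    (z ((chartAt (EuclideanSpace ℝ (Fin n)) c).symm w.1)) *
    Real.sqrt ((pulledGram c w.2).det / gramDet c w.1)

/-- The component of `z` on coordinate vectors in the chart at `c`. -/
def coordComponent (c : M) (z : (x : M) → Forms (TangentSpace (𝓡 n) x)) {k : ℕ}
    (I : Fin k → Fin n) (y : EuclideanSpace ℝ (Fin n)) : ℝ :=
  z ((chartAt (EuclideanSpace ℝ (Fin n)) c).symm y) k fun l =>
    chartD c y (EuclideanSpace.single (I l) (1 : ℝ))

variable {c : M} {z : (x : M) → Forms (TangentSpace (𝓡 n) x)} {y q : EuclideanSpace ℝ (Fin n)}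

/-- This separates the coefficients, which are C¹ near the identity derivative, from the components
of `z`, which are only measurable. -/
theorem pulledDensity_eq_sum (w : EuclideanSpace ℝ (Fin n) × EuclideanSpace ℝ (Fin n) ×
      (EuclideanSpace ℝ (Fin n) →L[ℝ] EuclideanSpace ℝ (Fin n))) :
    pulledDensity c z w = ∑ k ∈ Finset.range (n + 1), ∑ I : Fin k → Fin n, ∑ J : Fin k → Fin n,
      densityCoeff c I J w * (coordComponent c z I w.1 * coordComponent c z J w.1) := by
  rw [pulledDensity, componentNormSq, Fintype.card_fin, Finset.sum_mul]
  refine Finset.sum_congr rfl fun k _ => ?_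
  rw [componentInner, mul_assoc, Finset.sum_mul, Finset.mul_sum]
  refine Finset.sum_congr rfl fun I _ => ?_
  rw [Finset.sum_mul, Finset.mul_sum]
  refine Finset.sum_congr rfl fun J _ => ?_
  rw [densityCoeff, coordComponent, coordComponent]
  ring

theorem pulledGram_eq (A : EuclideanSpace ℝ (Fin n) →L[ℝ] EuclideanSpace ℝ (Fin n)) :
    pulledGram c (q, A) = gramMat fun i => chartD c q (A (EuclideanSpace.single i (1 : ℝ))) := by
  ext i j
  rw [gramMat_apply, pulledGram, Matrix.of_apply, chartMetric_apply]

theorem pulledGram_id : pulledGram c (q, ContinuousLinearMap.id ℝ _) = chartGram c q :=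
  pulledGram_eq _

theorem det_pulledGram (A : EuclideanSpace ℝ (Fin n) →L[ℝ] EuclideanSpace ℝ (Fin n)) :
    (pulledGram c (q, A)).det = gramDet c q * A.det ^ 2 := by
  rw [pulledGram_eq, gramDet_eq]
  exact det_gramMat_comp (chartD c q).toLinearMap A

theorem pulledDensity_id (hy : y ∈ (chartAt (EuclideanSpace ℝ (Fin n)) c).target) :
    pulledDensity c z (y, y, ContinuousLinearMap.id ℝ _) =
      normSq (z ((chartAt (EuclideanSpace ℝ (Fin n)) c).symm y)) := by
  rw [pulledDensity, pulledGram_id, ← gramDet_eq, div_self (gramDet_pos hy).ne', Real.sqrt_one,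
    mul_one, normSq_eq_componentNormSq (coordBasis c y hy), funext (coordBasis_apply hy)]
  rfl

theorem form_congr_point (z : (x : M) → Forms (TangentSpace (𝓡 n) x)) {x x' : M} (h : x = x')
    {k : ℕ} {v v' : Fin k → EuclideanSpace ℝ (Fin n)} (hv : v = v') :
    (z x k : (Fin k → TangentSpace (𝓡 n) x) → ℝ) v =
      (z x' k : (Fin k → TangentSpace (𝓡 n) x') → ℝ) v' := by
  subst h
  subst hv
  rfl

/-- The map `φ` undoes `ψ` in coordinates, so dφ takes the images under `J` of the coordinate
vectors at `y` back to those vectors. In the basis of these images the components of φ^*z are those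
of `z` at `y`, and the Gram matrix is `pulledGram`. -/
theorem normSq_pullback_chart {φ : M → M}
    {ψ : EuclideanSpace ℝ (Fin n) → EuclideanSpace ℝ (Fin n)}
    {J : EuclideanSpace ℝ (Fin n) →L[ℝ] EuclideanSpace ℝ (Fin n)}
    (hψ : ψ y ∈ (chartAt (EuclideanSpace ℝ (Fin n)) c).target) (hJ : HasFDerivAt ψ J y)
    (hdet : J.det ≠ 0) (hφ : MDifferentiableAt (𝓡 n) (𝓡 n) φ
      ((chartAt (EuclideanSpace ℝ (Fin n)) c).symm (ψ y)))
    (hφψ : φ ∘ (chartAt (EuclideanSpace ℝ (Fin n)) c).symm ∘ ψ =ᶠ[𝓝 y]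
      (chartAt (EuclideanSpace ℝ (Fin n)) c).symm) :
    normSq (pullback φ z ((chartAt (EuclideanSpace ℝ (Fin n)) c).symm (ψ y))) *
      Real.sqrt (gramDet c (ψ y) * J.det ^ 2 / gramDet c y) = pulledDensity c z (y, ψ y, J) := by
  set e := chartAt (EuclideanSpace ℝ (Fin n)) c with he
  let u : Module.Basis (Fin n) ℝ (TangentSpace (𝓡 n) (e.symm (ψ y))) :=
    ((EuclideanSpace.basisFun (Fin n) ℝ).toBasis.map
      (J.toContinuousLinearEquivOfDetNeZero hdet).toLinearEquiv).map
      (LinearEquiv.ofBijective (chartD c (ψ y)).toLinearMap (chartD_bijective hψ))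
  have hu : (u : Fin n → TangentSpace (𝓡 n) (e.symm (ψ y))) =
      fun i => chartD c (ψ y) (J (EuclideanSpace.single i (1 : ℝ))) := by
    ext1 i
    simp [u]
  have h1 : MDifferentiableAt (𝓡 n) (𝓡 n) e.symm (ψ y) :=
    (contMDiffAt_chart_symm hψ).mdifferentiableAt (by simp)
  have h2 : MDifferentiableAt (𝓡 n) (𝓡 n) ψ y := hJ.differentiableAt.mdifferentiableAt
  have h3 : MDifferentiableAt (𝓡 n) (𝓡 n) (e.symm ∘ ψ) y := h1.comp y h2
  have hd : ∀ v, mfderiv (𝓡 n) (𝓡 n) φ (e.symm (ψ y)) (chartD c (ψ y) (J v)) = chartD c y v := by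
    intro v
    have := hφψ.mfderiv_eq (I := 𝓡 n) (I' := 𝓡 n)
    rw [mfderiv_comp y hφ h3, mfderiv_comp y h1 h2, mfderiv_eq_fderiv, hJ.fderiv] at this
    exact DFunLike.congr_fun this v
  rw [pulledDensity, det_pulledGram, normSq_eq_componentNormSq u, hu, ← pulledGram_eq]
  congr 1
  have hc : ∀ (k : ℕ) (I : Fin k → Fin n),
      pullback φ z (e.symm (ψ y)) k (fun l => chartD c (ψ y) (J (EuclideanSpace.single (I l) 1))) =
        z (e.symm y) k fun l => chartD c y (EuclideanSpace.single (I l) 1) := by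
    intro k I
    exact form_congr_point z hφψ.eq_of_nhds (funext fun l => hd _)
  simp only [componentNormSq, hc]
  rfl

variable [IsContMDiffRiemannianBundle (𝓡 n) ∞ (EuclideanSpace ℝ (Fin n))
      (fun x : M => TangentSpace (𝓡 n) x)]

theorem contDiffAt_pulledGram {W : Type*} [NormedAddCommGroup W] [NormedSpace ℝ W]
    {f : W → EuclideanSpace ℝ (Fin n)}
    {A : W → EuclideanSpace ℝ (Fin n) →L[ℝ] EuclideanSpace ℝ (Fin n)} {w : W}
    {k : WithTop ℕ∞} (hk : k ≤ ∞) (hf : ContDiffAt ℝ k f w) (hA : ContDiffAt ℝ k A w)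
    (hfw : f w ∈ (chartAt (EuclideanSpace ℝ (Fin n)) c).target) (i j : Fin n) :
    ContDiffAt ℝ k (fun w => pulledGram c (f w, A w) i j) w := by
  have h1 : ContDiffAt ℝ k (fun w => chartMetric c (f w)) w :=
    ((contDiffAt_chartMetric hfw).of_le hk).comp w hf
  exact (h1.clm_apply (hA.clm_apply contDiffAt_const)).clm_apply (hA.clm_apply contDiffAt_const)

theorem contDiffAt_densityCoeff {k : ℕ} (I J : Fin k → Fin n)
    {A : EuclideanSpace ℝ (Fin n) →L[ℝ] EuclideanSpace ℝ (Fin n)}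
    (hy : y ∈ (chartAt (EuclideanSpace ℝ (Fin n)) c).target)
    (hq : q ∈ (chartAt (EuclideanSpace ℝ (Fin n)) c).target) (hA : A.det ≠ 0) :
    ContDiffAt ℝ 1 (densityCoeff c I J) (y, q, A) := by
  have hG : ∀ i j, ContDiffAt ℝ 1 (fun w : EuclideanSpace ℝ (Fin n) × EuclideanSpace ℝ (Fin n) ×
      (EuclideanSpace ℝ (Fin n) →L[ℝ] EuclideanSpace ℝ (Fin n)) => pulledGram c w.2 i j)
      (y, q, A) := fun i j =>
    contDiffAt_pulledGram (by norm_cast) contDiffAt_snd.fst contDiffAt_snd.snd hq i j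
  have hd := contDiffAt_det hG
  have hpos : 0 < (pulledGram c (q, A)).det := by
    rw [det_pulledGram]
    exact mul_pos (gramDet_pos hq) (by positivity)
  have hg : ContDiffAt ℝ 1 (fun w : EuclideanSpace ℝ (Fin n) × EuclideanSpace ℝ (Fin n) ×
      (EuclideanSpace ℝ (Fin n) →L[ℝ] EuclideanSpace ℝ (Fin n)) => gramDet c w.1) (y, q, A) :=
    ContDiffAt.comp (g := gramDet c) (y, q, A) ((contDiffAt_gramDet hy).of_le (by norm_cast))
      contDiffAt_fst
  refine (contDiffAt_const.mul (contDiffAt_prod fun l _ =>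
    contDiffAt_matrix_inv hG hpos.ne' _ _)).mul ((hd.div hg (gramDet_pos hy).ne').sqrt ?_)
  exact (div_pos hpos (gramDet_pos hy)).ne'

end PulledDensity

/-! ### Locality and additivity of the first variation density -/

section Locality

variable {n : ℕ} {M : Type*} [TopologicalSpace M] [ChartedSpace (EuclideanSpace ℝ (Fin n)) M]
  [IsManifold (𝓡 n) ∞ M] [RiemannianBundle (fun x : M => TangentSpace (𝓡 n) x)]
  [IsContMDiffRiemannianBundle (𝓡 n) ∞ (EuclideanSpace ℝ (Fin n))
      (fun x : M => TangentSpace (𝓡 n) x)]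
  {X X' : (x : M) → TangentSpace (𝓡 n) x} {x : M}

theorem SmoothField.diffFieldAt (hX : SmoothField X) (x : M) : DiffFieldAt X x :=
  hX.contMDiffAt.mdifferentiableAt (by simp)

theorem DiffFieldAt.congr (hX : DiffFieldAt X x) (h : ∀ᶠ p in 𝓝 x, X' p = X p) :
    DiffFieldAt X' x := by
  refine MDifferentiableAt.congr_of_eventuallyEq hX ?_
  filter_upwards [h] with p hp
  rw [hp]

/-- In coordinates only the value and the first derivative of the field at the point enter. -/
theorem leviCivita_congr (hX : DiffFieldAt X x) (h : ∀ᶠ p in 𝓝 x, X' p = X p)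
    (v : TangentSpace (𝓡 n) x) : leviCivita X' x v = leviCivita X x v := by
  have hX' := hX.congr h
  refine ext_inner_right ℝ fun w => ?_
  obtain ⟨c, y, hy, rfl⟩ := exists_chart_point (n := n) x
  obtain ⟨v, rfl⟩ := (chartD_bijective hy).2 v
  obtain ⟨w, rfl⟩ := (chartD_bijective hy).2 w
  rw [inner_leviCivita_chartD hy hX, inner_leviCivita_chartD hy hX']
  have hev : coordRep c X' =ᶠ[𝓝 y] coordRep c X := by
    have h1 := ((chartAt (EuclideanSpace ℝ (Fin n)) c).symm.continuousAt hy).eventually h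
    filter_upwards [h1, (chartAt (EuclideanSpace ℝ (Fin n)) c).open_target.mem_nhds hy] with p hp hpt
    exact coordRep_eq hpt (by rw [hp, chartD_coordRep hpt])
  rw [localConn, localConn, hev.fderiv_eq, hev.eq_of_nhds]

theorem leviCivita_eq_zero (h : ∀ᶠ p in 𝓝 x, X p = 0) (v : TangentSpace (𝓡 n) x) :
    leviCivita X x v = 0 := by
  have h0 : DiffFieldAt (n := n) (fun p : M => (0 : TangentSpace (𝓡 n) p)) x :=
    ((contMDiff_zeroSection ℝ (fun p : M => TangentSpace (𝓡 n) p)).contMDiffAt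
      (n := ∞)).mdifferentiableAt (by simp)
  refine ext_inner_right ℝ fun w => ?_
  rw [leviCivita_congr h0 h, inner_zero_left]
  have := inner_leviCivita_smul_field (mdifferentiableAt_const (c := (0 : ℝ))) h0 v w
  simpa using this

variable {z : (x : M) → Forms (TangentSpace (𝓡 n) x)}

theorem firstVarDensity_eq_zero (h : ∀ᶠ p in 𝓝 x, X p = 0) : firstVarDensity z X x = 0 := by
  simp only [firstVarDensity, leviCivita_eq_zero h, inner_zero_left, add_zero, zero_smul,
    Finset.sum_const_zero]
  have := innerForms_smul_right 0 (z x) (z x)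
  rwa [zero_smul, zero_mul] at this

theorem firstVarDensity_add (hX : DiffFieldAt X x) (hX' : DiffFieldAt X' x) :
    firstVarDensity z (fun p => X p + X' p) x =
      firstVarDensity z X x + firstVarDensity z X' x := by
  simp only [firstVarDensity, inner_leviCivita_add_field hX hX']
  rw [← innerForms_add_right, ← Finset.sum_add_distrib]
  refine congrArg _ (Finset.sum_congr rfl fun j _ => ?_)
  rw [← Finset.sum_add_distrib]
  refine Finset.sum_congr rfl fun m _ => ?_
  rw [← add_smul]
  congr 1
  ring

end Locality

/-! ### Differentiation under the integral sign at a single time -/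

section DerivUnderIntegral

variable {α : Type*} [MeasurableSpace α] {μ : Measure α}

/-- Differences are compared only with time zero, as this is the estimate the flow provides. The
derivative is measurable as a limit of difference quotients along a sequence. -/
theorem hasDerivAt_integral_of_lip_at {F : ℝ → α → ℝ} {F' bound : α → ℝ} {ε : ℝ} (hε : 0 < ε)
    (hmeas : ∀ t, |t| < ε → AEStronglyMeasurable (F t) μ) (hint : Integrable (F 0) μ)
    (hlip : ∀ᵐ a ∂μ, ∀ t, |t| < ε → |F t a - F 0 a| ≤ bound a * |t|) (hb : Integrable bound μ)
    (hd : ∀ᵐ a ∂μ, HasDerivAt (fun t => F t a) (F' a) 0) :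
    Integrable F' μ ∧ HasDerivAt (fun t => ∫ a, F t a ∂μ) (∫ a, F' a ∂μ) 0 := by
  -- The shift by 2 keeps the times strictly below ε also for k = 0.
  have hs : ∀ k : ℕ, |ε / (k + 2)| < ε := by
    intro k
    rw [abs_of_pos (by positivity), div_lt_iff₀ (by positivity)]
    have : (0 : ℝ) ≤ k := Nat.cast_nonneg k
    nlinarith
  have hlim : Tendsto (fun k : ℕ => ε / ((k : ℝ) + 2)) atTop (𝓝[≠] 0) := by
    refine tendsto_nhdsWithin_iff.2 ⟨?_, Eventually.of_forall fun k => ?_⟩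
    · exact tendsto_const_nhds.div_atTop
        (tendsto_atTop_add_const_right _ _ tendsto_natCast_atTop_atTop)
    · have : 0 < ε / ((k : ℝ) + 2) := by positivity
      exact this.ne'
  have hF' : AEStronglyMeasurable F' μ := by
    refine aestronglyMeasurable_of_tendsto_ae atTop
      (f := fun (k : ℕ) a => (ε / ((k : ℝ) + 2))⁻¹ * (F (ε / (k + 2)) a - F 0 a)) (fun k => ?_) ?_
    · exact ((hmeas _ (hs k)).sub hint.1).const_mul _
    · filter_upwards [hd] with a ha
      have := (hasDerivAt_iff_tendsto_slope.1 ha).comp hlim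
      refine this.congr fun k => ?_
      simp [slope_def_field, div_eq_inv_mul]
  have h := hasFDerivAt_integral_of_dominated_loc_of_lip' (𝕜 := ℝ) (F := F) (x₀ := 0)
    (bound := bound) (s := Metric.ball 0 ε)
    (F' := fun a => ContinuousLinearMap.toSpanSingleton ℝ (F' a)) (Metric.ball_mem_nhds 0 hε)
    (fun t ht => hmeas t (by simpa using ht)) hint
    ((ContinuousLinearMap.toSpanSingletonCLE (𝕜 := ℝ) (E := ℝ)).continuous.comp_aestronglyMeasurable
      hF') ?_ hb ?_
  · obtain ⟨h1, h2⟩ := h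
    have h3 : Integrable F' μ := by
      have := h1.apply_continuousLinearMap 1
      simpa using this
    refine ⟨h3, ?_⟩
    refine h2.hasDerivAt.congr_deriv ?_
    refine (ContinuousLinearMap.integral_apply h1 1).trans ?_
    simp
  · filter_upwards [hlip] with a ha t ht
    rw [sub_zero, Real.norm_eq_abs, Real.norm_eq_abs]
    exact ha t (by simpa using ht)
  · filter_upwards [hd] with a ha
    exact ha.hasFDerivAt

end DerivUnderIntegral

/-! ### Uniform bounds and measurability of the pulled back density -/

section DensityBounds

variable {n : ℕ} {M : Type*} [TopologicalSpace M]
  [ChartedSpace (EuclideanSpace ℝ (Fin n)) M] [IsManifold (𝓡 n) ∞ M]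
  [RiemannianBundle (fun x : M => TangentSpace (𝓡 n) x)]
  [IsContMDiffRiemannianBundle (𝓡 n) ∞ (EuclideanSpace ℝ (Fin n))
      (fun x : M => TangentSpace (𝓡 n) x)]
  {c : M} {z : (x : M) → Forms (TangentSpace (𝓡 n) x)} {K : Set M}

theorem exists_coordBasis_norm_le {κ : Set (EuclideanSpace ℝ (Fin n))} (hκ : IsCompact κ)
    (hκt : κ ⊆ (chartAt (EuclideanSpace ℝ (Fin n)) c).target) :
    ∃ B : ℝ, 1 ≤ B ∧ ∀ y ∈ κ, ∀ i, ‖chartD c y (EuclideanSpace.single i (1 : ℝ))‖ ≤ B := by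
  have h : ∀ i : Fin n, ∃ B : ℝ, ∀ y ∈ κ, chartGram c y i i ≤ B := by
    intro i
    obtain ⟨B, hB⟩ := (hκ.image_of_continuousOn (f := fun y => chartGram c y i i) fun y hy =>
      (contDiffAt_chartGram (hκt hy) i i).continuousAt.continuousWithinAt).bddAbove
    exact ⟨B, fun y hy => hB ⟨y, hy, rfl⟩⟩
  choose B hB using h
  have hS : 0 ≤ ∑ i, |B i| := Finset.sum_nonneg fun i _ => abs_nonneg _
  -- Since s ≤ 1 + s², the bound on squared norms gives one on norms, common to all i.
  refine ⟨1 + ∑ i, |B i|, by linarith, fun y hy i => ?_⟩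
  have h1 := hB i y hy
  rw [chartGram, gramMat_apply, real_inner_self_eq_norm_sq] at h1
  have h2 : |B i| ≤ ∑ i, |B i| :=
    Finset.single_le_sum (f := fun i => |B i|) (fun i _ => abs_nonneg _) (Finset.mem_univ i)
  have h3 := le_abs_self (B i)
  nlinarith [norm_nonneg (chartD c y (EuclideanSpace.single i (1 : ℝ)))]

/-- The coefficients of the density are C¹ near the compact set of points (y, y, id), hence
uniformly Lipschitz there. The products of components that they multiply are bounded by multiples of
|z|², with no regularity of `z`. -/
theorem exists_pulledDensity_lipschitz {κ : Set (EuclideanSpace ℝ (Fin n))} (hκ : IsCompact κ)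
    (hκt : κ ⊆ (chartAt (EuclideanSpace ℝ (Fin n)) c).target)
    (z : (x : M) → Forms (TangentSpace (𝓡 n) x)) :
    ∃ δ > 0, ∃ L : ℝ, 0 ≤ L ∧ ∀ y ∈ κ, ∀ p : EuclideanSpace ℝ (Fin n) ×
        (EuclideanSpace ℝ (Fin n) →L[ℝ] EuclideanSpace ℝ (Fin n)),
      ‖p - (y, ContinuousLinearMap.id ℝ _)‖ < δ →
      |pulledDensity c z (y, p) - normSq (z ((chartAt (EuclideanSpace ℝ (Fin n)) c).symm y))| ≤
        L * ‖p - (y, ContinuousLinearMap.id ℝ _)‖ *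
          normSq (z ((chartAt (EuclideanSpace ℝ (Fin n)) c).symm y)) := by
  obtain ⟨B, hB1, hB⟩ := exists_coordBasis_norm_le hκ hκt
  set base : EuclideanSpace ℝ (Fin n) → EuclideanSpace ℝ (Fin n) × EuclideanSpace ℝ (Fin n) ×
      (EuclideanSpace ℝ (Fin n) →L[ℝ] EuclideanSpace ℝ (Fin n)) :=
    fun y => (y, y, ContinuousLinearMap.id ℝ _) with hbase
  have hc : IsCompact (base '' κ) := hκ.image (by fun_prop)
  have hid : (ContinuousLinearMap.id ℝ (EuclideanSpace ℝ (Fin n))).det ≠ 0 := by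
    rw [ContinuousLinearMap.det, ContinuousLinearMap.coe_id, LinearMap.det_id]
    exact one_ne_zero
  have h := fun i : Σ k : Fin (n + 1), (Fin k → Fin n) × (Fin k → Fin n) =>
    exists_lipschitz_near_isCompact (f := densityCoeff c i.2.1 i.2.2) hc (by
      rintro _ ⟨y, hy, rfl⟩
      exact contDiffAt_densityCoeff _ _ (hκt hy) (hκt hy) hid)
  choose δ hδ L hL hlip using h
  -- A positive radius below the radii of all finitely many coefficients.
  obtain ⟨δ₀, hlt, hδ₀⟩ := ((eventually_all.2 fun i => Ioo_mem_nhdsGT (hδ i)).and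
    (self_mem_nhdsWithin (a := (0 : ℝ)) (s := Ioi 0))).exists
  refine ⟨δ₀, hδ₀, ∑ k : Fin (n + 1), ∑ I : Fin k → Fin n, ∑ J : Fin k → Fin n,
    L ⟨k, I, J⟩ * ((k : ℕ).factorial * B ^ (2 * (k : ℕ))), ?_, ?_⟩
  · exact Finset.sum_nonneg fun k _ => Finset.sum_nonneg fun I _ => Finset.sum_nonneg fun J _ =>
      mul_nonneg (hL _) (by positivity)
  · intro y hy p hp
    have he : ∀ r : ℝ, r - normSq (z ((chartAt (EuclideanSpace ℝ (Fin n)) c).symm y)) =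
        r - pulledDensity c z (y, y, ContinuousLinearMap.id ℝ _) := by
      rw [pulledDensity_id (hκt hy)]
      exact fun _ => rfl
    rw [he, pulledDensity_eq_sum, pulledDensity_eq_sum,
      ← Finset.sum_sub_distrib, Finset.sum_range, Finset.sum_mul, Finset.sum_mul]
    refine (Finset.abs_sum_le_sum_abs _ _).trans (Finset.sum_le_sum fun k _ => ?_)
    rw [← Finset.sum_sub_distrib, Finset.sum_mul, Finset.sum_mul]
    refine (Finset.abs_sum_le_sum_abs _ _).trans (Finset.sum_le_sum fun I _ => ?_)
    rw [← Finset.sum_sub_distrib, Finset.sum_mul, Finset.sum_mul]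
    refine (Finset.abs_sum_le_sum_abs _ _).trans (Finset.sum_le_sum fun J _ => ?_)
    rw [← sub_mul, abs_mul]
    have hnorm : ‖((y, p) : EuclideanSpace ℝ (Fin n) × EuclideanSpace ℝ (Fin n) ×
      (EuclideanSpace ℝ (Fin n) →L[ℝ] EuclideanSpace ℝ (Fin n))) - base y‖ =
        ‖p - (y, ContinuousLinearMap.id ℝ _)‖ := by
      simp [hbase, Prod.norm_def]
    have h1 := hlip ⟨k, I, J⟩ (base y) ⟨y, hy, rfl⟩ (y, p)
      (by rw [hnorm]; exact hp.trans (hlt ⟨k, I, J⟩).2)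
    rw [hnorm] at h1
    have hk : (k : ℕ) ∈ Finset.range (Module.finrank ℝ (TangentSpace (𝓡 n)
        ((chartAt (EuclideanSpace ℝ (Fin n)) c).symm y)) + 1) := by
      have : Module.finrank ℝ (TangentSpace (𝓡 n)
        ((chartAt (EuclideanSpace ℝ (Fin n)) c).symm y)) = n := finrank_euclideanSpace_fin
      rw [this]
      exact Finset.mem_range.2 k.2
    have h2 := abs_apply_mul_apply_le hk
      (z ((chartAt (EuclideanSpace ℝ (Fin n)) c).symm y))
      (fun l => chartD c y (EuclideanSpace.single (I l) (1 : ℝ)))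
      (fun l => chartD c y (EuclideanSpace.single (J l) (1 : ℝ)))
      (fun l => hB y hy _) (fun l => hB y hy _)
    refine (mul_le_mul h1 h2 (abs_nonneg _) (mul_nonneg (hL _) (norm_nonneg _))).trans ?_
    apply le_of_eq
    ring

/-- The coefficient is continuous on the open set where both points lie in the target and the
derivative is invertible; extended by zero from there it is Borel. -/
theorem aestronglyMeasurable_densityCoeff [MeasurableSpace M] [BorelSpace M] {k : ℕ}
    (I J : Fin k → Fin n)
    {g : EuclideanSpace ℝ (Fin n) → EuclideanSpace ℝ (Fin n) × EuclideanSpace ℝ (Fin n) ×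
      (EuclideanSpace ℝ (Fin n) →L[ℝ] EuclideanSpace ℝ (Fin n))} (hg : Measurable g)
    (h : ∀ y ∈ (chartAt (EuclideanSpace ℝ (Fin n)) c).target,
      (g y).1 ∈ (chartAt (EuclideanSpace ℝ (Fin n)) c).target ∧
      (g y).2.1 ∈ (chartAt (EuclideanSpace ℝ (Fin n)) c).target ∧ (g y).2.2.det ≠ 0) :
    AEStronglyMeasurable (fun y => densityCoeff c I J (g y)) (coordMeasure c) := by
  classical
  set e := chartAt (EuclideanSpace ℝ (Fin n)) c with he
  set s : Set (EuclideanSpace ℝ (Fin n) × EuclideanSpace ℝ (Fin n) ×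
      (EuclideanSpace ℝ (Fin n) →L[ℝ] EuclideanSpace ℝ (Fin n))) :=
    {w | w.1 ∈ e.target ∧ w.2.1 ∈ e.target ∧ w.2.2.det ≠ 0} with hs
  have hso : IsOpen s := by
    refine (e.open_target.preimage continuous_fst).inter
      ((e.open_target.preimage (continuous_fst.comp continuous_snd)).inter ?_)
    exact isOpen_ne_fun (ContinuousLinearMap.continuous_det.comp
      (continuous_snd.comp continuous_snd)) continuous_const
  have hc : ContinuousOn (densityCoeff c I J) s := fun w hw =>
    (contDiffAt_densityCoeff I J hw.1 hw.2.1 hw.2.2).continuousAt.continuousWithinAt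
  have hm := (hc.measurable_piecewise (g := fun _ => (0 : ℝ)) continuousOn_const
    hso.measurableSet).comp hg
  refine hm.aestronglyMeasurable.congr ?_
  filter_upwards [ae_coordMeasure_mem_target c] with y hy
  exact piecewise_eq_of_mem _ _ _ (h y hy)

/-- `IsL2Form` tests only globally smooth fields. On the compact set `K` the coordinate fields agree
with such fields. -/
theorem aestronglyMeasurable_coordComponent [T2Space M] [CompactSpace M] [MeasurableSpace M]
    [BorelSpace M] (hz : IsL2Form z) (hK : IsCompact K)
    (hKs : K ⊆ (chartAt (EuclideanSpace ℝ (Fin n)) c).source) {k : ℕ} (I : Fin k → Fin n) :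
    AEStronglyMeasurable (coordComponent c z I)
      ((coordMeasure c).restrict (chartAt (EuclideanSpace ℝ (Fin n)) c '' K)) := by
  set e := chartAt (EuclideanSpace ℝ (Fin n)) c with he
  obtain ⟨w, hw, hwK⟩ := exists_smoothField_eq hK.isClosed e.open_source hKs
    (fun i : Fin n => coordField c (EuclideanSpace.single i (1 : ℝ)))
    (fun i => contMDiffOn_coordField c _)
  have h1 := ((aestronglyMeasurable_source_iff c).1
    ((hz.1 k (fun l => w (I l)) fun l => hw _).restrict)).restrict (s := e '' K)
  refine h1.congr ?_
  filter_upwards [ae_restrict_mem (isCompact_image_chart hK hKs).isClosed.measurableSet] with y hy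
  have hyt := image_chart_subset hKs hy
  obtain ⟨x, hx, rfl⟩ := hy
  have hx' : e.symm (e x) ∈ K := by rwa [e.left_inv (hKs hx)]
  have := (hwK _ hx').self_of_nhds
  simp only [Function.comp, coordComponent]
  refine congrArg _ (funext fun l => ?_)
  rw [this, coordField_eq hyt]

end DensityBounds

/-! ### The energy along a flow supported in a chart -/

section FlowEnergy

variable {n : ℕ} {M : Type*} [TopologicalSpace M] [T2Space M]
  [ChartedSpace (EuclideanSpace ℝ (Fin n)) M] [IsManifold (𝓡 n) ∞ M]
  {c : M} {X : (x : M) → TangentSpace (𝓡 n) x} {K : Set M}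
  {ψ : ℝ → EuclideanSpace ℝ (Fin n) → EuclideanSpace ℝ (Fin n)} {L : NNReal}
  {J J' : EuclideanSpace ℝ (Fin n) → EuclideanSpace ℝ (Fin n) →L[ℝ] EuclideanSpace ℝ (Fin n)}
  {t : ℝ}

theorem IsVectorFlow.det_ne_zero {E : Type*} [NormedAddCommGroup E] [NormedSpace ℝ E]
    [FiniteDimensional ℝ E] {Y : E → E} {ψ : ℝ → E → E} {J J' : E → E →L[ℝ] E}
    (hψ : IsVectorFlow Y ψ) (hL : LipschitzWith L Y)
    (hJ' : ∀ y, HasFDerivAt (ψ t) (J' y) y) (hJ : ∀ y, HasFDerivAt (ψ (-t)) (J y) y) (y : E) :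
    (J y).det ≠ 0 := by
  have h1 := (hJ' (ψ (-t) y)).comp y (hJ y)
  have h2 : ψ t ∘ ψ (-t) = id := funext fun p => hψ.apply_neg hL t p
  rw [h2] at h1
  have h3 := h1.unique (hasFDerivAt_id y)
  have h4 : (J' (ψ (-t) y)).det * (J y).det = 1 := by
    have h5 := congrArg (fun A : E →L[ℝ] E => LinearMap.det (A : E →ₗ[ℝ] E)) h3
    simpa [LinearMap.det_comp] using h5
  exact right_ne_zero_of_mul_eq_one h4

theorem hasDerivAt_comp_fderiv {E G : Type*} [NormedAddCommGroup E] [NormedSpace ℝ E]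
    [NormedAddCommGroup G] [NormedSpace ℝ G] {g : E → G} {p : ℝ → E} {p' : E} {t : ℝ}
    (hg : DifferentiableAt ℝ g (p t)) (hp : HasDerivAt p p' t) :
    HasDerivAt (fun t => g (p t)) (fderiv ℝ g (p t) p') t :=
  hg.hasFDerivAt.comp_hasDerivAt t hp

set_option synthInstance.maxHeartbeats 200000 in
theorem hasDerivAt_bilin_neg {E : Type*} [NormedAddCommGroup E] [NormedSpace ℝ E]
    {g : E → E →L[ℝ] E →L[ℝ] ℝ} {p v w : ℝ → E} {p' v' w' : E} {t : ℝ}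
    (hg : DifferentiableAt ℝ g (p t)) (hp : HasDerivAt p (-p') t) (hv : HasDerivAt v (-v') t)
    (hw : HasDerivAt w (-w') t) : HasDerivAt (fun t => g (p t) (v t) (w t))
      (-(fderiv ℝ g (p t) p' (v t) (w t) + g (p t) v' (w t) + g (p t) (v t) w')) t := by
  have h1 : HasDerivAt (fun t => g (p t)) (fderiv ℝ g (p t) (-p')) t :=
    hasDerivAt_comp_fderiv (G := E →L[ℝ] E →L[ℝ] ℝ) (g := g) hg hp
  have h2 : HasDerivAt (fun t => g (p t) (v t))
      (fderiv ℝ g (p t) (-p') (v t) + g (p t) (-v')) t := h1.clm_apply hv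
  have h3 : HasDerivAt (fun t => g (p t) (v t) (w t))
      ((fderiv ℝ g (p t) (-p') (v t) + g (p t) (-v')) (w t) + g (p t) (v t) (-w')) t :=
    h2.clm_apply hw
  refine h3.congr_deriv ?_
  simp only [map_neg, add_apply, neg_apply]
  ring

/-- Off the compact image of `K` the field vanishes, and this set is open, so the flow map is the
identity near `y`. -/
theorem fderiv_flow_eq_id (hψ : IsVectorFlow (chartField c X) ψ)
    (hL : LipschitzWith L (chartField c X)) (hK : IsCompact K)
    (hKs : K ⊆ (chartAt (EuclideanSpace ℝ (Fin n)) c).source) (hX0 : ∀ x ∉ K, X x = 0)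
    (hJ : ∀ y, HasFDerivAt (ψ t) (J y) y) {y : EuclideanSpace ℝ (Fin n)}
    (hy : y ∉ chartAt (EuclideanSpace ℝ (Fin n)) c '' K) :
    ψ t y = y ∧ J y = ContinuousLinearMap.id ℝ _ := by
  have h : ∀ p ∉ chartAt (EuclideanSpace ℝ (Fin n)) c '' K, ψ t p = p := fun p hp =>
    hψ.eq_of_eq_zero hL (chartField_eq_zero hX0 hp) t
  refine ⟨h y hy, ?_⟩
  refine (hJ y).unique ((hasFDerivAt_id y).congr_of_eventuallyEq ?_)
  filter_upwards [(isCompact_image_chart hK hKs).isClosed.isOpen_compl.mem_nhds hy] with p hp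
  exact h p hp

variable [RiemannianBundle (fun x : M => TangentSpace (𝓡 n) x)]
  {z : (x : M) → Forms (TangentSpace (𝓡 n) x)}

theorem pullback_chartFlow_of_notMem
    (hψ : IsVectorFlow (chartField c X) ψ) (hL : LipschitzWith L (chartField c X))
    (hK : IsCompact K) (hKs : K ⊆ (chartAt (EuclideanSpace ℝ (Fin n)) c).source)
    (hX0 : ∀ x ∉ K, X x = 0) {x : M} (hx : x ∉ K) (t : ℝ) :
    pullback (chartFlow c ψ t) z x = z x := by
  have h : chartFlow c ψ t =ᶠ[𝓝 x] id := by
    filter_upwards [hK.isClosed.isOpen_compl.mem_nhds hx] with p hp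
    exact chartFlow_eq_self hψ hL hX0 hKs hp t
  have hd : ∀ v : TangentSpace (𝓡 n) x, mfderiv (𝓡 n) (𝓡 n) (chartFlow c ψ t) x v = v := by
    intro v
    have h1 := h.mfderiv_eq (I := 𝓡 n) (I' := 𝓡 n)
    rw [mfderiv_id] at h1
    exact DFunLike.congr_fun h1 v
  funext k
  ext v
  exact form_congr_point z h.eq_of_nhds (funext fun l => hd _)

theorem normSq_pullback_chartFlow (hψ : IsVectorFlow (chartField c X) ψ)
    (hL : LipschitzWith L (chartField c X))
    (hJ' : ∀ y, HasFDerivAt (ψ t) (J' y) y) (hJ : ∀ y, HasFDerivAt (ψ (-t)) (J y) y)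
    {y : EuclideanSpace ℝ (Fin n)} (hy : y ∈ (chartAt (EuclideanSpace ℝ (Fin n)) c).target) :
    normSq (pullback (chartFlow c ψ t) z
      ((chartAt (EuclideanSpace ℝ (Fin n)) c).symm (ψ (-t) y))) *
      Real.sqrt (gramDet c (ψ (-t) y) * (J y).det ^ 2 / gramDet c y) =
      pulledDensity c z (y, ψ (-t) y, J y) := by
  set e := chartAt (EuclideanSpace ℝ (Fin n)) c with he
  have hm : ∀ s, ∀ p, ψ s p ∈ e.target ↔ p ∈ e.target := fun s p =>
    hψ.mem_iff hL support_chartField_subset s p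
  have hq : ψ (-t) y ∈ e.target := (hm _ _).2 hy
  have hx : e.symm (ψ (-t) y) ∈ e.source := e.map_target hq
  refine normSq_pullback_chart hq (hJ y) (hψ.det_ne_zero hL hJ' hJ y) ?_ ?_
  · have h1 : MDifferentiableAt (𝓡 n) (𝓡 n) e (e.symm (ψ (-t) y)) :=
      (contMDiffAt_chart hx).mdifferentiableAt (by simp)
    have h2 : MDifferentiableAt (𝓡 n) (𝓡 n) (ψ t) (e (e.symm (ψ (-t) y))) :=
      (hJ' _).differentiableAt.mdifferentiableAt
    have h3 : MDifferentiableAt (𝓡 n) (𝓡 n) e.symm (ψ t (e (e.symm (ψ (-t) y)))) :=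
      (contMDiffAt_chart_symm ((hm _ _).2 (e.map_source hx))).mdifferentiableAt (by simp)
    have h4 : MDifferentiableAt (𝓡 n) (𝓡 n) (e.symm ∘ (ψ t ∘ e)) (e.symm (ψ (-t) y)) :=
      h3.comp (e.symm (ψ (-t) y)) (h2.comp _ h1)
    refine h4.congr_of_eventuallyEq ?_
    filter_upwards [e.open_source.mem_nhds hx] with p hp
    exact if_pos hp
  · filter_upwards [e.open_target.mem_nhds hy] with p hp
    simp only [Function.comp]
    rw [chartFlow_symm ((hm _ _).2 hp), hψ.apply_neg hL]

variable [IsContMDiffRiemannianBundle (𝓡 n) ∞ (EuclideanSpace ℝ (Fin n))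
      (fun x : M => TangentSpace (𝓡 n) x)] [MeasurableSpace M] [BorelSpace M]

/-- The substitution by ψ_{-t} evaluates `z` always at the point `y`, so the time enters only
through the metric and the Jacobian. -/
theorem setIntegral_normSq_pullback_chartFlow (hψ : IsVectorFlow (chartField c X) ψ)
    (hL : LipschitzWith L (chartField c X))
    (hJ' : ∀ y, HasFDerivAt (ψ t) (J' y) y) (hJ : ∀ y, HasFDerivAt (ψ (-t)) (J y) y) :
    (IntegrableOn (fun x => normSq (pullback (chartFlow c ψ t) z x))
      (chartAt (EuclideanSpace ℝ (Fin n)) c).source (riemVol n M) ↔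
      Integrable (fun y => pulledDensity c z (y, ψ (-t) y, J y)) (coordMeasure c)) ∧
    ∫ x in (chartAt (EuclideanSpace ℝ (Fin n)) c).source,
      normSq (pullback (chartFlow c ψ t) z x) ∂riemVol n M =
      ∫ y, pulledDensity c z (y, ψ (-t) y, J y) ∂coordMeasure c := by
  set e := chartAt (EuclideanSpace ℝ (Fin n)) c with he
  have hm : ∀ s, ∀ p, ψ s p ∈ e.target ↔ p ∈ e.target := fun s p =>
    hψ.mem_iff hL support_chartField_subset s p
  have hinj : Function.Injective (ψ (-t)) := fun p q hpq => by
    rw [← hψ.apply_neg hL t p, hpq, hψ.apply_neg hL]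
  have himg : ψ (-t) '' e.target = e.target := by
    ext y
    constructor
    · rintro ⟨p, hp, rfl⟩
      exact (hm _ _).2 hp
    · intro hy
      exact ⟨ψ t y, (hm _ _).2 hy, hψ.neg_apply hL t y⟩
  have hae : (fun y => normSq (pullback (chartFlow c ψ t) z (e.symm (ψ (-t) y))) *
      Real.sqrt (gramDet c (ψ (-t) y) * (J y).det ^ 2 / gramDet c y)) =ᵐ[coordMeasure c]
      fun y => pulledDensity c z (y, ψ (-t) y, J y) := by
    filter_upwards [ae_coordMeasure_mem_target c] with y hy
    exact normSq_pullback_chartFlow hψ hL hJ' hJ hy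
  obtain ⟨h1, h2⟩ := coordMeasure_change c hJ hinj himg
    fun y => normSq (pullback (chartFlow c ψ t) z (e.symm y))
  constructor
  · rw [integrableOn_source_iff]
    exact h1.trans (integrable_congr hae)
  · rw [setIntegral_source, h2]
    exact integral_congr_ae hae

/-- On the image of `K` the components of `z` are measurable; off it the flow is the identity and
the density is |z|². -/
theorem aestronglyMeasurable_pulledDensity [CompactSpace M] (hz : IsL2Form z)
    (hψ : IsVectorFlow (chartField c X) ψ)
    (hL : LipschitzWith L (chartField c X)) (hK : IsCompact K)
    (hKs : K ⊆ (chartAt (EuclideanSpace ℝ (Fin n)) c).source) (hX0 : ∀ x ∉ K, X x = 0)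
    (hJ' : ∀ y, HasFDerivAt (ψ t) (J' y) y) (hJ : ∀ y, HasFDerivAt (ψ (-t)) (J y) y) :
    AEStronglyMeasurable (fun y => pulledDensity c z (y, ψ (-t) y, J y)) (coordMeasure c) := by
  set e := chartAt (EuclideanSpace ℝ (Fin n)) c with he
  have hκm := (isCompact_image_chart hK hKs).isClosed.measurableSet
  rw [← Measure.restrict_univ (μ := coordMeasure c), ← union_compl_self (e '' K),
    aestronglyMeasurable_union_iff]
  constructor
  · have hdiff : Differentiable ℝ (ψ (-t)) := fun y => (hJ y).differentiableAt
    have hJeq : J = fderiv ℝ (ψ (-t)) := funext fun y => (hJ y).fderiv.symm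
    have hg : Measurable fun y => ((y, ψ (-t) y, J y) : EuclideanSpace ℝ (Fin n) ×
        EuclideanSpace ℝ (Fin n) × (EuclideanSpace ℝ (Fin n) →L[ℝ] EuclideanSpace ℝ (Fin n))) := by
      refine measurable_id.prodMk (hdiff.continuous.measurable.prodMk ?_)
      rw [hJeq]
      exact measurable_fderiv ℝ _
    simp only [pulledDensity_eq_sum]
    refine Finset.aestronglyMeasurable_fun_sum _ fun k _ =>
      Finset.aestronglyMeasurable_fun_sum _ fun I _ =>
        Finset.aestronglyMeasurable_fun_sum _ fun I' _ => ?_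
    refine AEStronglyMeasurable.mul ?_ ((aestronglyMeasurable_coordComponent hz hK hKs I).mul
      (aestronglyMeasurable_coordComponent hz hK hKs I'))
    exact (aestronglyMeasurable_densityCoeff I I' hg fun y hy =>
      ⟨hy, (hψ.mem_iff hL support_chartField_subset _ _).2 hy,
        hψ.det_ne_zero hL hJ' hJ y⟩).restrict
  · have h1 : AEStronglyMeasurable (fun y => normSq (z (e.symm y))) (coordMeasure c) :=
      (aestronglyMeasurable_source_iff c (f := fun x => normSq (z x))).1 hz.2.1.restrict
    refine (h1.restrict (s := (e '' K)ᶜ)).congr ?_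
    filter_upwards [ae_restrict_mem hκm.compl, ae_restrict_of_ae (ae_coordMeasure_mem_target c)]
      with y hy hyt
    obtain ⟨h2, h3⟩ := fderiv_flow_eq_id hψ hL hK hKs hX0 hJ hy
    rw [h2, h3, pulledDensity_id hyt]

/-- At time zero the pulled back Gram matrix has derivative -L_X g, which is minus `covSym` by
`localConn_add_swap`; the sign comes from the reversed time. The factor 1/2 arises because the
density in (*) is 2⟨S, Q⟩ - tr S |z|². -/
theorem hasDerivAt_pulledDensity (hX : SmoothField X) (hψ : IsVectorFlow (chartField c X) ψ)
    {J : ℝ → EuclideanSpace ℝ (Fin n) →L[ℝ] EuclideanSpace ℝ (Fin n)}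
    {y : EuclideanSpace ℝ (Fin n)} (hy : y ∈ (chartAt (EuclideanSpace ℝ (Fin n)) c).target)
    (hJ0 : J 0 = ContinuousLinearMap.id ℝ _)
    (hJ : HasDerivAt J (fderiv ℝ (chartField c X) y) 0) :
    HasDerivAt (fun t => pulledDensity c z (y, ψ (-t) y, J (-t)))
      (1 / 2 * firstVarDensity z X ((chartAt (EuclideanSpace ℝ (Fin n)) c).symm y)) 0 := by
  set e := chartAt (EuclideanSpace ℝ (Fin n)) c with he
  have hXd := hX.diffFieldAt (e.symm y)
  have hbasis : (coordBasis c y hy : Fin n → TangentSpace (𝓡 n) (e.symm y)) =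
      fun i => chartD c y (EuclideanSpace.single i (1 : ℝ)) := funext (coordBasis_apply hy)
  have hneg : HasDerivAt (fun t : ℝ => -t) (-1) 0 := hasDerivAt_neg 0
  have h1 : HasDerivAt (fun t => ψ (-t) y) (-chartField c X y) 0 := by
    have h := hψ.hasDerivAt y 0
    rw [hψ.zero, ← neg_zero] at h
    exact (HasDerivAt.scomp (0 : ℝ) h hneg).congr_deriv (by simp)
  have h2 : HasDerivAt (fun t => J (-t)) (-fderiv ℝ (chartField c X) y) 0 := by
    rw [← neg_zero] at hJ
    exact (HasDerivAt.scomp (0 : ℝ) hJ hneg).congr_deriv (by simp)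
  have hentry : ∀ i j, HasDerivAt (fun t => pulledGram c (ψ (-t) y, J (-t)) i j)
      (-(Matrix.of fun i j => covSym hXd (coordBasis c y hy i) (coordBasis c y hy j)) i j) 0 := by
    intro i j
    have hv : ∀ i : Fin n, HasDerivAt (fun t => J (-t) (EuclideanSpace.single i (1 : ℝ)))
        (-fderiv ℝ (chartField c X) y (EuclideanSpace.single i (1 : ℝ))) 0 := by
      intro i
      refine (h2.clm_apply (hasDerivAt_const (0 : ℝ) (EuclideanSpace.single i (1 : ℝ)))).congr_deriv
        ?_
      simp
    have hp : ψ (-0) y = y := by rw [neg_zero, hψ.zero]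
    refine (hasDerivAt_bilin_neg (g := chartMetric c) (p := fun t => ψ (-t) y)
      (by rw [hp]; exact differentiableAt_chartMetric hy) h1 (hv i) (hv j)).congr_deriv ?_
    rw [neg_zero, hψ.zero, hJ0, Matrix.of_apply, covSym_apply, hbasis,
      inner_leviCivita_chartD hy hXd, inner_leviCivita_chartD hy hXd,
      localConn_add_swap (chartMetric_symm c) (differentiableAt_chartMetric hy),
      (chartField_eventuallyEq (X := X) hy).fderiv_eq,
      (chartField_eventuallyEq (X := X) hy).eq_of_nhds]
    rfl
  have hgram : gramMat (coordBasis c y hy) = chartGram c y := by rw [hbasis]; rfl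
  have h0 : pulledGram c (ψ (-0) y, J (-0)) = gramMat (coordBasis c y hy) := by
    rw [hgram, neg_zero, hψ.zero, hJ0, pulledGram_id]
  have hmain := hasDerivAt_componentNormSq_mul_sqrt_det (coordBasis c y hy) (z (e.symm y))
    (G := fun t => pulledGram c (ψ (-t) y, J (-t))) h0 hentry
  rw [firstVarDensity_eq (coordBasis c y hy) z hXd]
  rw [hgram] at hmain ⊢
  refine (hmain.congr_deriv ?_).congr_of_eventuallyEq (Eventually.of_forall fun t => ?_)
  · ring
  · simp only [pulledDensity]
    rw [hbasis, gramDet_eq]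

end FlowEnergy

/-! ### The first variation formula and the divergence theorem -/

section FirstVariation

variable {n : ℕ} {M : Type*} [TopologicalSpace M] [T2Space M] [CompactSpace M]
  [ChartedSpace (EuclideanSpace ℝ (Fin n)) M] [IsManifold (𝓡 n) ∞ M]
  [RiemannianBundle (fun x : M => TangentSpace (𝓡 n) x)]
  [IsContMDiffRiemannianBundle (𝓡 n) ∞ (EuclideanSpace ℝ (Fin n))
      (fun x : M => TangentSpace (𝓡 n) x)] [MeasurableSpace M] [BorelSpace M]
  {c : M} {X : (x : M) → TangentSpace (𝓡 n) x} {K : Set M}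
  {z : (x : M) → Forms (TangentSpace (𝓡 n) x)}

set_option maxHeartbeats 400000 in
/-- The first variation formula for a vector field supported in the domain of a chart. -/
theorem exists_flow_hasDerivAt_energy (hz : IsL2Form z) (hX : SmoothField X) (hK : IsCompact K)
    (hKs : K ⊆ (chartAt (EuclideanSpace ℝ (Fin n)) c).source) (hX0 : ∀ x ∉ K, X x = 0) :
    Integrable (firstVarDensity z X) (riemVol n M) ∧ ∃ φ : ℝ → M → M, IsFlow X φ ∧
      HasDerivAt (fun t => energy (pullback (φ t) z)) (1 / 2 * firstVar z X) 0 := by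
  set e := chartAt (EuclideanSpace ℝ (Fin n)) c with he
  have hYs := contDiff_chartField hX hK hKs hX0
  have hYc := hasCompactSupport_chartField hK hKs hX0
  obtain ⟨L, hL⟩ := ContDiff.lipschitzWith_of_hasCompactSupport hYc hYs (by simp)
  obtain ⟨B, hB⟩ := hYc.exists_bound_of_continuous hYs.continuous
  obtain ⟨ψ, hψ⟩ := exists_isVectorFlow hL hB
  obtain ⟨ε, hε, C, J, hJ⟩ := hψ.exists_hasFDerivAt (hYs.of_le (by norm_cast)) hYc
  have hJt : ∀ t, |t| < ε → ∀ y, HasFDerivAt (ψ t) (J t y) y := fun t ht y => ((hJ y).2.2 t ht).1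
  have hJn : ∀ t, |t| < ε → ∀ y, HasFDerivAt (ψ (-t)) (J (-t) y) y := fun t ht y =>
    hJt _ (by rwa [abs_neg]) y
  set F : ℝ → EuclideanSpace ℝ (Fin n) → ℝ :=
    fun t y => pulledDensity c z (y, ψ (-t) y, J (-t) y) with hF
  have hF0 : ∀ y ∈ e.target, F 0 y = normSq (z (e.symm y)) := by
    intro y hy
    simp only [hF, neg_zero, hψ.zero, (hJ y).2.1]
    exact pulledDensity_id hy
  obtain ⟨δ, hδ, L', hL', hlip⟩ := exists_pulledDensity_lipschitz (isCompact_image_chart hK hKs)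
    (image_chart_subset hKs) z
  set C' := |C| with hC'
  -- For times below ε' the flow and its derivative stay within δ of the identity, where the
  -- Lipschitz estimate applies.
  obtain ⟨ε', hε'ε, hε'⟩ : ∃ ε' ≤ ε, 0 < ε' ∧ C' * ε' < δ := by
    refine ⟨min ε (δ / (C' + 1)), min_le_left _ _, lt_min hε (by positivity), ?_⟩
    have h1 : min ε (δ / (C' + 1)) ≤ δ / (C' + 1) := min_le_right _ _
    have h2 : 0 ≤ C' := abs_nonneg _
    calc C' * min ε (δ / (C' + 1)) ≤ C' * (δ / (C' + 1)) := mul_le_mul_of_nonneg_left h1 h2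
      _ < δ := by
        rw [mul_div_assoc', div_lt_iff₀ (by positivity)]
        nlinarith
  have hnz : Integrable (fun y => normSq (z (e.symm y))) (coordMeasure c) :=
    (integrableOn_source_iff c (f := fun x => normSq (z x))).1 hz.2.integrableOn
  -- On the image of `K` this is the Lipschitz estimate; elsewhere the flow is the identity and the
  -- difference is zero.
  have hbound : ∀ y ∈ e.target, ∀ t, |t| < ε' →
      |F t y - F 0 y| ≤ L' * C' * normSq (z (e.symm y)) * |t| := by
    intro y hy t ht
    have htε := ht.trans_le hε'ε
    rw [hF0 y hy]
    by_cases hyK : y ∈ e '' K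
    · have hn : ‖((ψ (-t) y, J (-t) y) : EuclideanSpace ℝ (Fin n) ×
          (EuclideanSpace ℝ (Fin n) →L[ℝ] EuclideanSpace ℝ (Fin n))) -
          (y, ContinuousLinearMap.id ℝ _)‖ ≤ C' * |t| := by
        obtain ⟨-, h1, h2⟩ := (hJ y).2.2 (-t) (by rwa [abs_neg])
        rw [abs_neg] at h1 h2
        have h3 : C * |t| ≤ C' * |t| := mul_le_mul_of_nonneg_right (le_abs_self _) (abs_nonneg _)
        rw [Prod.mk_sub_mk, Prod.norm_def]
        exact max_le (h2.trans h3) (h1.trans h3)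
      have hlt : C' * |t| < δ :=
        (mul_le_mul_of_nonneg_left ht.le (abs_nonneg _)).trans_lt hε'.2
      refine (hlip y hyK _ (hn.trans_lt hlt)).trans ?_
      have h4 : 0 ≤ normSq (z (e.symm y)) := normSq_nonneg _
      calc _ ≤ L' * (C' * |t|) * normSq (z (e.symm y)) :=
            mul_le_mul_of_nonneg_right (mul_le_mul_of_nonneg_left hn hL') h4
        _ = _ := by ring
    · obtain ⟨h1, h2⟩ := fderiv_flow_eq_id hψ hL hK hKs hX0 (hJn t htε) hyK
      have h3 : F t y = normSq (z (e.symm y)) := by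
        simp only [hF]
        rw [h1, h2, pulledDensity_id hy]
      rw [h3, sub_self, abs_zero]
      have h4 : 0 ≤ normSq (z (e.symm y)) := normSq_nonneg _
      positivity
  have hmeas : ∀ t, |t| < ε' → AEStronglyMeasurable (F t) (coordMeasure c) := fun t ht =>
    aestronglyMeasurable_pulledDensity hz hψ hL hK hKs hX0 (hJt t (ht.trans_le hε'ε))
      (hJn t (ht.trans_le hε'ε))
  have hF0i : Integrable (F 0) (coordMeasure c) := by
    refine hnz.congr ?_
    filter_upwards [ae_coordMeasure_mem_target c] with y hy
    exact (hF0 y hy).symm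
  have hder : ∀ y ∈ e.target, HasDerivAt (fun t => F t y)
      (1 / 2 * firstVarDensity z X (e.symm y)) 0 := fun y hy =>
    hasDerivAt_pulledDensity (J := fun t => J t y) hX hψ hy (hJ y).2.1 (hJ y).1
  obtain ⟨hi, hd⟩ := hasDerivAt_integral_of_lip_at (F := F) (μ := coordMeasure c) hε'.1 hmeas hF0i
    (bound := fun y => L' * C' * normSq (z (e.symm y)))
    (F' := fun y => 1 / 2 * firstVarDensity z X (e.symm y))
    ((ae_coordMeasure_mem_target c).mono fun y hy => hbound y hy) (hnz.const_mul _)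
    ((ae_coordMeasure_mem_target c).mono hder)
  have hKc : ∀ x ∉ K, ∀ᶠ p in 𝓝 x, X p = 0 := fun x hx => by
    filter_upwards [hK.isClosed.isOpen_compl.mem_nhds hx] with p hp
    exact hX0 p hp
  have hdens0 : ∀ x ∉ e.source, firstVarDensity z X x = 0 := fun x hx =>
    firstVarDensity_eq_zero (hKc x fun h => hx (hKs h))
  refine ⟨?_, chartFlow c ψ, isFlow_chartFlow hψ hL hX0 hKs, ?_⟩
  · have h1 : Integrable (fun y => firstVarDensity z X (e.symm y)) (coordMeasure c) := by
      have := hi.const_mul 2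
      simpa [← mul_assoc] using this
    have h2 := (integrableOn_source_iff c (f := firstVarDensity z X)).2 h1
    rwa [← integrableOn_iff_integrable_of_support_subset]
    exact fun x hx => by_contra fun h => hx (hdens0 x h)
  · have hval : ∫ y, 1 / 2 * firstVarDensity z X (e.symm y) ∂coordMeasure c =
        1 / 2 * firstVar z X := by
      rw [integral_const_mul, ← setIntegral_source, firstVar,
        setIntegral_eq_integral_of_forall_compl_eq_zero hdens0]
    rw [hval] at hd
    -- Off the chart domain the pulled back form is `z` itself, so that part of the energy is
    -- constant in time.
    refine (hd.add_const (∫ x in e.sourceᶜ, normSq (z x) ∂riemVol n M)).congr_of_eventuallyEq ?_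
    filter_upwards [Metric.ball_mem_nhds (0 : ℝ) hε'.1] with t ht
    have ht' : |t| < ε' := by simpa using ht
    have htε := ht'.trans_le hε'ε
    obtain ⟨h1, h2⟩ := setIntegral_normSq_pullback_chartFlow (z := z) hψ hL (hJt t htε) (hJn t htε)
    have hFi : Integrable (F t) (coordMeasure c) := by
      have h3 : Integrable (fun y => F t y - F 0 y) (coordMeasure c) := by
        refine ((hnz.const_mul (L' * C')).mul_const |t|).mono' ((hmeas t ht').sub hF0i.1) ?_
        filter_upwards [ae_coordMeasure_mem_target c] with y hy
        exact hbound y hy t ht'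
      refine (h3.add hF0i).congr (Eventually.of_forall fun y => ?_)
      simp
    have hcompl : EqOn (fun x => normSq (pullback (chartFlow c ψ t) z x)) (fun x => normSq (z x))
        e.sourceᶜ := fun x hx => by
      simp only
      rw [pullback_chartFlow_of_notMem hψ hL hK hKs hX0 (fun h => hx (hKs h))]
    have hms := e.open_source.measurableSet
    have hint : Integrable (fun x => normSq (pullback (chartFlow c ψ t) z x)) (riemVol n M) := by
      rw [← integrableOn_univ, ← union_compl_self e.source, integrableOn_union]
      exact ⟨h1.2 hFi, (integrableOn_congr_fun hcompl hms.compl).2 hz.2.integrableOn⟩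
    rw [energy, ← integral_add_compl hms hint, h2, setIntegral_congr_fun hms.compl hcompl]

theorem firstVarDensity_sum {ι : Type*} (s : Finset ι) {W : ι → (x : M) → TangentSpace (𝓡 n) x}
    (hW : ∀ i ∈ s, SmoothField (W i)) (x : M) :
    firstVarDensity z (fun p => ∑ i ∈ s, W i p) x = ∑ i ∈ s, firstVarDensity z (W i) x := by
  classical
  induction s using Finset.induction_on with
  | empty =>
    simp only [Finset.sum_empty]
    exact firstVarDensity_eq_zero (Eventually.of_forall fun _ => rfl)
  | insert a s ha ih =>
    have hs : SmoothField (fun p => ∑ i ∈ s, W i p) :=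
      ContMDiff.sum_section fun i hi => hW i (Finset.mem_insert_of_mem hi)
    simp only [Finset.sum_insert ha]
    rw [firstVarDensity_add ((hW a (Finset.mem_insert_self a s)).diffFieldAt x) (hs.diffFieldAt x),
      ih fun i hi => hW i (Finset.mem_insert_of_mem hi)]

/-- A smooth vector field is a finite sum of fields supported in domains of charts. -/
theorem exists_chart_decomposition (hX : SmoothField X) :
    ∃ (s : Finset M) (W : M → (x : M) → TangentSpace (𝓡 n) x),
      (∀ c, SmoothField (W c)) ∧ (∀ c, ∃ K, IsCompact K ∧
        K ⊆ (chartAt (EuclideanSpace ℝ (Fin n)) c).source ∧ ∀ x ∉ K, W c x = 0) ∧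
      X = fun p => ∑ c ∈ s, W c p := by
  obtain ⟨f, hf⟩ := SmoothPartitionOfUnity.exists_isSubordinate (𝓡 n) (isClosed_univ (X := M))
    (fun c : M => (chartAt (EuclideanSpace ℝ (Fin n)) c).source)
    (fun c => (chartAt (EuclideanSpace ℝ (Fin n)) c).open_source)
    (fun x _ => mem_iUnion.2 ⟨x, mem_chart_source _ x⟩)
  -- By compactness only finitely many members of the partition of unity are nonzero.
  have hfin := f.locallyFinite.finite_nonempty_of_compact
  refine ⟨hfin.toFinset, fun c => fun x => f c x • X x, fun c => ?_, fun c => ?_, ?_⟩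
  · exact ContMDiff.smul_section (f c).contMDiff hX
  · refine ⟨tsupport (f c), (isClosed_tsupport _).isCompact, hf c, fun x hx => ?_⟩
    simp only [image_eq_zero_of_notMem_tsupport hx, zero_smul]
  · funext p
    have h1 := f.sum_eq_one (mem_univ p)
    rw [finsum_eq_sum_of_support_subset (s := hfin.toFinset)] at h1
    · rw [← Finset.sum_smul, h1, one_smul]
    · intro c hc
      simp only [Finite.coe_toFinset]
      exact ⟨p, hc⟩

/-- Criticality is used for the flow of each chart-supported piece separately; linearity of the
density then adds the pieces up, without reference to the flow of `X`. -/
theorem firstVar_eq_zero_of_isCritical (hz : IsL2Form z) (hc : IsCritical z)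
    (hX : SmoothField X) : firstVar z X = 0 := by
  obtain ⟨s, W, hW, hK, rfl⟩ := exists_chart_decomposition hX
  have h : ∀ c, Integrable (firstVarDensity z (W c)) (riemVol n M) ∧ firstVar z (W c) = 0 := by
    intro c
    obtain ⟨K, hKc, hKs, hK0⟩ := hK c
    obtain ⟨h1, φ, hφ, hd⟩ := exists_flow_hasDerivAt_energy hz (hW c) hKc hKs hK0
    have := hd.unique (hc (W c) φ (hW c) hφ)
    exact ⟨h1, by linarith⟩
  rw [firstVar]
  simp only [firstVarDensity_sum s fun i _ => hW i]
  rw [integral_finsetSum s fun i _ => (h i).1]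
  exact Finset.sum_eq_zero fun i _ => (h i).2

theorem normSq_oneForm {V : Type*} [NormedAddCommGroup V] [InnerProductSpace ℝ V]
    [FiniteDimensional ℝ V] : normSq (oneForm : Forms V) = 1 := by
  rw [normSq, innerForms, Finset.sum_eq_single 0]
  · simp [innerDeg, oneForm]
  · intro k _ hk
    simp [innerDeg, oneForm, Pi.single_eq_of_ne hk]
  · intro h
    exact absurd (Finset.mem_range.2 (Nat.succ_pos _)) h

theorem isL2Form_oneForm :
    IsL2Form (n := n) (fun x : M => (oneForm : Forms (TangentSpace (𝓡 n) x))) := by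
  constructor
  · rintro (_ | k) X -
    · refine (aestronglyMeasurable_const (b := (1 : ℝ))).congr (Eventually.of_forall fun x => ?_)
      simp [oneForm]
    · refine (aestronglyMeasurable_const (b := (0 : ℝ))).congr (Eventually.of_forall fun x => ?_)
      simp [oneForm]
  · simp only [normSq_oneForm]
    exact integrable_const _

/-- As the form 1 is its own pullback, its energy is constant along any flow, and its first
variation formula becomes the divergence theorem. -/
theorem pullback_oneForm (φ : M → M) :
    pullback (n := n) φ (fun x : M => (oneForm : Forms (TangentSpace (𝓡 n) x))) =
      fun _ => oneForm := by
  funext x k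
  rcases k with _ | k
  · ext v
    simp [pullback, oneForm]
  · ext v
    simp [pullback, oneForm]

/-- The divergence theorem: the density of the first variation of the form `1` is twice the
negative of the divergence. -/
theorem firstVar_oneForm (hX : SmoothField X) (hK : IsCompact K)
    (hKs : K ⊆ (chartAt (EuclideanSpace ℝ (Fin n)) c).source) (hX0 : ∀ x ∉ K, X x = 0) :
    Integrable (firstVarDensity (fun x : M => (oneForm : Forms (TangentSpace (𝓡 n) x))) X)
      (riemVol n M) ∧ firstVar (fun x : M => (oneForm : Forms (TangentSpace (𝓡 n) x))) X = 0 := by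
  obtain ⟨h1, φ, -, hd⟩ := exists_flow_hasDerivAt_energy isL2Form_oneForm hX hK hKs hX0
  refine ⟨h1, ?_⟩
  simp only [pullback_oneForm] at hd
  have := hd.unique (hasDerivAt_const _ _)
  linarith

end FirstVariation

/-! ### The pointwise equations in an orthonormal frame -/

theorem continuousAt_fderiv_apply {F G : Type*} [NormedAddCommGroup F] [NormedSpace ℝ F]
    [NormedAddCommGroup G] [NormedSpace ℝ G] {f : F → G} {u : F → F} {y : F}
    (hf : ContDiffAt ℝ 1 f y) (hu : ContinuousAt u y) :
    ContinuousAt (fun y => fderiv ℝ f y (u y)) y :=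
  (hf.fderiv_right (m := 0) (by norm_num)).continuousAt.clm_apply hu

theorem continuousAt_localConn {F : Type*} [NormedAddCommGroup F] [NormedSpace ℝ F]
    {g : F → F →L[ℝ] F →L[ℝ] ℝ} {X u w : F → F} {y : F} (hg : ContDiffAt ℝ 1 g y)
    (hX : ContDiffAt ℝ 1 X y) (hu : ContinuousAt u y) (hw : ContinuousAt w y) :
    ContinuousAt (fun y => localConn g X y (u y) (w y)) y := by
  have hd : ∀ {a : F → F}, ContinuousAt a y → ContinuousAt (fun y => fderiv ℝ g y (a y)) y :=
    fun ha => continuousAt_fderiv_apply (G := F →L[ℝ] F →L[ℝ] ℝ) hg ha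
  have hX' := continuousAt_fderiv_apply hX hu
  have hX0 := hX.continuousAt
  exact ((hg.continuousAt.clm_apply hX').clm_apply hw).add (continuousAt_const.mul
    (((((hd hu).clm_apply hX0).clm_apply hw).add (((hd hX0).clm_apply hw).clm_apply hu)).sub
      (((hd hw).clm_apply hu).clm_apply hX0)))

section Frame

variable {n : ℕ} {M : Type*} [TopologicalSpace M]
  [ChartedSpace (EuclideanSpace ℝ (Fin n)) M] [IsManifold (𝓡 n) ∞ M]
  [RiemannianBundle (fun x : M => TangentSpace (𝓡 n) x)]
  {ι : Type*} [Fintype ι] {v : ι → (x : M) → TangentSpace (𝓡 n) x}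
  {z : (x : M) → Forms (TangentSpace (𝓡 n) x)} {U : Set M} {x : M}

/-- The orthonormal basis given by an orthonormal frame at a point. -/
def IsOrthonormalFrameOn.basis (hv : IsOrthonormalFrameOn v U) (hx : x ∈ U) :
    OrthonormalBasis ι ℝ (TangentSpace (𝓡 n) x) :=
  OrthonormalBasis.mk (hv.2 x hx) (hv.1.generating hx)

theorem IsOrthonormalFrameOn.basis_apply (hv : IsOrthonormalFrameOn v U) (hx : x ∈ U) (i : ι) :
    hv.basis hx i = v i x := by
  simp [IsOrthonormalFrameOn.basis]

theorem IsOrthonormalFrameOn.contMDiffAt (hv : IsOrthonormalFrameOn v U) (hU : IsOpen U)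
    (hx : x ∈ U) (i : ι) : ContMDiffAt (𝓡 n) (𝓡 n).tangent ∞
      (fun x => (⟨x, v i x⟩ : TangentBundle (𝓡 n) M)) x :=
  (hv.1.contMDiffOn i).contMDiffAt (hU.mem_nhds hx)

theorem IsOrthonormalFrameOn.diffFieldAt (hv : IsOrthonormalFrameOn v U) (hU : IsOpen U)
    (hx : x ∈ U) (i : ι) : DiffFieldAt (v i) x :=
  (hv.contMDiffAt hU hx i).mdifferentiableAt (by simp)

theorem innerForms_eq_sum {V : Type*} [NormedAddCommGroup V] [InnerProductSpace ℝ V]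
    [FiniteDimensional ℝ V] (b : OrthonormalBasis ι ℝ V) (α β : Forms V) :
    innerForms α β = ∑ k ∈ Finset.range (Fintype.card ι + 1), (k.factorial : ℝ)⁻¹ *
      ∑ I : Fin k → ι, α k (fun l => b (I l)) * β k (fun l => b (I l)) := by
  classical
  rw [innerForms, Module.finrank_eq_card_basis b.toBasis]
  exact Finset.sum_congr rfl fun k _ => innerDeg_eq_sum b _ _


section Smooth

variable [T2Space M] [CompactSpace M]

/-- Smoothness of a form is tested on global fields; near `x` the local fields coincide with global
ones. -/
theorem SmoothFormOn.contMDiffAt_apply (hz : SmoothFormOn z U) (hU : IsOpen U) (hx : x ∈ U)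
    (hv : ∀ i, ContMDiffOn (𝓡 n) (𝓡 n).tangent ∞
      (fun x => (⟨x, v i x⟩ : TangentBundle (𝓡 n) M)) U) {k : ℕ} (I : Fin k → ι) :
    ContMDiffAt (𝓡 n) 𝓘(ℝ, ℝ) ∞ (fun x => z x k fun l => v (I l) x) x := by
  obtain ⟨w, hw, hwx⟩ := exists_smoothField_eq (isClosed_singleton (x := x)) hU
    (singleton_subset_iff.2 hx) v hv
  refine ((hz k (fun l => w (I l)) fun l => hw _).contMDiffAt
    (hU.mem_nhds hx)).congr_of_eventuallyEq ?_
  filter_upwards [hwx x (mem_singleton x)] with p hp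
  simp only [hp]

theorem contMDiffAt_normSq (hz : SmoothFormOn z U) (hU : IsOpen U) (hx : x ∈ U)
    (hv : IsOrthonormalFrameOn v U) :
    ContMDiffAt (𝓡 n) 𝓘(ℝ, ℝ) ∞ (fun x => normSq (z x)) x := by
  have h : ContMDiffAt (𝓡 n) 𝓘(ℝ, ℝ) ∞ (fun x => ∑ k ∈ Finset.range (Fintype.card ι + 1),
      (k.factorial : ℝ)⁻¹ * ∑ I : Fin k → ι, z x k (fun l => v (I l) x) *
        z x k (fun l => v (I l) x)) x := by
    refine ContMDiffAt.sum fun k _ => contMDiffAt_const.mul (ContMDiffAt.sum fun I _ => ?_)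
    exact (hz.contMDiffAt_apply hU hx hv.1.contMDiffOn I).mul
      (hz.contMDiffAt_apply hU hx hv.1.contMDiffOn I)
  refine h.congr_of_eventuallyEq ?_
  filter_upwards [hU.mem_nhds hx] with p hp
  rw [normSq, innerForms_eq_sum (hv.basis hp)]
  simp only [hv.basis_apply]

theorem contMDiffAt_normSq_intMul (hz : SmoothFormOn z U) (hU : IsOpen U) (hx : x ∈ U)
    (hv : IsOrthonormalFrameOn v U) (j : ι) :
    ContMDiffAt (𝓡 n) 𝓘(ℝ, ℝ) ∞ (fun x => normSq (intMul (v j x) (z x))) x := by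
  have hc : ∀ (k : ℕ) (I : Fin k → ι) (p : M), intMul (v j p) (z p) k (fun l => v (I l) p) =
      z p (k + 1) fun l => v (Matrix.vecCons j I l) p := by
    intro k I p
    rw [intMul_apply]
    refine congrArg _ (funext fun l => ?_)
    refine Fin.cases ?_ (fun l => ?_) l <;> simp
  have h : ContMDiffAt (𝓡 n) 𝓘(ℝ, ℝ) ∞ (fun x => ∑ k ∈ Finset.range (Fintype.card ι + 1),
      (k.factorial : ℝ)⁻¹ * ∑ I : Fin k → ι, z x (k + 1) (fun l => v (Matrix.vecCons j I l) x) *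
        z x (k + 1) (fun l => v (Matrix.vecCons j I l) x)) x := by
    refine ContMDiffAt.sum fun k _ => contMDiffAt_const.mul (ContMDiffAt.sum fun I _ => ?_)
    exact (hz.contMDiffAt_apply hU hx hv.1.contMDiffOn _).mul
      (hz.contMDiffAt_apply hU hx hv.1.contMDiffOn _)
  refine h.congr_of_eventuallyEq ?_
  filter_upwards [hU.mem_nhds hx] with p hp
  rw [normSq, innerForms_eq_sum (hv.basis hp)]
  simp only [hv.basis_apply, hc]

end Smooth

variable [IsContMDiffRiemannianBundle (𝓡 n) ∞ (EuclideanSpace ℝ (Fin n))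
      (fun x : M => TangentSpace (𝓡 n) x)] {X : (x : M) → TangentSpace (𝓡 n) x}

theorem firstVarDensity_orthonormal (b : OrthonormalBasis ι ℝ (TangentSpace (𝓡 n) x))
    (hX : DiffFieldAt X x) : firstVarDensity z X x =
      2 * ∑ i, ∑ j, covSym hX (b i) (b j) * contractionForm (z x) (b i) (b j) -
        (∑ i, covSym hX (b i) (b i)) * normSq (z x) := by
  classical
  rw [firstVarDensity_eq b.toBasis z hX, OrthonormalBasis.coe_toBasis,
    gramMat_orthonormal b.orthonormal]
  simp [Matrix.trace]

theorem covSym_smul {f : M → ℝ} (hf : MDifferentiableAt (𝓡 n) 𝓘(ℝ, ℝ) f x)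
    (hX : DiffFieldAt X x) (hfX : DiffFieldAt (fun p => f p • X p) x)
    (u w : TangentSpace (𝓡 n) x) : covSym hfX u w =
      mvfderiv (𝓡 n) f x u * inner ℝ (X x) w + mvfderiv (𝓡 n) f x w * inner ℝ (X x) u +
        f x * covSym hX u w := by
  rw [covSym_apply, covSym_apply, inner_leviCivita_smul_field hf hX,
    inner_leviCivita_smul_field hf hX]
  ring

/-- The diagonal part of the symmetrized covariant derivative of a frame vector. -/
theorem covSym_frame (hv : IsOrthonormalFrameOn v U) (hU : IsOpen U) (hx : x ∈ U) (i j : ι) :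
    covSym (hv.diffFieldAt hU hx j) (v i x) (v i x) = -2 * conn v i i j x := by
  classical
  have h : mvfderiv (𝓡 n) (fun p => (inner ℝ (v j p) (v i p) : ℝ)) x (v i x) = 0 := by
    have hev : (fun p => (inner ℝ (v j p) (v i p) : ℝ)) =ᶠ[𝓝 x] fun _ => if j = i then 1 else 0 := by
      filter_upwards [hU.mem_nhds hx] with p hp
      exact orthonormal_iff_ite.1 (hv.2 p hp) j i
    rw [mvfderiv, hev.mfderiv_eq, mfderiv_const]
    rfl
  rw [mvfderiv_inner (hv.diffFieldAt hU hx j) (hv.diffFieldAt hU hx i)] at h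
  rw [covSym_apply, conn]
  linarith

/-- Diagonality of Q leaves only the diagonal entries of the symmetrized derivative of f v_j, which
are 2 v_j(f) δ_{ij} - 2 f γ^j_{ii}. -/
theorem firstVarDensity_smul_frame [DecidableEq ι] (hv : IsOrthonormalFrameOn v U)
    (hU : IsOpen U) (hx : x ∈ U) (hd : DiagonalizesOn v z U) {f : M → ℝ}
    (hf : MDifferentiableAt (𝓡 n) 𝓘(ℝ, ℝ) f x) (j : ι) :
    firstVarDensity z (fun p => f p • v j p) x =
      2 * mvfderiv (𝓡 n) f x (v j x) * (2 * normSq (intMul (v j x) (z x)) - normSq (z x)) -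
        2 * f x * ∑ i, conn v i i j x *
          (2 * normSq (intMul (v i x) (z x)) - normSq (z x)) := by
  have hX := hv.diffFieldAt hU hx j
  have hfX : DiffFieldAt (fun p => f p • v j p) x := hf.smul_section hX
  rw [firstVarDensity_orthonormal (hv.basis hx) hfX]
  simp only [hv.basis_apply]
  have h1 : ∀ i, ∑ m, covSym hfX (v i x) (v m x) * contractionForm (z x) (v i x) (v m x) =
      covSym hfX (v i x) (v i x) * normSq (intMul (v i x) (z x)) := by
    intro i
    refine (Finset.sum_eq_single i (fun m _ hm => ?_) (by simp)).trans rfl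
    rw [contractionForm_apply, hd x hx i m (Ne.symm hm), mul_zero]
  have h2 : ∀ i, covSym hfX (v i x) (v i x) =
      (if j = i then 2 * mvfderiv (𝓡 n) f x (v j x) else 0) + f x * (-2 * conn v i i j x) := by
    intro i
    rw [covSym_smul hf hX, covSym_frame hv hU hx, orthonormal_iff_ite.1 (hv.2 x hx) j i]
    split_ifs with h
    · subst h; ring
    · ring
  simp only [h1]
  rw [Finset.mul_sum, Finset.sum_mul, ← Finset.sum_sub_distrib]
  have h3 : ∀ i, 2 * (covSym hfX (v i x) (v i x) * normSq (intMul (v i x) (z x))) -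
      covSym hfX (v i x) (v i x) * normSq (z x) =
      (if j = i then 2 * mvfderiv (𝓡 n) f x (v j x) *
        (2 * normSq (intMul (v j x) (z x)) - normSq (z x)) else 0) -
      2 * f x * (conn v i i j x * (2 * normSq (intMul (v i x) (z x)) - normSq (z x))) := by
    intro i
    rw [h2]
    split_ifs with h
    · subst h; ring
    · ring
  simp only [h3]
  rw [Finset.sum_sub_distrib, Finset.sum_ite_eq, if_pos (Finset.mem_univ j), Finset.mul_sum]

/-- The coordinate formula for ∇ involves only continuous functions, in a single chart around `x`.
Continuity is needed to pass from integral to pointwise equations. -/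
theorem continuousAt_conn (hv : IsOrthonormalFrameOn v U) (hU : IsOpen U) (hx : x ∈ U)
    (i j k : ι) : ContinuousAt (conn v i j k) x := by
  set e := chartAt (EuclideanSpace ℝ (Fin n)) x with he
  have hxs : x ∈ e.source := mem_chart_source _ x
  have hy : e x ∈ e.target := e.map_source hxs
  have hcr : ∀ i, ContDiffAt ℝ ∞ (coordRep x (v i)) (e x) := fun i =>
    contDiffAt_coordRep hy (by rw [e.left_inv hxs]; exact hv.contMDiffAt hU hx i)
  have hloc : ContinuousAt (fun y => localConn (chartMetric x) (coordRep x (v j)) y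
      (coordRep x (v i) y) (coordRep x (v k) y)) (e x) :=
    continuousAt_localConn ((contDiffAt_chartMetric hy).of_le (by norm_cast))
      ((hcr j).of_le (by norm_cast)) (hcr i).continuousAt (hcr k).continuousAt
  refine (ContinuousAt.comp (f := e) hloc (e.continuousAt hxs)).congr ?_
  filter_upwards [hU.mem_nhds hx, e.open_source.mem_nhds hxs] with p hp hps
  have hpt := e.map_source hps
  have hd : DiffFieldAt (v j) (e.symm (e p)) := by
    rw [e.left_inv hps]
    exact hv.diffFieldAt hU hp j
  have h := inner_leviCivita_chartD hpt hd (coordRep x (v i) (e p)) (coordRep x (v k) (e p))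
  rw [chartD_coordRep hpt, chartD_coordRep hpt] at h
  rw [Function.comp, ← h, conn]
  rw [e.left_inv hps]

theorem continuousAt_mvfderiv_frame (hv : IsOrthonormalFrameOn v U) (hU : IsOpen U) (hx : x ∈ U)
    {f : M → ℝ} (hf : ∀ p ∈ U, ContMDiffAt (𝓡 n) 𝓘(ℝ, ℝ) ∞ f p) (j : ι) :
    ContinuousAt (fun p => mvfderiv (𝓡 n) f p (v j p)) x := by
  set e := chartAt (EuclideanSpace ℝ (Fin n)) x with he
  have hxs : x ∈ e.source := mem_chart_source _ x
  have hy : e x ∈ e.target := e.map_source hxs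
  have hcr : ContDiffAt ℝ ∞ (coordRep x (v j)) (e x) :=
    contDiffAt_coordRep hy (by rw [e.left_inv hxs]; exact hv.contMDiffAt hU hx j)
  have hfc : ContDiffAt ℝ ∞ (f ∘ e.symm) (e x) := by
    have h1 : ContMDiffAt (𝓡 n) 𝓘(ℝ, ℝ) ∞ f (e.symm (e x)) := by
      rw [e.left_inv hxs]
      exact hf x hx
    exact contMDiffAt_iff_contDiffAt.1 (h1.comp (e x) (contMDiffAt_chart_symm hy))
  have hloc : ContinuousAt (fun y => fderiv ℝ (f ∘ e.symm) y (coordRep x (v j) y)) (e x) :=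
    (hfc.fderiv_right (m := 0) (by norm_num)).continuousAt.clm_apply hcr.continuousAt
  refine (ContinuousAt.comp (f := e) hloc (e.continuousAt hxs)).congr ?_
  filter_upwards [hU.mem_nhds hx, e.open_source.mem_nhds hxs] with p hp hps
  have hpt := e.map_source hps
  have hd : MDifferentiableAt (𝓡 n) 𝓘(ℝ, ℝ) f (e.symm (e p)) := by
    rw [e.left_inv hps]
    exact (hf p hp).mdifferentiableAt (by simp)
  have h := mvfderiv_chartD hpt hd (coordRep x (v j) (e p))
  rw [chartD_coordRep hpt] at h
  rw [Function.comp, ← h]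
  rw [e.left_inv hps]

end Frame

section OneForm

variable {V : Type*} [NormedAddCommGroup V] [InnerProductSpace ℝ V]

theorem intMul_oneForm (v : V) : intMul v (oneForm : Forms V) = 0 := by
  funext k
  ext w
  simp [intMul, oneForm]

variable [FiniteDimensional ℝ V]

theorem innerForms_zero_left (β : Forms V) : innerForms 0 β = 0 := by
  have := innerForms_smul_left 0 (0 : Forms V) β
  rwa [zero_smul, zero_mul] at this

theorem normSq_zero : normSq (0 : Forms V) = 0 := innerForms_zero_left 0

end OneForm

/-! ### From the integral identity to the pointwise equations -/

section Pointwise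

variable {n : ℕ} {M : Type*} [TopologicalSpace M] [T2Space M] [CompactSpace M]
  [ChartedSpace (EuclideanSpace ℝ (Fin n)) M] [IsManifold (𝓡 n) ∞ M]
  [RiemannianBundle (fun x : M => TangentSpace (𝓡 n) x)]
  [IsContMDiffRiemannianBundle (𝓡 n) ∞ (EuclideanSpace ℝ (Fin n))
      (fun x : M => TangentSpace (𝓡 n) x)] [MeasurableSpace M] [BorelSpace M]
  {ι : Type*} [Fintype ι] {v : ι → (x : M) → TangentSpace (𝓡 n) x}
  {z : (x : M) → Forms (TangentSpace (𝓡 n) x)} {U : Set M}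

/-- A continuous function that is orthogonal to the smooth functions supported near a point
vanishes at this point. -/
theorem eq_zero_of_forall_integral_mul_eq_zero {O : Set M} (hO : IsOpen O) {T : M → ℝ} {x : M}
    (hx : x ∈ O) (hT : ∀ p ∈ O, ContinuousAt T p)
    (h : ∀ f : M → ℝ, ContMDiff (𝓡 n) 𝓘(ℝ, ℝ) ∞ f → tsupport f ⊆ O →
      Integrable (fun p => f p * T p) (riemVol n M) ∧ ∫ p, f p * T p ∂riemVol n M = 0) :
    T x = 0 := by
  by_contra hne
  -- Multiplication by `T x` makes the integrand nonnegative whatever the sign of `T x`.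
  have hev : ∀ᶠ p in 𝓝 x, 0 < T x * T p := by
    have hc : ContinuousAt (fun p => T x * T p) x := continuousAt_const.mul (hT x hx)
    exact hc.eventually (lt_mem_nhds (mul_self_pos.2 hne))
  obtain ⟨V, hVsub, hV, hxV⟩ := mem_nhds_iff.1 (inter_mem hev (hO.mem_nhds hx))
  obtain ⟨f, hf, hf1, hfs, hf0⟩ := exists_cutoff (n := n) (isClosed_singleton (x := x)) hV
    (singleton_subset_iff.2 hxV)
  obtain ⟨hi, h0⟩ := h f hf fun p hp => (hVsub (hfs hp)).2
  have hpos : ∀ p, 0 ≤ T x * (f p * T p) := by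
    intro p
    by_cases hp : p ∈ V
    · have : 0 < T x * T p := (hVsub hp).1
      nlinarith [mul_nonneg (hf0 p) this.le]
    · rw [image_eq_zero_of_notMem_tsupport fun hm => hp (hfs hm)]
      simp
  have hae := (integral_eq_zero_iff_of_nonneg hpos (hi.const_mul (T x))).1
    (by rw [integral_const_mul, h0, mul_zero])
  have hnear : ∀ᶠ p in 𝓝 x, T x * (f p * T p) ≠ 0 := by
    filter_upwards [hf1 x (mem_singleton x), hev] with p hp1 hp2
    rw [hp1, one_mul]
    exact hp2.ne'
  exact (Measure.measure_pos_of_mem_nhds (riemVol n M) hnear).ne' (ae_iff.1 hae)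

/-- The density of f v_j for `z` contains v_j(f). Adding the density of 2 f q v_j for the form 1,
whose integral is zero, removes this derivative and leaves a multiple of f T. -/
theorem pointwiseEq_of_firstVar_eq_zero (hz : IsL2Form z)
    (h : ∀ X : (x : M) → TangentSpace (𝓡 n) x, SmoothField X → firstVar z X = 0)
    (hU : IsOpen U) (hzU : SmoothFormOn z U) (hv : IsOrthonormalFrameOn v U)
    (hd : DiagonalizesOn v z U) {x : M} (hx : x ∈ U) : PointwiseEq v z x := by
  classical
  intro j
  set q : M → ℝ := fun p => normSq (intMul (v j p) (z p)) - (1 / 2) * normSq (z p) with hq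
  have hNs : ∀ p ∈ U, ContMDiffAt (𝓡 n) 𝓘(ℝ, ℝ) ∞ (fun x => normSq (z x)) p := fun p hp =>
    contMDiffAt_normSq hzU hU hp hv
  have hNi : ∀ i, ∀ p ∈ U, ContMDiffAt (𝓡 n) 𝓘(ℝ, ℝ) ∞
      (fun x => normSq (intMul (v i x) (z x))) p := fun i p hp =>
    contMDiffAt_normSq_intMul hzU hU hp hv i
  have hqs : ∀ p ∈ U, ContMDiffAt (𝓡 n) 𝓘(ℝ, ℝ) ∞ q p := fun p hp =>
    (hNi j p hp).sub (contMDiffAt_const.mul (hNs p hp))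
  set T : M → ℝ := fun p => ∑ m, conn v m m j p * (normSq (intMul (v j p) (z p)) -
    normSq (intMul (v m p) (z p))) - mvfderiv (𝓡 n) q p (v j p) with hTdef
  have hTc : ∀ p ∈ U, ContinuousAt T p := by
    intro p hp
    refine ContinuousAt.sub (tendsto_finsetSum _ fun m _ => ?_)
      (continuousAt_mvfderiv_frame hv hU hp hqs j)
    exact (continuousAt_conn hv hU hp m m j).mul
      ((hNi j p hp).continuousAt.sub (hNi m p hp).continuousAt)
  set e := chartAt (EuclideanSpace ℝ (Fin n)) x with he
  -- Test functions supported here give fields supported in one chart, where the integrability and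
  -- divergence results apply.
  have hO : IsOpen (U ∩ e.source) := hU.inter e.open_source
  suffices hT0 : T x = 0 by
    have : T x = _ - _ := rfl
    linarith
  refine eq_zero_of_forall_integral_mul_eq_zero (n := n) hO ⟨hx, mem_chart_source _ x⟩
    (fun p hp => hTc p hp.1) fun f hf hfs => ?_
  have hK : IsCompact (tsupport f) := (isClosed_tsupport f).isCompact
  have hKs : tsupport f ⊆ e.source := fun p hp => (hfs hp).2
  have hKU : tsupport f ⊆ U := fun p hp => (hfs hp).1
  set g : M → ℝ := fun p => f p * (2 * q p) with hg
  have hX : SmoothField (fun p => f p • v j p) :=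
    ContMDiffOn.smul_section_of_tsupport hf.contMDiffOn hU hKU (hv.1.contMDiffOn j)
  have hW : SmoothField (fun p => g p • v j p) := by
    refine ContMDiffOn.smul_section_of_tsupport (ψ := g) (s := v j)
      (fun p hp => ContMDiffAt.contMDiffWithinAt ?_) hU ?_ (hv.1.contMDiffOn j)
    · exact hf.contMDiffAt.mul (contMDiffAt_const.mul (hqs p hp))
    · exact (tsupport_mul_subset_left (f := f) (g := fun p => 2 * q p)).trans hKU
  have hf0 : ∀ p ∉ tsupport f, f p = 0 := fun p hp => image_eq_zero_of_notMem_tsupport hp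
  have hX0 : ∀ p ∉ tsupport f, f p • v j p = 0 := fun p hp => by rw [hf0 p hp, zero_smul]
  have hW0 : ∀ p ∉ tsupport f, g p • v j p = 0 := fun p hp => by
    simp only [hg]
    rw [hf0 p hp, zero_mul, zero_smul]
  obtain ⟨hi1, -⟩ := exists_flow_hasDerivAt_energy hz hX hK hKs hX0
  obtain ⟨hi2, hW1⟩ := firstVar_oneForm hW hK hKs hW0
  have hd1 : DiagonalizesOn v (fun x : M => (oneForm : Forms (TangentSpace (𝓡 n) x))) U := by
    intro p _ i m _
    rw [intMul_oneForm, innerForms_zero_left]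
  -- With q = |i_{v_j} z|² - ½|z|², the first density contributes 4 q v_j(f) and the second -4 q
  -- v_j(f) - 4 f v_j(q) besides connection terms. In the latter |z|² cancels, and the sum is 4 f T.
  have hsum : ∀ p, f p * T p = 1 / 4 * (firstVarDensity z (fun p => f p • v j p) p +
      firstVarDensity (fun x : M => (oneForm : Forms (TangentSpace (𝓡 n) x)))
        (fun p => g p • v j p) p) := by
    intro p
    by_cases hp : p ∈ tsupport f
    · have hpU := hKU hp
      have hfd : MDifferentiableAt (𝓡 n) 𝓘(ℝ, ℝ) f p := hf.contMDiffAt.mdifferentiableAt (by simp)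
      have hqd : MDifferentiableAt (𝓡 n) 𝓘(ℝ, ℝ) q p := (hqs p hpU).mdifferentiableAt (by simp)
      have hqd2 : MDifferentiableAt (𝓡 n) 𝓘(ℝ, ℝ) (fun p => 2 * q p) p :=
        (contMDiffAt_const.mul (hqs p hpU)).mdifferentiableAt (n := ∞) (by simp)
      have hgd : MDifferentiableAt (𝓡 n) 𝓘(ℝ, ℝ) g p := hfd.mul hqd2
      rw [firstVarDensity_smul_frame hv hU hpU hd hfd, firstVarDensity_smul_frame hv hU hpU hd1 hgd]
      have hgv : mvfderiv (𝓡 n) g p (v j p) =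
          f p * (2 * mvfderiv (𝓡 n) q p (v j p)) + 2 * q p * mvfderiv (𝓡 n) f p (v j p) := by
        have e1 := DFunLike.congr_fun (mvfderiv_mul hfd hqd2) (v j p)
        have e2 := DFunLike.congr_fun (mvfderiv_mul (mdifferentiableAt_const (c := (2 : ℝ))) hqd)
          (v j p)
        simp only [mvfderiv_const, smul_apply, smul_eq_mul, smul_zero, add_zero] at e2
        simp only [add_apply, smul_apply, smul_eq_mul] at e1
        exact e1.trans (congrArg (fun r => f p * r + 2 * q p * _) e2)
      simp only [intMul_oneForm, normSq_zero, normSq_oneForm]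
      rw [hgv]
      have hs : ∑ m, conn v m m j p * (normSq (intMul (v j p) (z p)) -
          normSq (intMul (v m p) (z p))) =
          (∑ m, conn v m m j p) * normSq (intMul (v j p) (z p)) -
            ∑ m, conn v m m j p * normSq (intMul (v m p) (z p)) := by
        rw [Finset.sum_mul, ← Finset.sum_sub_distrib]
        exact Finset.sum_congr rfl fun m _ => by ring
      have hs2 : ∑ m, conn v m m j p * (2 * normSq (intMul (v m p) (z p)) - normSq (z p)) =
          2 * ∑ m, conn v m m j p * normSq (intMul (v m p) (z p)) -
            (∑ m, conn v m m j p) * normSq (z p) := by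
        rw [Finset.sum_mul, Finset.mul_sum, ← Finset.sum_sub_distrib]
        exact Finset.sum_congr rfl fun m _ => by ring
      have hs3 : ∑ m, conn v m m j p * (2 * 0 - 1) = -∑ m, conn v m m j p := by
        rw [← Finset.sum_mul]
        ring
      rw [hs2, hs3]
      simp only [hTdef]
      rw [hs]
      simp only [hg, hq]
      ring
    · have hev : ∀ᶠ p in 𝓝 p, f p = 0 :=
        notMem_tsupport_iff_eventuallyEq.1 hp
      rw [hf0 p hp, firstVarDensity_eq_zero, firstVarDensity_eq_zero]
      · simp
      · filter_upwards [hev] with p hp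
        simp only [hg]
        rw [hp, zero_mul, zero_smul]
      · filter_upwards [hev] with p hp
        rw [hp, zero_smul]
  simp only [hsum]
  refine ⟨(hi1.add hi2).const_mul _, ?_⟩
  rw [integral_const_mul, integral_add hi1 hi2]
  have e1 : ∫ p, firstVarDensity z (fun p => f p • v j p) p ∂riemVol n M = 0 := h _ hX
  have e2 : ∫ p, firstVarDensity (fun x : M => (oneForm : Forms (TangentSpace (𝓡 n) x)))
      (fun p => g p • v j p) p ∂riemVol n M = 0 := hW1
  rw [e1, e2]
  simp

end Pointwise

/-! ### Forms of degree two in dimension four -/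

section FourDim

variable {V : Type*} [NormedAddCommGroup V] [InnerProductSpace ℝ V]

theorem extMul_smul_right (w : V →L[ℝ] ℝ) (r : ℝ) (α : Forms V) :
    extMul w (r • α) = r • extMul w α := by
  funext k
  rcases k with _ | k
  · simp [extMul]
  · ext u
    simp [extMul, wedgeLeft_apply, Finset.mul_sum]
    exact Finset.sum_congr rfl fun i _ => by ring

/-- The form `a e₀ ∧ e₁ + b e₂ ∧ e₃`. -/
def biplaneForm (e : Fin 4 → V) (a b : ℝ) : Forms V :=
  a • extMul (flat (e 0)) (extMul (flat (e 1)) oneForm) +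
    b • extMul (flat (e 2)) (extMul (flat (e 3)) oneForm)

theorem intMul_extMul_oneForm (v w : V) :
    intMul v (extMul (flat w) oneForm) = (inner ℝ w v : ℝ) • (oneForm : Forms V) := by
  rw [intMul_extMul, intMul_oneForm]
  have : extMul (flat w) (0 : Forms V) = 0 := by
    have := extMul_smul_right (flat w) 0 (0 : Forms V)
    simpa using this
  rw [this, sub_zero]
  rfl

theorem intMul_extMul_extMul (v w w' : V) :
    intMul v (extMul (flat w) (extMul (flat w') oneForm)) =
      (inner ℝ w v : ℝ) • extMul (flat w') oneForm -
        (inner ℝ w' v : ℝ) • extMul (flat w) oneForm := by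
  rw [intMul_extMul, intMul_extMul_oneForm, extMul_smul_right]
  rfl

theorem intMul_biplaneForm (v : V) (e : Fin 4 → V) (a b : ℝ) :
    intMul v (biplaneForm e a b) =
      a • ((inner ℝ (e 0) v : ℝ) • extMul (flat (e 1)) oneForm -
        (inner ℝ (e 1) v : ℝ) • extMul (flat (e 0)) oneForm) +
      b • ((inner ℝ (e 2) v : ℝ) • extMul (flat (e 3)) oneForm -
        (inner ℝ (e 3) v : ℝ) • extMul (flat (e 2)) oneForm) := by
  rw [biplaneForm, intMul_add_right, intMul_smul_right, intMul_smul_right, intMul_extMul_extMul,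
    intMul_extMul_extMul]

variable [FiniteDimensional ℝ V]

theorem innerForms_extMul_oneForm (v w : V) :
    innerForms (extMul (flat v) oneForm) (extMul (flat w) oneForm) = inner ℝ v w := by
  rw [innerForms_extMul, intMul_extMul_oneForm, innerForms_smul_left]
  have : innerForms (oneForm : Forms V) oneForm = 1 := normSq_oneForm
  rw [this, mul_one]

/-- Contraction with a frame vector leaves ±a or ±b times the covector of its partner in the same
plane. Distinct frame vectors have distinct partners, so Q is diagonal. -/
theorem innerForms_intMul_biplaneForm {e : Fin 4 → V} (he : Orthonormal ℝ e) (a b : ℝ)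
    (i j : Fin 4) : innerForms (intMul (e i) (biplaneForm e a b))
      (intMul (e j) (biplaneForm e a b)) = if i = j then ![a ^ 2, a ^ 2, b ^ 2, b ^ 2] i else 0 := by
  have h := orthonormal_iff_ite.1 he
  rw [intMul_biplaneForm, intMul_biplaneForm]
  simp only [← innerFormsₗ_apply, map_add, map_smul, map_sub, LinearMap.add_apply,
    LinearMap.smul_apply, LinearMap.sub_apply, smul_eq_mul]
  simp only [innerFormsₗ_apply, innerForms_extMul_oneForm, h]
  fin_cases i <;> fin_cases j <;> simp <;> ring

/-- Moving one exterior factor of each term across by adjointness reduces the norm to inner products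
of covectors. -/
theorem normSq_biplaneForm {e : Fin 4 → V} (he : Orthonormal ℝ e) (a b : ℝ) :
    normSq (biplaneForm e a b) = a ^ 2 + b ^ 2 := by
  have h := orthonormal_iff_ite.1 he
  have h1 : ∀ β : Forms V, innerForms (biplaneForm e a b) β =
      a * innerForms (intMul (e 0) β) (extMul (flat (e 1)) oneForm) +
        b * innerForms (intMul (e 2) β) (extMul (flat (e 3)) oneForm) := by
    intro β
    rw [biplaneForm, innerForms_add_left, innerForms_smul_left, innerForms_smul_left,
      innerForms_comm _ β, innerForms_comm _ β, innerForms_extMul (α := β), innerForms_extMul (α := β)]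
  rw [normSq, h1, intMul_biplaneForm, intMul_biplaneForm]
  simp only [← innerFormsₗ_apply, map_add, map_smul, map_sub, LinearMap.add_apply,
    LinearMap.smul_apply, LinearMap.sub_apply, smul_eq_mul]
  simp only [innerFormsₗ_apply, innerForms_extMul_oneForm, h]
  simp
  ring

end FourDim

/-! ### The gradient equation for a w¹ ∧ w² + b w³ ∧ w⁴ -/

section Gradient

variable {n : ℕ} {M : Type*} [TopologicalSpace M] [ChartedSpace (EuclideanSpace ℝ (Fin n)) M]
  [IsManifold (𝓡 n) ∞ M] {x : M}

theorem mvfderiv_log_sqrt {h : M → ℝ} (hh : MDifferentiableAt (𝓡 n) 𝓘(ℝ, ℝ) h x) (hpos : 0 < h x)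
    (v : TangentSpace (𝓡 n) x) :
    mvfderiv (𝓡 n) (fun p => Real.log (Real.sqrt (h p))) x v =
      1 / 2 * (h x)⁻¹ * mvfderiv (𝓡 n) h x v := by
  have hd : HasDerivAt (fun r => Real.log (Real.sqrt r)) (1 / 2 * (h x)⁻¹) (h x) := by
    refine ((Real.hasDerivAt_sqrt hpos.ne').log (Real.sqrt_pos.2 hpos).ne').congr_deriv ?_
    have := Real.mul_self_sqrt hpos.le
    rw [div_div, mul_assoc, this, one_div, mul_inv, one_div]
  have hm : MDifferentiableAt 𝓘(ℝ, ℝ) 𝓘(ℝ, ℝ) (fun r => Real.log (Real.sqrt r)) (h x) :=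
    hd.differentiableAt.mdifferentiableAt
  have key := mvfderiv_comp_apply x hm hh v
  refine key.trans ?_
  have h2 : mfderiv 𝓘(ℝ, ℝ) 𝓘(ℝ, ℝ) (fun r => Real.log (Real.sqrt r)) (h x) =
      ContinuousLinearMap.toSpanSingleton ℝ (1 / 2 * (h x)⁻¹) := by
    rw [mfderiv_eq_fderiv, hd.hasFDerivAt.fderiv]
  have h3 : ∀ s : ℝ, mvfderiv 𝓘(ℝ, ℝ) (fun r => Real.log (Real.sqrt r)) (h x) s =
      1 / 2 * (h x)⁻¹ * s := by
    intro s
    rw [mvfderiv, h2]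
    change s • (1 / 2 * (h x)⁻¹) = _
    rw [smul_eq_mul, mul_comm]
  exact h3 _

variable [RiemannianBundle (fun x : M => TangentSpace (𝓡 n) x)]

theorem inner_grad (f : M → ℝ) (w : TangentSpace (𝓡 n) x) :
    inner ℝ (grad f x) w = mvfderiv (𝓡 n) f x w := by
  conv_rhs => rw [← (stdOrthonormalBasis ℝ (TangentSpace (𝓡 n) x)).sum_repr' w]
  rw [grad, sum_inner, map_sum]
  refine Finset.sum_congr rfl fun j _ => ?_
  rw [map_smul, real_inner_smul_left, smul_eq_mul, mul_comm]

variable [T2Space M] [CompactSpace M] {e : Fin 4 → (x : M) → TangentSpace (𝓡 n) x}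
  {z : (x : M) → Forms (TangentSpace (𝓡 n) x)} {a b : M → ℝ} {U : Set M}

theorem diagonalizesOn_biplaneForm (he : IsOrthonormalFrameOn e U)
    (hz : ∀ x ∈ U, z x = biplaneForm (fun i => e i x) (a x) (b x)) : DiagonalizesOn e z U := by
  intro p hp i j hij
  rw [hz p hp, innerForms_intMul_biplaneForm (e := fun i => e i p) (he.2 p hp), if_neg hij]

/-- For a form `a w¹ ∧ w² + b w³ ∧ w⁴` the pointwise equations say that the gradient of
`log √(a² - b²)` is the sum of the mean curvature vectors of the two plane fields. -/
theorem pointwiseEq_iff_grad_eq (hU : IsOpen U) (hzU : SmoothFormOn z U)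
    (he : IsOrthonormalFrameOn e U)
    (hz : ∀ x ∈ U, z x = biplaneForm (fun i => e i x) (a x) (b x))
    (hab : ∀ x ∈ U, b x ^ 2 < a x ^ 2) (hx : x ∈ U) :
    PointwiseEq e z x ↔ grad (fun p => Real.log (Real.sqrt (a p ^ 2 - b p ^ 2))) x =
      meanCurvA e x + meanCurvB e x := by
  set h : M → ℝ := fun p => a p ^ 2 - b p ^ 2 with hh
  have hpos : 0 < h x := sub_pos.2 (hab x hx)
  have hN : ∀ p ∈ U, ∀ i, normSq (intMul (e i p) (z p)) =
      ![a p ^ 2, a p ^ 2, b p ^ 2, b p ^ 2] i := by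
    intro p hp i
    rw [hz p hp, normSq, innerForms_intMul_biplaneForm (e := fun i => e i p) (he.2 p hp), if_pos rfl]
  have hN0 : ∀ p ∈ U, normSq (z p) = a p ^ 2 + b p ^ 2 := by
    intro p hp
    rw [hz p hp, normSq_biplaneForm (e := fun i => e i p) (he.2 p hp)]
  -- No regularity of `a` and `b` is assumed; a² - b² is smooth because it equals |i_{e 0} z|² -
  -- |i_{e 2} z|².
  have hsm : MDifferentiableAt (𝓡 n) 𝓘(ℝ, ℝ) h x := by
    have h1 := ((contMDiffAt_normSq_intMul hzU hU hx he 0).sub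
      (contMDiffAt_normSq_intMul hzU hU hx he 2)).mdifferentiableAt (by simp)
    refine h1.congr_of_eventuallyEq ?_
    filter_upwards [hU.mem_nhds hx] with p hp
    rw [hN p hp, hN p hp]
    rfl
  have hdq : ∀ (j : Fin 4) (s : ℝ), (∀ p ∈ U, normSq (intMul (e j p) (z p)) -
      (1 / 2) * normSq (z p) = s * h p) → mvfderiv (𝓡 n)
        (fun p => normSq (intMul (e j p) (z p)) - (1 / 2) * normSq (z p)) x (e j x) =
        s * mvfderiv (𝓡 n) h x (e j x) := by
    intro j s hs
    have hev : (fun p => normSq (intMul (e j p) (z p)) - (1 / 2) * normSq (z p)) =ᶠ[𝓝 x]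
        (fun _ => s) * h := by
      filter_upwards [hU.mem_nhds hx] with p hp
      exact hs p hp
    have e1 : mvfderiv (𝓡 n)
        (fun p => normSq (intMul (e j p) (z p)) - (1 / 2) * normSq (z p)) x =
        mvfderiv (𝓡 n) ((fun _ => s) * h) x := by
      rw [mvfderiv, mvfderiv, hev.mfderiv_eq, hev.eq_of_nhds]
    rw [e1]
    have e2 := DFunLike.congr_fun (mvfderiv_mul (mdifferentiableAt_const (c := s)) hsm) (e j x)
    simpa only [mvfderiv_const, smul_apply, smul_eq_mul, smul_zero, add_zero] using e2
  have hgrad : grad (fun p => Real.log (Real.sqrt (a p ^ 2 - b p ^ 2))) x =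
      meanCurvA e x + meanCurvB e x ↔ ∀ j, 1 / 2 * (h x)⁻¹ * mvfderiv (𝓡 n) h x (e j x) =
        inner ℝ (meanCurvA e x + meanCurvB e x) (e j x) := by
    constructor
    · intro hg j
      rw [← hg, inner_grad, ← mvfderiv_log_sqrt hsm hpos]
    · intro hj
      refine InnerProductSpace.ext_inner_right_basis (𝕜 := ℝ) (he.basis hx).toBasis fun j => ?_
      rw [OrthonormalBasis.coe_toBasis, he.basis_apply, ← hj, inner_grad,
        ← mvfderiv_log_sqrt hsm hpos]
  rw [hgrad]
  have hon := orthonormal_iff_ite.1 (he.2 x hx)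
  have key : ∀ c d : ℝ, 1 / 2 * (h x)⁻¹ * d = c ↔ 1 / 2 * d = c * h x := by
    intro c d
    rw [mul_right_comm, ← div_eq_mul_inv, div_eq_iff hpos.ne']
  refine forall_congr' fun j => ?_
  rw [key]
  -- The left side of the pointwise equation is ½ e_j(h) in the first plane and -½ e_j(h) in the
  -- second. On the right only the two terms of the other plane survive, with the factor h or -h
  -- respectively.
  fin_cases j
  · rw [hdq _ (1 / 2) fun p hp => by rw [hN p hp, hN0 p hp]; simp [hh]; ring]
    simp only [Fin.sum_univ_four, hN x hx, meanCurvA, meanCurvB, inner_add_left,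
      real_inner_smul_left, hon]
    simp [hh]
    constructor <;> intro hc <;> linarith
  · rw [hdq _ (1 / 2) fun p hp => by rw [hN p hp, hN0 p hp]; simp [hh]; ring]
    simp only [Fin.sum_univ_four, hN x hx, meanCurvA, meanCurvB, inner_add_left,
      real_inner_smul_left, hon]
    simp [hh]
    constructor <;> intro hc <;> linarith
  · rw [hdq _ (-(1 / 2)) fun p hp => by rw [hN p hp, hN0 p hp]; simp [hh]; ring]
    simp only [Fin.sum_univ_four, hN x hx, meanCurvA, meanCurvB, inner_add_left,
      real_inner_smul_left, hon]
    simp [hh]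
    constructor <;> intro hc <;> linarith
  · rw [hdq _ (-(1 / 2)) fun p hp => by rw [hN p hp, hN0 p hp]; simp [hh]; ring]
    simp only [Fin.sum_univ_four, hN x hx, meanCurvA, meanCurvB, inner_add_left,
      real_inner_smul_left, hon]
    simp [hh]
    constructor <;> intro hc <;> linarith

end Gradient

end FirstVar

end

theorem mainTheorem4 {n : ℕ} {M : Type*} [TopologicalSpace M] [T2Space M] [CompactSpace M]
    [ChartedSpace (EuclideanSpace ℝ (Fin n)) M] [IsManifold (𝓡 n) ∞ M]
    [RiemannianBundle (fun x : M => TangentSpace (𝓡 n) x)]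
    [IsContMDiffRiemannianBundle (𝓡 n) ∞ (EuclideanSpace ℝ (Fin n))
      (fun x : M => TangentSpace (𝓡 n) x)]
    [MeasurableSpace M] [BorelSpace M]
    (z : (x : M) → FirstVar.Forms (TangentSpace (𝓡 n) x)) (hz : FirstVar.IsL2Form z) :
    (FirstVar.IsCritical z →
      ∀ X : (x : M) → TangentSpace (𝓡 n) x, FirstVar.SmoothField X → FirstVar.firstVar z X = 0) ∧
    ((∀ X : (x : M) → TangentSpace (𝓡 n) x, FirstVar.SmoothField X → FirstVar.firstVar z X = 0) →
      ∀ (U : Set M) (v : Fin n → (x : M) → TangentSpace (𝓡 n) x), IsOpen U →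
        FirstVar.SmoothFormOn z U → FirstVar.IsOrthonormalFrameOn v U →
        FirstVar.DiagonalizesOn v z U →
        ∀ x ∈ U, FirstVar.PointwiseEq v z x) ∧
    (n = 4 →
      ∀ (U : Set M) (e : Fin 4 → (x : M) → TangentSpace (𝓡 n) x) (a b : M → ℝ), IsOpen U →
        FirstVar.SmoothFormOn z U → FirstVar.IsOrthonormalFrameOn e U →
        (∀ x ∈ U, b x ^ 2 < a x ^ 2 ∧
          z x = a x • FirstVar.extMul (FirstVar.flat (e 0 x))
                  (FirstVar.extMul (FirstVar.flat (e 1 x)) FirstVar.oneForm)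
              + b x • FirstVar.extMul (FirstVar.flat (e 2 x))
                  (FirstVar.extMul (FirstVar.flat (e 3 x)) FirstVar.oneForm)) →
        (∀ x ∈ U, (FirstVar.PointwiseEq e z x ↔
          FirstVar.grad (fun p => Real.log (Real.sqrt (a p ^ 2 - b p ^ 2))) x =
            FirstVar.meanCurvA e x + FirstVar.meanCurvB e x)) ∧
        ((∀ X : (x : M) → TangentSpace (𝓡 n) x,
            FirstVar.SmoothField X → FirstVar.firstVar z X = 0) →
          ∀ x ∈ U, FirstVar.grad (fun p => Real.log (Real.sqrt (a p ^ 2 - b p ^ 2))) x =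
            FirstVar.meanCurvA e x + FirstVar.meanCurvB e x)) := by
  refine ⟨fun hc X hX => FirstVar.firstVar_eq_zero_of_isCritical hz hc hX,
    fun h U v hU hzU hv hd x hx =>
      FirstVar.pointwiseEq_of_firstVar_eq_zero hz h hU hzU hv hd hx, ?_⟩
  intro _ U e a b hU hzU he hzab
  have hiff := fun x (hx : x ∈ U) => FirstVar.pointwiseEq_iff_grad_eq hU hzU he
    (fun x hx => (hzab x hx).2) (fun x hx => (hzab x hx).1) hx
  -- The frame lemma allows any finite index type, so it applies to the frame indexed by `Fin 4`
  -- directly; diagonality comes from the shape of `z`.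
  exact ⟨hiff, fun h x hx => (hiff x hx).1 (FirstVar.pointwiseEq_of_firstVar_eq_zero hz h hU hzU he
    (FirstVar.diagonalizesOn_biplaneForm he fun x hx => (hzab x hx).2) hx)⟩
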